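/- **Theorem 4.1 (PT-ISABB is complete).** *Setting.* An ADCOP consists of a finite set of agents, agent $a_i$ controlling one variable $x_i$ with a finite non-empty ordered domain $D_i$, a constraint graph on the agents, and, for constrained agents $a_i,a_j$, private costs $f_{ij}(x_i,x_j)\ge 0$ (of $a_i$) and $f_{ji}(x_j,x_i)\ge 0$ (of $a_j$), not necessarily equal. The aggregated cost of a complete assignment is the sum of $f_{ij}+f_{ji}$ over all constraints. Let a pseudo tree be given: a rooted spanning tree consisting of edges of the constraint graph, such that every constraint joins an agent to one of its ancestors. $C(a_i)$ is the set of children, $AP(a_i)$ the set of ancestors constrained with $a_i$, $Sep(a_i)$ the set of ancestors constrained with $a_i$ or one of its descendants. Let $k\in\mathbb N\cup\{\infty\}$ be the dimension limit. *Inference phase of PT-ISABB.* Starting at the leaves, every non-root agent $a_i$, once it has the UTIL messages of all its children, sends its parent the table $\sum_{a_j\in AP(a_i)}f_{ij}+\sum_{c\in C(a_i)}Child\_util_i^c$; if the table has more than $k$ dimensions, only the $k$ deepest are kept and the others (the highest ancestors) are removed by minimization. On receiving the table $u_c$ of a child $a_c$, $a_i$ sets $Child\_util_i^c=\min_{x_c}(u_c+f_{ic})$.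 The root starts the search phase when it has all UTIL messages. *Search phase.* For a current partial assignment $Cpa$ of its ancestors and an upper bound $ub_i$ (empty and $\infty$ for the root), $a_i$ keeps: $high_i(d)$, initially $\sum_{a_j\in AP(a_i)}f_{ij}(d,Cpa(x_j))$; $lb_i^c(d)$, initially $Child\_util_i^c(Cpa_{[Sep(a_c)]},x_i=d)$; $lb_i(d)=high_i(d)+\sum_{c\in C(a_i)}lb_i^c(d)$; the value $Srch_i^c$ being explored in the subtree of child $a_c$; the set $Cmplt_i$ of values for which all children have backtracked ($D_i$ for a leaf); and $Spa_i(d)$, initially $\{x_i=d\}$. A value is feasible if $lb_i(d)<ub_i$. Let $lb_i^*=\min_{d\in Cmplt_i}lb_i(d)$ ($\infty$ if $Cmplt_i=\emptyset$), and let $d_i^*$ be the first value in $Cmplt_i$ attaining it. * The root lets all children explore the first value of its domain. * On a CPA message with $(Cpa,ub_i)$, $a_i$ initializes these data and takes its first feasible value. If there is none, it backtracks with cost $\infty$ and the empty assignment; otherwise all its children turn to this value and $a_i$ requests the costs for it from all agents of $AP(a_i)$. * On a cost request for $x_j=d$ from a descendant $a_j$ in the branch of child $a_c$, $a_i$ replies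 $f_{ij}(Srch_i^c,d)$. On a reply for $d$, the requester adds it to its $high(d)$. * When $a_i$ has all replies for $d$: a leaf sets $ub_i:=\min(ub_i,lb_i(d))$ and turns to its next feasible value. A non-leaf with $lb_i(d)<ub_i$ sends each child $a_c$ with $Srch_i^c=d$ a CPA message with $Cpa\cup\{x_i=d\}$ and the bound $ub_i-high_i(d)-\sum_{c'\ne c}lb_i^{c'}(d)$; if $lb_i(d)\ge ub_i$, these children instead turn to the next feasible value. * On a BACKTRACK message from $a_c$ for $d=Srch_i^c$ with cost $v$ and assignment $S$, $a_i$ sets $lb_i^c(d):=v$ and merges $S$ into $Spa_i(d)$; if all children have now backtracked for $d$, it sets $ub_i:=\min(ub_i,lb_i(d))$. Then $a_c$ turns to the next feasible value. * When children turn to a value: if all costs for it are known, they are sent CPA messages for it as above; otherwise the costs are requested unless this has already been done (a leaf requests the costs of the value it turns to in the same way). If there is no such value and all children have exhausted the domain of $a_i$, then $a_i$ sends its parent a BACKTRACK message with $lb_i^*$ and $Spa_i(d_i^*)$ (empty if $Cmplt_i=\emptyset$); the root instead terminates, sends TERMINATE messages down the tree and returns $Spa_{root}(d^*_{root})$. A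 root without children terminates and returns at once when the search phase starts. Messages are never lost; they are delivered one at a time, after arbitrary finite delays and in any order, and each is processed atomically. *Claim.* For every ADCOP, every pseudo tree, every $k$ and every order of delivery, PT-ISABB terminates: no execution is infinite, and an execution can only stop with all agents terminated. Once the root has terminated, the assignment it returns assigns to every variable a value of its domain, and its aggregated cost is minimal among all complete assignments. -/

import Mathlib

open scoped NNReal ENNReal

noncomputable section

namespace PTISABB

/-! ### Problems and pseudo trees -/

/-- An asymmetric distributed constraint optimization problem with one variable per agent and binary
constraints. `A` is the set of agents (= variables), `V` a linearly ordered set of values (an agent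
scans its domain in increasing order). The constraint graph says which pairs are constrained, and
`f i j d e` is the private cost of agent `i`, in its constraint with `j`, when `x_i = d`, `x_j = e`. -/
structure ADCOP (A V : Type*) where
  graph : SimpleGraph A
  dom : A → Finset V
  dom_nonempty : ∀ i, (dom i).Nonempty
  f : A → A → V → V → ℝ≥0

/-- `IsAncestor parent j i`: `j` is a proper ancestor of `i`. -/
def IsAncestor {A : Type*} (parent : A → Option A) (j i : A) : Prop :=
  Relation.TransGen (fun a b => parent b = some a) j i

/-- A pseudo tree of the constraint graph `G`: a rooted spanning tree whose (tree) edges are edges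
of `G`, such that every edge of `G` joins an agent to one of its ancestors. -/
structure PseudoTree {A : Type*} (G : SimpleGraph A) where
  root : A
  parent : A → Option A
  /-- the distance to the root -/
  level : A → ℕ
  parent_eq_none_iff : ∀ i, parent i = none ↔ i = root
  level_root : level root = 0
  level_parent : ∀ i p, parent i = some p → level i = level p + 1
  adj_parent : ∀ i p, parent i = some p → G.Adj i p
  adj_related : ∀ i j, G.Adj i j → IsAncestor parent i j ∨ IsAncestor parent j i

section Problem

variable {A V : Type*} [Fintype A]

open Classical in
/-- The aggregated cost of a complete assignment: both sides of every constraint are counted. -/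
def ADCOP.totalCost (P : ADCOP A V) (x : A → V) : ℝ≥0 :=
  ∑ i, ∑ j ∈ Finset.univ.filter (fun j => P.graph.Adj i j), P.f i j (x i) (x j)

/-- A complete assignment (each variable in its domain) of minimal aggregated cost. -/
def ADCOP.IsSolution (P : ADCOP A V) (x : A → V) : Prop :=
  (∀ i, x i ∈ P.dom i) ∧ ∀ y : A → V, (∀ i, y i ∈ P.dom i) → P.totalCost x ≤ P.totalCost y

variable {G : SimpleGraph A} (T : PseudoTree G)

open Classical in
/-- `C(a_i)` -/
def PseudoTree.children (i : A) : Finset A :=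
  Finset.univ.filter (fun c => T.parent c = some i)

open Classical in
/-- `AP(a_i)`: the parent and the pseudo parents, i.e. all ancestors constrained with `a_i`. -/
def PseudoTree.allParents (i : A) : Finset A :=
  Finset.univ.filter (fun j => G.Adj i j ∧ IsAncestor T.parent j i)

open Classical in
/-- `Sep(a_i)`: the ancestors of `a_i` constrained with `a_i` or with a descendant of `a_i`. -/
def PseudoTree.sep (i : A) : Finset A :=
  Finset.univ.filter (fun j => IsAncestor T.parent j i ∧
    ∃ l, (l = i ∨ IsAncestor T.parent i l) ∧ G.Adj l j)

open Classical in
/-- The child of `i` whose subtree contains the descendant `j` of `i`. -/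
def PseudoTree.branch (i j : A) : Option A :=
  if h : ∃ c, T.parent c = some i ∧ (c = j ∨ IsAncestor T.parent c j) then some h.choose else none

end Problem

/-! ### Partial assignments and utility tables -/

/-- A partial assignment; `none` marks an unassigned variable. -/
abbrev PAssign (A V : Type*) := A → Option V

/-- A utility table: its set of dimensions and its entries. The entries only depend on the values of
the dimensions for all tables built below. -/
structure Util (A V : Type*) where
  dims : Finset A
  val : PAssign A V → ℝ≥0

section Tables

variable {A V : Type*} [Fintype A] [DecidableEq A]

/-- The table without dimensions and with the entry `0`. -/
def Util.zero : Util A V := ⟨∅, fun _ => 0⟩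

/-- The join `⊗` of two tables. -/
def Util.join (u v : Util A V) : Util A V := ⟨u.dims ∪ v.dims, fun x => u.val x + v.val x⟩

/-- `f_ij`, read at two values of a partial assignment (both are assigned whenever it is used). -/
def ADCOP.privCost (P : ADCOP A V) (i j : A) : Option V → Option V → ℝ≥0
  | some d, some e => P.f i j d e
  | _, _ => 0

/-- `f_ij` as a table over `x_i` and `x_j`. -/
def ADCOP.costTable (P : ADCOP A V) (i j : A) : Util A V :=
  ⟨{i, j}, fun x => P.privCost i j (x i) (x j)⟩

/-- Minimal projection: the dimensions in `S` are minimized out of the table. -/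
def ADCOP.minProj (P : ADCOP A V) (S : Finset A) (u : Util A V) : Util A V :=
  ⟨u.dims \ S, fun x => (Fintype.piFinset P.dom).inf' (Fintype.piFinset_nonempty.2 P.dom_nonempty)
    (fun y => u.val (fun j => if j ∈ S then some (y j) else x j))⟩

variable (P : ADCOP A V) (T : PseudoTree P.graph)

/-- `local_util_i`: the join of the `f_ij` over `a_j ∈ AP(a_i)`. -/
def localUtil (i : A) : Util A V :=
  ⟨(T.allParents i).biUnion (fun j => {i, j}),
    fun x => ∑ j ∈ T.allParents i, (P.costTable i j).val x⟩

/-- Dropping dimensions to stay within the limit `k`: the `k` deepest dimensions are kept and those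
of the highest ancestors are removed by a minimal projection. -/
def dropDims (k : ℕ∞) (u : Util A V) : Util A V :=
  P.minProj (u.dims.filter fun j =>
    k ≤ ((u.dims.filter fun l => T.level j < T.level l).card : ℕ∞)) u

end Tables

/-! ### Messages, local states and configurations -/

/-- The messages; the sender and the receiver are recorded in `Packet`. -/
inductive Msg (A V : Type*) where
  /-- UTIL: a utility table for the parent -/
  | util (u : Util A V)
  /-- CPA: a partial assignment and an upper bound for a child -/
  | cpa (pa : PAssign A V) (ub : ℝ≥0∞)
  /-- COST_REQ: asks a (pseudo) parent for its private cost for the sender's value `d` -/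
  | costReq (d : V)
  /-- COST: the reply to COST_REQ -/
  | cost (d : V) (v : ℝ≥0)
  /-- BACKTRACK: best cost and best subproblem assignment, for the parent -/
  | backtrack (v : ℝ≥0∞) (pa : PAssign A V)
  /-- TERMINATE -/
  | terminate

structure Packet (A V : Type*) where
  src : A
  dst : A
  msg : Msg A V

/-- The local state of an agent `a_i`. -/
structure AgentState (A V : Type*) where
  /-- `Child_util_i^c`, once the UTIL message of the child has arrived -/
  childUtil : A → Option (Util A V)
  /-- `Cpa` -/
  cpa : PAssign A V
  /-- `ub_i` -/
  ub : ℝ≥0∞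
  /-- `high_cost_i(d)` -/
  high : V → ℝ≥0
  /-- `lb_i^c(d)` -/
  lbc : A → V → ℝ≥0∞
  /-- `Srch_val_i^c`; `none` when the child has exhausted the domain of `a_i` -/
  srch : A → Option V
  /-- the values for which COST_REQ messages were sent under the current `Cpa` -/
  requested : Finset V
  /-- the (pseudo) parents whose COST message for `d` has arrived -/
  gotCost : V → Finset A
  /-- the children whose BACKTRACK message for `d` has arrived -/
  gotBack : V → Finset A
  /-- `Spa_i(d)` -/
  spa : V → PAssign A V
  terminated : Prop

/-- A global configuration: the local states and the messages in transit. -/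
structure Config (A V : Type*) where
  agents : A → AgentState A V
  net : Multiset (Packet A V)

/-- The state of an agent before the start. -/
def AgentState.blank {A V : Type*} : AgentState A V where
  childUtil := fun _ => none
  cpa := fun _ => none
  ub := ⊤
  high := fun _ => 0
  lbc := fun _ _ => 0
  srch := fun _ => none
  requested := ∅
  gotCost := fun _ => ∅
  gotBack := fun _ => ∅
  spa := fun _ _ => none
  terminated := False

/-! ### The algorithm -/

section Algorithm

variable {A V : Type*} [Fintype A] [DecidableEq A] [LinearOrder V]

/-- The first element of a set of values, if there is one. -/
def first (S : Finset V) : Option V := if h : S.Nonempty then some (S.min' h) else none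

variable (P : ADCOP A V) (T : PseudoTree P.graph)

/-- `lb_i(d)` -/
def lb (i : A) (st : AgentState A V) (d : V) : ℝ≥0∞ :=
  st.high d + ∑ c ∈ T.children i, st.lbc c d

/-- `Cmplt_vals_i`; the whole domain for a leaf. -/
def cmplt (i : A) (st : AgentState A V) : Finset V :=
  (P.dom i).filter (fun d => T.children i ⊆ st.gotBack d)

/-- `lb_i^*`; `∞` if no value is complete. -/
def bestCost (i : A) (st : AgentState A V) : ℝ≥0∞ := (cmplt P T i st).inf (lb P T i st)

/-- `d_i^*`, the first complete value of minimal lower bound. -/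
def bestVal (i : A) (st : AgentState A V) : Option V :=
  first ((cmplt P T i st).filter (fun d => lb P T i st d = bestCost P T i st))

/-- `Spa_i(d_i^*)`; empty if no value is complete. -/
def bestSpa (i : A) (st : AgentState A V) : PAssign A V :=
  match bestVal P T i st with
  | some d => st.spa d
  | none => fun _ => none

/-- The first feasible value. -/
def firstFeasible (i : A) (st : AgentState A V) : Option V :=
  first ((P.dom i).filter (fun e => lb P T i st e < st.ub))

/-- The next feasible value after `d`. -/
def nextFeasible (i : A) (st : AgentState A V) (d : V) : Option V :=
  first ((P.dom i).filter (fun e => d < e ∧ lb P T i st e < st.ub))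

/-- What an agent does when the search below it is over: the root terminates and tells its children
to do so, any other agent backtracks with its best cost and its best subproblem assignment. -/
def finish (i : A) (st : AgentState A V) : AgentState A V × Multiset (Packet A V) :=
  match T.parent i with
  | none => ({ st with terminated := True },
      (T.children i).val.map fun c => ⟨i, c, .terminate⟩)
  | some p => (st, {⟨i, p, .backtrack (bestCost P T i st) (bestSpa P T i st)⟩})

/-- The CPA messages to the children in `S`, which are going to explore `d`. The upper bound for a
child is what remains of `ub_i` after deducting `high_cost_i(d)` and the lower bounds of the other
children (the message is only sent when `lb_i(d) < ub_i`, so the subtraction is never truncated). -/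
def sendCPA (i : A) (st : AgentState A V) (d : V) (S : Finset A) : Multiset (Packet A V) :=
  S.val.map fun c => ⟨i, c, .cpa (Function.update st.cpa i (some d))
    (st.ub - (st.high d + ∑ c' ∈ (T.children i).erase c, st.lbc c' d))⟩

/-- The children in `S` switch to the value `e`, the next one that is feasible. If there is no such
value and all children have exhausted the domain, the search below `a_i` is over. If there is one,
they are sent CPA messages when all costs for it are known; otherwise these costs are requested,
if that has not been done. -/
def advance (i : A) (st₀ : AgentState A V) (S : Finset A) (e : Option V) :
    AgentState A V × Multiset (Packet A V) :=
  let st : AgentState A V := { st₀ with srch := fun c => if c ∈ S then e else st₀.srch c }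
  match e with
  | none => if ∀ c ∈ T.children i, st.srch c = none then finish P T i st else (st, 0)
  | some d =>
    if T.allParents i ⊆ st.gotCost d then (st, sendCPA P T i st d S)
    else if d ∈ st.requested then (st, 0)
    else ({ st with requested := insert d st.requested },
      (T.allParents i).val.map fun j => ⟨i, j, .costReq d⟩)

/-- The search data structures for a new `Cpa` and a new upper bound. -/
def initSearch (i : A) (st : AgentState A V) (cpa : PAssign A V) (ub : ℝ≥0∞) : AgentState A V :=
  { st with
    cpa := cpa
    ub := ub
    high := fun d => ∑ j ∈ T.allParents i, P.privCost i j (some d) (cpa j)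
    lbc := fun c d => (((st.childUtil c).getD Util.zero).val
      (Function.update (fun j => if j ∈ T.sep c then cpa j else none) i (some d)) : ℝ≥0)
    srch := fun _ => none
    requested := ∅
    gotCost := fun _ => ∅
    gotBack := fun _ => ∅
    spa := fun d => Function.update (fun _ => none) i (some d) }

/-- The root starts the search with the first element of its domain. (A root without children is a
leaf and has nothing to explore.) -/
def startSearch (i : A) (st₀ : AgentState A V) : AgentState A V × Multiset (Packet A V) :=
  let st := initSearch P T i st₀ (fun _ => none) ⊤
  if T.children i = ∅ then finish P T i st
  else advance P T i st (T.children i) (first (P.dom i))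

/-- The bottom-up step of the inference phase, taken as soon as the UTIL messages of all children
have arrived (for a leaf: at the start). -/
def inferenceStep (k : ℕ∞) (i : A) (st : AgentState A V) :
    AgentState A V × Multiset (Packet A V) :=
  if ∀ c ∈ T.children i, (st.childUtil c).isSome then
    match T.parent i with
    | none => startSearch P T i st
    | some p =>
      let u : Util A V :=
        ⟨(localUtil P T i).dims ∪
            (T.children i).biUnion (fun c => ((st.childUtil c).getD Util.zero).dims),
          fun x => (localUtil P T i).val x +
            ∑ c ∈ T.children i, ((st.childUtil c).getD Util.zero).val x⟩
      (st, {⟨i, p, .util (dropDims P T k u)⟩})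
  else (st, 0)

/-- Receipt of a UTIL message from the child `c`: it is joined with `f_ic` and `x_c` is eliminated. -/
def onUtil (k : ℕ∞) (i : A) (st : AgentState A V) (c : A) (u : Util A V) :
    AgentState A V × Multiset (Packet A V) :=
  inferenceStep P T k i { st with
    childUtil := Function.update st.childUtil c (some (P.minProj {c} (u.join (P.costTable i c)))) }

/-- Receipt of a CPA message (from the parent). -/
def onCPA (i : A) (st₀ : AgentState A V) (p : A) (cpa : PAssign A V) (ub : ℝ≥0∞) :
    AgentState A V × Multiset (Packet A V) :=
  let st := initSearch P T i st₀ cpa ub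
  match firstFeasible P T i st with
  | none => (st, {⟨i, p, .backtrack ⊤ (fun _ => none)⟩})
  | some d => advance P T i st (T.children i) (some d)

/-- Receipt of a COST_REQ message from the descendant `j` for `x_j = d`: the reply is the private
cost `f_ij` for the value of `x_i` being explored in the branch of `j`. -/
def onCostReq (i : A) (st : AgentState A V) (j : A) (d : V) :
    AgentState A V × Multiset (Packet A V) :=
  (st, {⟨i, j, .cost d (P.privCost i j ((T.branch i j).bind st.srch) (some d))⟩})

/-- Receipt of a COST message for `d` from the (pseudo) parent `j`. When it is the last one for `d`,
a leaf updates its upper bound and turns to its next feasible value; any other agent lets the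
children waiting for `d` explore it, or makes them switch to the next feasible value if `d` has
turned out to be suboptimal. -/
def onCost (i : A) (st₀ : AgentState A V) (j : A) (d : V) (v : ℝ≥0) :
    AgentState A V × Multiset (Packet A V) :=
  let st : AgentState A V := { st₀ with
    high := Function.update st₀.high d (st₀.high d + v)
    gotCost := Function.update st₀.gotCost d (insert j (st₀.gotCost d)) }
  if T.allParents i ⊆ st.gotCost d then
    if T.children i = ∅ then
      let st' : AgentState A V := { st with ub := min st.ub (lb P T i st d) }
      advance P T i st' ∅ (nextFeasible P T i st' d)
    else
      let S := (T.children i).filter (fun c => st.srch c = some d)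
      if lb P T i st d < st.ub then (st, sendCPA P T i st d S)
      else advance P T i st S (nextFeasible P T i st d)
  else (st, 0)

/-- Receipt of a BACKTRACK message from the child `c`, for the value `d` that `c` was exploring. The
lower bound is replaced, the assignments are merged; when it is the last one for `d`, the upper
bound is updated; `c` turns to the next feasible value. -/
def onBacktrack (i : A) (st₀ : AgentState A V) (c : A) (v : ℝ≥0∞) (pa : PAssign A V) :
    AgentState A V × Multiset (Packet A V) :=
  match st₀.srch c with
  | none => (st₀, 0)
  | some d =>
    let st : AgentState A V := { st₀ with
      lbc := Function.update st₀.lbc c (Function.update (st₀.lbc c) d v)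
      spa := Function.update st₀.spa d (fun j => (pa j).or (st₀.spa d j))
      gotBack := Function.update st₀.gotBack d (insert c (st₀.gotBack d)) }
    let st' : AgentState A V := { st with
      ub := if T.children i ⊆ st.gotBack d then min st.ub (lb P T i st d) else st.ub }
    advance P T i st' {c} (nextFeasible P T i st' d)

/-- Receipt of a TERMINATE message: it is passed on. -/
def onTerminate (i : A) (st : AgentState A V) : AgentState A V × Multiset (Packet A V) :=
  ({ st with terminated := True }, (T.children i).val.map fun c => ⟨i, c, .terminate⟩)

/-- What agent `i` in state `st` does with a message `m` from agent `j`. -/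
def handle (k : ℕ∞) (i : A) (st : AgentState A V) (j : A) (m : Msg A V) :
    AgentState A V × Multiset (Packet A V) :=
  match m with
  | .util u => onUtil P T k i st j u
  | .cpa pa ub => onCPA P T i st j pa ub
  | .costReq d => onCostReq P T i st j d
  | .cost d v => onCost P T i st j d v
  | .backtrack v pa => onBacktrack P T i st j v pa
  | .terminate => onTerminate P T i st

/-- The initial configuration: every agent has started, i.e. the leaves have sent their local
utilities. -/
def initConfig (k : ℕ∞) : Config A V where
  agents := fun i => (inferenceStep P T k i AgentState.blank).1
  net := ∑ i, (inferenceStep P T k i AgentState.blank).2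

/-- One step of an asynchronous execution: an arbitrary message in transit is delivered and
processed. -/
def Step (k : ℕ∞) (s s' : Config A V) : Prop :=
  ∃ (p : Packet A V) (rest : Multiset (Packet A V)), s.net = p ::ₘ rest ∧
    s' = ⟨Function.update s.agents p.dst (handle P T k p.dst (s.agents p.dst) p.src p.msg).1,
      rest + (handle P T k p.dst (s.agents p.dst) p.src p.msg).2⟩

/-- The configurations that occur in executions of the algorithm. -/
def Reachable (k : ℕ∞) (s : Config A V) : Prop :=
  Relation.ReflTransGen (Step P T k) (initConfig P T k) s

/-- The assignment `Spa_r(d_r^*)` held by the root `a_r`, its answer once it has terminated. -/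
def answer (s : Config A V) : PAssign A V := bestSpa P T T.root (s.agents T.root)

end Algorithm

end PTISABB

end

noncomputable section

set_option linter.unusedSectionVars false

namespace PTISABB

section TreeFacts

variable {A : Type*} {G : SimpleGraph A} (T : PseudoTree G)

/-- `l` lies in the subtree rooted at `i`. -/
def InSubtree (i l : A) : Prop := l = i ∨ IsAncestor T.parent i l

variable {T}

theorem inSubtree_iff_reflTransGen {i l : A} :
    InSubtree T i l ↔ Relation.ReflTransGen (fun a b => T.parent b = some a) i l :=
  Relation.reflTransGen_iff_eq_or_transGen.symm

theorem inSubtree_self (i : A) : InSubtree T i i := Or.inl rfl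

theorem isAncestor_level_lt {j i : A} (h : IsAncestor T.parent j i) : T.level j < T.level i := by
  induction h with
  | single h => rw [T.level_parent _ _ h]; omega
  | tail _ h ih => rw [T.level_parent _ _ h]; omega

theorem isAncestor_irrefl (i : A) : ¬ IsAncestor T.parent i i :=
  fun h => lt_irrefl _ (isAncestor_level_lt h)

theorem isAncestor_of_parent {c p : A} (h : T.parent c = some p) : IsAncestor T.parent p c :=
  Relation.TransGen.single h

theorem isAncestor_trans {a b c : A} (h : IsAncestor T.parent a b) (h' : IsAncestor T.parent b c) :
    IsAncestor T.parent a c := Relation.TransGen.trans h h'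

theorem isAncestor_iff_of_parent {c p : A} (h : T.parent c = some p) (j : A) :
    IsAncestor T.parent j c ↔ j = p ∨ IsAncestor T.parent j p := by
  unfold IsAncestor
  rw [Relation.TransGen.tail'_iff]
  constructor
  · rintro ⟨b, hb, hbc⟩
    obtain rfl : p = b := by simpa [h] using hbc
    rcases Relation.reflTransGen_iff_eq_or_transGen.1 hb with h | h
    · exact Or.inl h.symm
    · exact Or.inr h
  · rintro (rfl | h')
    · exact ⟨_, .refl, h⟩
    · exact ⟨p, Relation.TransGen.to_reflTransGen h', h⟩

theorem not_isAncestor_root (j : A) : ¬ IsAncestor T.parent j T.root := by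
  intro h
  have := isAncestor_level_lt h
  rw [T.level_root] at this
  omega

theorem inSubtree_child {c p l : A} (h : T.parent c = some p) (hl : InSubtree T c l) :
    IsAncestor T.parent p l := by
  rcases hl with rfl | hl
  · exact isAncestor_of_parent h
  · exact isAncestor_trans (isAncestor_of_parent h) hl

theorem isAncestor_iff_child {i l : A} :
    IsAncestor T.parent i l ↔ ∃ c, T.parent c = some i ∧ InSubtree T c l := by
  constructor
  · intro h
    obtain ⟨c, hc, hl⟩ := Relation.TransGen.head'_iff.1 h
    exact ⟨c, hc, inSubtree_iff_reflTransGen.2 hl⟩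
  · rintro ⟨c, hc, hl⟩
    exact inSubtree_child hc hl

theorem inSubtree_total {a b l : A} (ha : InSubtree T a l) (hb : InSubtree T b l) :
    InSubtree T a b ∨ InSubtree T b a := by
  rw [inSubtree_iff_reflTransGen] at ha hb ⊢
  rw [inSubtree_iff_reflTransGen]
  have key : Relator.RightUnique (Function.swap (fun a b => T.parent b = some a)) := by
    intro x y z h h'
    exact Option.some_injective _ (h.symm.trans h')
  have := Relation.ReflTransGen.total_of_right_unique key
    (Relation.reflTransGen_swap.2 ha) (Relation.reflTransGen_swap.2 hb)
  exact (this.imp Relation.reflTransGen_swap.1 Relation.reflTransGen_swap.1).symm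

theorem inSubtree_trans {a b c : A} (h : InSubtree T a b) (h' : InSubtree T b c) :
    InSubtree T a c := by
  rw [inSubtree_iff_reflTransGen] at *
  exact h.trans h'

/-- The subtrees of distinct children are disjoint. -/
theorem child_unique {i c c' l : A} (hc : T.parent c = some i) (hc' : T.parent c' = some i)
    (h : InSubtree T c l) (h' : InSubtree T c' l) : c = c' := by
  have h1 := T.level_parent _ _ hc
  have h2 := T.level_parent _ _ hc'
  rcases inSubtree_total h h' with (h | h) | (h | h)
  · exact h.symm
  · have := isAncestor_level_lt h; omega
  · exact h
  · have := isAncestor_level_lt h; omega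

theorem inSubtree_or_isAncestor {i l j : A} (hl : InSubtree T i l)
    (hj : IsAncestor T.parent j l) : InSubtree T i j ∨ IsAncestor T.parent j i := by
  rcases inSubtree_total hl (Or.inr hj) with h | h | h
  · exact Or.inl h
  · exact Or.inl (Or.inl h.symm)
  · exact Or.inr h

theorem not_inSubtree_of_isAncestor {i j : A} (h : IsAncestor T.parent j i) :
    ¬ InSubtree T i j := by
  rintro (rfl | h')
  · exact isAncestor_irrefl _ h
  · exact isAncestor_irrefl _ (isAncestor_trans h h')

theorem exists_parent {i : A} (h : i ≠ T.root) : ∃ p, T.parent i = some p :=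
  Option.ne_none_iff_exists'.1 (mt (T.parent_eq_none_iff i).1 h)

theorem parent_root : T.parent T.root = none := (T.parent_eq_none_iff _).2 rfl

theorem ne_root_of_parent {c p : A} (h : T.parent c = some p) : c ≠ T.root := by
  rintro rfl
  rw [parent_root] at h
  cases h

/-- Induction along the tree, from the root downwards. -/
theorem tree_induction {motive : A → Prop} (root : motive T.root)
    (step : ∀ c p, T.parent c = some p → motive p → motive c) (i : A) : motive i := by
  induction h : T.level i using Nat.strong_induction_on generalizing i with
  | _ n ih =>
    by_cases hi : i = T.root
    · rwa [hi]
    · obtain ⟨p, hp⟩ := exists_parent hi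
      exact step i p hp (ih _ (by rw [← h, T.level_parent _ _ hp]; omega) p rfl)

theorem inSubtree_root (i : A) : InSubtree T T.root i :=
  tree_induction (inSubtree_self _)
    (fun _ _ h ih => inSubtree_trans ih (Or.inr (isAncestor_of_parent h))) i

section Fin

variable [Fintype A]

@[simp] theorem mem_children {i c : A} : c ∈ T.children i ↔ T.parent c = some i := by
  simp [PseudoTree.children]

theorem mem_allParents {i j : A} :
    j ∈ T.allParents i ↔ G.Adj i j ∧ IsAncestor T.parent j i := by
  simp [PseudoTree.allParents]

theorem mem_sep {i j : A} :
    j ∈ T.sep i ↔ IsAncestor T.parent j i ∧ ∃ l, InSubtree T i l ∧ G.Adj l j := by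
  simp [PseudoTree.sep, InSubtree]

theorem allParents_root : T.allParents T.root = ∅ := by
  ext j
  simp only [mem_allParents, Finset.notMem_empty, iff_false, not_and]
  exact fun _ => not_isAncestor_root j

theorem parent_mem_allParents {c p : A} (h : T.parent c = some p) : p ∈ T.allParents c :=
  mem_allParents.2 ⟨T.adj_parent _ _ h, isAncestor_of_parent h⟩

theorem parent_mem_sep {c p : A} (h : T.parent c = some p) : p ∈ T.sep c :=
  mem_sep.2 ⟨isAncestor_of_parent h, c, inSubtree_self c, T.adj_parent _ _ h⟩

theorem allParents_subset_sep (i : A) : T.allParents i ⊆ T.sep i := fun _ hj =>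
  mem_sep.2 ⟨(mem_allParents.1 hj).2, i, inSubtree_self i, (mem_allParents.1 hj).1⟩

theorem sep_child_subset {c i j : A} (h : T.parent c = some i) (hj : j ∈ T.sep c) :
    j = i ∨ j ∈ T.sep i := by
  obtain ⟨ha, l, hl, hlj⟩ := mem_sep.1 hj
  rcases (isAncestor_iff_of_parent h j).1 ha with rfl | ha
  · exact Or.inl rfl
  · exact Or.inr (mem_sep.2 ⟨ha, l, Or.inr (inSubtree_child h hl), hlj⟩)

theorem branch_eq_some {i j c : A} (hc : T.parent c = some i) (hj : InSubtree T c j) :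
    T.branch i j = some c := by
  have h : ∃ c, T.parent c = some i ∧ (c = j ∨ IsAncestor T.parent c j) :=
    ⟨c, hc, hj.imp Eq.symm id⟩
  rw [PseudoTree.branch, dif_pos h]
  congr 1
  exact child_unique h.choose_spec.1 hc (h.choose_spec.2.imp Eq.symm id) hj

/-- Induction along the tree, from the leaves upwards. -/
theorem tree_induction_up {motive : A → Prop}
    (step : ∀ i, (∀ c, T.parent c = some i → motive c) → motive i) (i : A) : motive i := by
  obtain ⟨N, hN⟩ : ∃ N, ∀ i, T.level i ≤ N :=
    ⟨Finset.univ.sup T.level, fun i => Finset.le_sup (Finset.mem_univ i)⟩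
  induction h : N - T.level i using Nat.strong_induction_on generalizing i with
  | _ n ih =>
    refine step i fun c hc => ih _ ?_ c rfl
    have h1 := T.level_parent _ _ hc
    have h2 := hN c
    omega

end Fin

end TreeFacts

section Costs

variable {A V : Type*} [Fintype A] (P : ADCOP A V) (T : PseudoTree P.graph)

/-- The cost, both sides included, of the constraints of `i` with its ancestors. -/
def nodeCost (i : A) (z : A → V) : ℝ≥0 :=
  ∑ j ∈ T.allParents i, (P.f i j (z i) (z j) + P.f j i (z j) (z i))

open Classical in
/-- The cost of all constraints with an end in the subtree of `i`. -/
def subCost (i : A) (z : A → V) : ℝ≥0 :=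
  ∑ l ∈ Finset.univ.filter (InSubtree T i), nodeCost P T l z

variable {P T}

open Classical in
theorem subCost_eq (i : A) (z : A → V) :
    subCost P T i z = nodeCost P T i z + ∑ c ∈ T.children i, subCost P T c z := by
  have hs : Finset.univ.filter (InSubtree T i) =
      insert i ((T.children i).biUnion fun c => Finset.univ.filter (InSubtree T c)) := by
    ext l
    simp only [Finset.mem_filter, Finset.mem_univ, true_and, Finset.mem_insert,
      Finset.mem_biUnion, mem_children]
    rw [InSubtree, isAncestor_iff_child]
  unfold subCost
  rw [hs, Finset.sum_insert, Finset.sum_biUnion]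
  · intro c hc c' hc' hne
    rw [Function.onFun, Finset.disjoint_left]
    intro l hl hl'
    simp only [Finset.mem_filter, Finset.mem_univ, true_and] at hl hl'
    exact hne (child_unique (mem_children.1 hc) (mem_children.1 hc') hl hl')
  · simp only [Finset.mem_biUnion, mem_children, Finset.mem_filter, Finset.mem_univ, true_and,
      not_exists, not_and]
    exact fun c hc h => isAncestor_irrefl i (inSubtree_child hc h)

theorem nodeCost_congr {i : A} {z z' : A → V} (hi : z i = z' i)
    (h : ∀ j, IsAncestor T.parent j i → z j = z' j) : nodeCost P T i z = nodeCost P T i z' :=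
  Finset.sum_congr rfl fun j hj => by rw [hi, h j (mem_allParents.1 hj).2]

theorem subCost_congr {i : A} {z z' : A → V} (h : ∀ j, InSubtree T i j → z j = z' j)
    (h' : ∀ j, IsAncestor T.parent j i → z j = z' j) : subCost P T i z = subCost P T i z' := by
  classical
  refine Finset.sum_congr rfl fun l hl => ?_
  have hl := (Finset.mem_filter.1 hl).2
  refine nodeCost_congr (h l hl) fun j hj => ?_
  rcases inSubtree_or_isAncestor hl hj with h1 | h1
  · exact h j h1
  · exact h' j h1

theorem subCost_root (z : A → V) : subCost P T T.root z = P.totalCost z := by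
  classical
  unfold subCost ADCOP.totalCost nodeCost
  rw [Finset.filter_true_of_mem fun i _ => inSubtree_root i]
  have h1 : ∀ i, Finset.univ.filter (fun j => P.graph.Adj i j) =
      T.allParents i ∪ Finset.univ.filter (fun j => i ∈ T.allParents j) := by
    intro i
    ext j
    simp only [Finset.mem_filter, Finset.mem_univ, true_and, Finset.mem_union, mem_allParents]
    constructor
    · intro h
      rcases T.adj_related _ _ h with h' | h'
      · exact Or.inr ⟨h.symm, h'⟩
      · exact Or.inl ⟨h, h'⟩
    · rintro (h | h)
      · exact h.1
      · exact h.1.symm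
  have h2 : ∀ i, Disjoint (T.allParents i) (Finset.univ.filter (fun j => i ∈ T.allParents j)) := by
    intro i
    rw [Finset.disjoint_left]
    intro j hj hj'
    rw [Finset.mem_filter, mem_allParents] at hj'
    exact isAncestor_irrefl _ (isAncestor_trans (mem_allParents.1 hj).2 hj'.2.2)
  simp_rw [h1, Finset.sum_union (h2 _), Finset.sum_add_distrib]
  congr 1
  simp_rw [Finset.sum_filter]
  rw [Finset.sum_comm]
  refine Finset.sum_congr rfl fun i _ => ?_
  rw [← Finset.sum_filter]
  congr 1
  ext j
  simp

variable (P T)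

/-- `z` is a complete assignment that extends the partial assignment `pa` of the ancestors of `i`. -/
def Compat (i : A) (pa : PAssign A V) (z : A → V) : Prop :=
  (∀ l, z l ∈ P.dom l) ∧ ∀ j, IsAncestor T.parent j i → pa j = some (z j)

/-- The optimal cost in the subtree of `i` under the partial assignment `pa`. -/
def opt (i : A) (pa : PAssign A V) : ℝ≥0∞ :=
  ⨅ (z : A → V) (_ : Compat P T i pa z), (subCost P T i z : ℝ≥0∞)

/-- The full cost of the constraints of `i` with its ancestors. -/
def fullHigh (i : A) (pa : PAssign A V) (d : V) : ℝ≥0 :=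
  ∑ j ∈ T.allParents i, P.privCost i j (some d) (pa j) +
    ∑ j ∈ T.allParents i, P.privCost j i (pa j) (some d)

/-- The optimal cost in the subtree of `i` when `i` takes the value `d`. -/
def optVal [DecidableEq A] (i : A) (pa : PAssign A V) (d : V) : ℝ≥0∞ :=
  fullHigh P T i pa d + ∑ c ∈ T.children i, opt P T c (Function.update pa i (some d))

variable {P T}

theorem opt_le {i : A} {pa : PAssign A V} {z : A → V} (h : Compat P T i pa z) :
    opt P T i pa ≤ subCost P T i z := iInf₂_le z h

theorem Compat.fullHigh_eq {i : A} {pa : PAssign A V} {z : A → V} (h : Compat P T i pa z) :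
    fullHigh P T i pa (z i) = nodeCost P T i z := by
  unfold fullHigh nodeCost
  rw [Finset.sum_add_distrib]
  congr 1 <;> refine Finset.sum_congr rfl fun j hj => ?_ <;>
  · rw [h.2 j (mem_allParents.1 hj).2, ADCOP.privCost]

theorem compat_child_iff [DecidableEq A] {c i : A} (hc : T.parent c = some i)
    {pa : PAssign A V} {d : V} {z : A → V} :
    Compat P T c (Function.update pa i (some d)) z ↔ Compat P T i pa z ∧ z i = d := by
  unfold Compat
  simp only [isAncestor_iff_of_parent hc]
  constructor
  · rintro ⟨h1, h2⟩
    refine ⟨⟨h1, fun j hj => ?_⟩, ?_⟩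
    · have hne : j ≠ i := by rintro rfl; exact isAncestor_irrefl _ hj
      have := h2 j (Or.inr hj)
      rwa [Function.update_of_ne hne] at this
    · have := h2 i (Or.inl rfl)
      rw [Function.update_self] at this
      exact (Option.some_injective _ this).symm
  · rintro ⟨⟨h1, h2⟩, rfl⟩
    refine ⟨h1, fun j hj => ?_⟩
    by_cases hne : j = i
    · subst hne; rw [Function.update_self]
    · rw [Function.update_of_ne hne]
      exact h2 j (hj.resolve_left hne)

theorem optVal_le [DecidableEq A] {i : A} {pa : PAssign A V} {z : A → V}
    (h : Compat P T i pa z) : optVal P T i pa (z i) ≤ subCost P T i z := by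
  rw [subCost_eq, optVal, h.fullHigh_eq]
  push_cast
  gcongr with c hc
  exact opt_le ((compat_child_iff (mem_children.1 hc)).2 ⟨h, rfl⟩)

/-- A lower bound on the optimal cost that holds for every value of `i` is a lower bound. -/
theorem le_opt [DecidableEq A] {i : A} {pa : PAssign A V} {x : ℝ≥0∞}
    (h : ∀ d ∈ P.dom i, x ≤ optVal P T i pa d) : x ≤ opt P T i pa :=
  le_iInf₂ fun z hz => (h (z i) (hz.1 i)).trans (optVal_le hz)

end Costs

section Termination

variable {A V : Type*} [Fintype A] [DecidableEq A] [LinearOrder V]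

/-- The weight of a TERMINATE message to an agent at height `h`, in a tree with `n` agents. -/
def termWeight (n : ℕ) : ℕ → ℕ
  | 0 => 1
  | h + 1 => 1 + n * termWeight n h

/-- The weight of a COST message to an agent, from the weight `w` of a CPA message to a child and
the weight `t` of a TERMINATE message to the agent. -/
def costWeightOf (n w t : ℕ) : ℕ := 1 + n * w + t

/-- An upper bound for the potential of the search state of an agent. -/
def searchBoundOf (n D w t : ℕ) : ℕ := n * (t + D * w) + D * (n * (1 + costWeightOf n w t))

/-- The weight of a CPA message to an agent. -/
def cpaWeightOf (n D w t : ℕ) : ℕ := 1 + searchBoundOf n D w t + t + n * w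

/-- The weight of a CPA message to the children of an agent at height `h`. -/
def childWeight (n D : ℕ) : ℕ → ℕ
  | 0 => 0
  | h + 1 => cpaWeightOf n D (childWeight n D h) (termWeight n h)

variable (P : ADCOP A V) (T : PseudoTree P.graph)

/-- The number of levels below that of `i`. -/
def height (i : A) : ℕ := Finset.univ.sup T.level - T.level i

/-- The sum of the sizes of the domains. -/
def domSize : ℕ := ∑ i, (P.dom i).card

def termW (i : A) : ℕ := termWeight (Fintype.card A) (height P T i)

def childW (i : A) : ℕ := childWeight (Fintype.card A) (domSize P) (height P T i)

def costW (i : A) : ℕ := costWeightOf (Fintype.card A) (childW P T i) (termW P T i)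

def cpaW (i : A) : ℕ :=
  cpaWeightOf (Fintype.card A) (domSize P) (childW P T i) (termW P T i)

/-- The weight of a message in transit: a bound on the length of the executions it may cause. -/
def weight (p : Packet A V) : ℕ :=
  match p.msg with
  | .util _ => cpaW P T T.root + T.level p.dst
  | .cpa _ _ => cpaW P T p.dst
  | .costReq _ => 1 + costW P T p.src
  | .cost _ _ => costW P T p.dst
  | .backtrack _ _ => 1
  | .terminate => termW P T p.dst

def netWeight (m : Multiset (Packet A V)) : ℕ := (m.map (weight P T)).sum

/-- What the exploration by one child may still cause. -/
def srchPot (i : A) : Option V → ℕ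
  | none => 0
  | some d => termW P T i + ((P.dom i).filter fun e => d < e).card * childW P T i

/-- What an agent may still cause before it receives its next CPA message. -/
def statePot (i : A) (st : AgentState A V) : ℕ :=
  ∑ c, srchPot P T i (st.srch c) +
    (P.dom i \ st.requested).card * (Fintype.card A * (1 + costW P T i))

/-- Only children explore values. -/
def SrchValid (i : A) (st : AgentState A V) : Prop :=
  ∀ c d, st.srch c = some d → T.parent c = some i

variable {P T}

theorem height_child {c i : A} (h : T.parent c = some i) :
    height P T i = height P T c + 1 := by
  have h1 := T.level_parent _ _ h
  have h2 : T.level c ≤ Finset.univ.sup T.level := Finset.le_sup (Finset.mem_univ c)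
  unfold height
  omega

theorem cpaW_child {c i : A} (h : T.parent c = some i) : cpaW P T c = childW P T i := by
  unfold cpaW childW termW
  rw [height_child h, childWeight]

theorem termW_child {c i : A} (h : T.parent c = some i) :
    termW P T i = 1 + Fintype.card A * termW P T c := by
  unfold termW
  rw [height_child h, termWeight]

theorem one_le_termW (i : A) : 1 ≤ termW P T i := by
  unfold termW
  cases height P T i <;> simp [termWeight]

theorem netWeight_add (m m' : Multiset (Packet A V)) :
    netWeight P T (m + m') = netWeight P T m + netWeight P T m' := by
  simp [netWeight]

@[simp] theorem netWeight_zero : netWeight P T (0 : Multiset (Packet A V)) = 0 := by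
  simp [netWeight]

@[simp] theorem netWeight_singleton (p : Packet A V) : netWeight P T {p} = weight P T p := by
  simp [netWeight]

theorem netWeight_map_le (S : Finset A) (g : A → Packet A V) (b : ℕ)
    (h : ∀ c ∈ S, weight P T (g c) ≤ b) : netWeight P T (S.val.map g) ≤ S.card * b := by
  unfold netWeight
  rw [Multiset.map_map]
  exact Finset.sum_le_card_nsmul S (fun c => weight P T (g c)) b h

theorem netWeight_terminate (i : A) :
    netWeight P T ((T.children i).val.map fun c => (⟨i, c, .terminate⟩ : Packet A V)) + 1
      ≤ termW P T i := by
  by_cases h : ∃ c, T.parent c = some i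
  · obtain ⟨c, hc⟩ := h
    have := netWeight_map_le (P := P) (T := T) (T.children i)
      (fun c => (⟨i, c, .terminate⟩ : Packet A V)) (termW P T c) (by
        intro c' hc'
        rw [mem_children] at hc'
        have h1 := height_child (P := P) hc
        have h2 := height_child (P := P) hc'
        simp only [weight, termW]
        rw [show height P T c' = height P T c by omega])
    rw [termW_child hc]
    have h3 := Nat.mul_le_mul_right (termW P T c) (Finset.card_le_univ (T.children i))
    omega
  · have : T.children i = ∅ := by
      ext c
      simp only [mem_children, Finset.notMem_empty, iff_false]
      exact fun hc => h ⟨c, hc⟩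
    rw [this]
    simpa using one_le_termW i

theorem statePot_congr {i : A} {st st' : AgentState A V} (h1 : st.srch = st'.srch)
    (h2 : st.requested = st'.requested) : statePot P T i st = statePot P T i st' := by
  unfold statePot
  rw [h1, h2]

theorem finish_weight (i : A) (st : AgentState A V) :
    statePot P T i (finish P T i st).1 + netWeight P T (finish P T i st).2
      ≤ statePot P T i st + termW P T i := by
  unfold finish
  split
  · have := netWeight_terminate (P := P) (T := T) i
    have h2 : statePot P T i { st with terminated := True } = statePot P T i st := rfl
    dsimp only
    omega
  · simpa [weight] using one_le_termW i

theorem sendCPA_weight (i : A) (st : AgentState A V) (d : V) {S : Finset A}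
    (hS : S ⊆ T.children i) :
    netWeight P T (sendCPA P T i st d S) ≤ S.card * childW P T i :=
  netWeight_map_le _ _ _ fun _ hc => (cpaW_child (mem_children.1 (hS hc))).le

theorem first_mem {S : Finset V} {d : V} (h : first S = some d) : d ∈ S := by
  unfold first at h
  split at h
  · cases h
    exact Finset.min'_mem _ _
  · cases h

theorem advance_weight (i : A) (st : AgentState A V) {S : Finset A} (hS : S ⊆ T.children i)
    (e : Option V) (he : ∀ d, e = some d → d ∈ P.dom i) :
    statePot P T i (advance P T i st S e).1 + netWeight P T (advance P T i st S e).2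
      ≤ statePot P T i { st with srch := fun c => if c ∈ S then e else st.srch c } +
        (if e = none then termW P T i else S.card * childW P T i) := by
  unfold advance
  cases e with
  | none =>
    dsimp only
    rw [if_pos rfl]
    split
    · exact finish_weight _ _
    · simp
  | some d =>
    rw [if_neg (Option.some_ne_none d)]
    dsimp only
    split_ifs with h0 hd
    · exact Nat.add_le_add_left (sendCPA_weight _ _ _ hS) _
    · simp
    · have h1 := netWeight_map_le (P := P) (T := T) (T.allParents i)
        (fun j => (⟨i, j, .costReq d⟩ : Packet A V)) (1 + costW P T i) (fun _ _ => le_rfl)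
      have h2 := Nat.mul_le_mul_right (1 + costW P T i) (Finset.card_le_univ (T.allParents i))
      have h3 : (P.dom i \ insert d st.requested).card + 1 ≤ (P.dom i \ st.requested).card := by
        rw [Nat.succ_le_iff]
        refine Finset.card_lt_card ⟨fun x hx => ?_, fun hsub => ?_⟩
        · simp only [Finset.mem_sdiff, Finset.mem_insert, not_or] at hx ⊢
          exact ⟨hx.1, hx.2.2⟩
        · have := hsub (Finset.mem_sdiff.2 ⟨he d rfl, hd⟩)
          simp at this
      have h4 := Nat.mul_le_mul_right (Fintype.card A * (1 + costW P T i)) h3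
      rw [Nat.add_mul, one_mul] at h4
      unfold statePot
      dsimp only at *
      omega

theorem srchPot_le (i : A) (o : Option V) :
    srchPot P T i o ≤ termW P T i + domSize P * childW P T i := by
  cases o with
  | none => simp [srchPot]
  | some d =>
    refine Nat.add_le_add_left (Nat.mul_le_mul_right _ ?_) _
    exact (Finset.card_filter_le _ _).trans
      (Finset.single_le_sum (f := fun i => (P.dom i).card) (fun _ _ => Nat.zero_le _)
        (Finset.mem_univ i))

theorem statePot_le (i : A) (st : AgentState A V) :
    statePot P T i st ≤
      searchBoundOf (Fintype.card A) (domSize P) (childW P T i) (termW P T i) := by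
  unfold statePot searchBoundOf
  refine Nat.add_le_add ?_ (Nat.mul_le_mul_right _ ?_)
  · have := Finset.sum_le_card_nsmul Finset.univ (fun c => srchPot P T i (st.srch c)) _
      (fun c _ => srchPot_le i (st.srch c))
    simpa using this
  · exact (Finset.card_le_card Finset.sdiff_subset).trans
      (Finset.single_le_sum (f := fun i => (P.dom i).card) (fun _ _ => Nat.zero_le _)
        (Finset.mem_univ i))

theorem card_mul_le (S : Finset A) (w : ℕ) : S.card * w ≤ Fintype.card A * w :=
  Nat.mul_le_mul_right _ (Finset.card_le_univ S)

theorem advance_weight_le (i : A) (st : AgentState A V) {S : Finset A} (hS : S ⊆ T.children i)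
    (e : Option V) (he : ∀ d, e = some d → d ∈ P.dom i) :
    statePot P T i (advance P T i st S e).1 + netWeight P T (advance P T i st S e).2 + 1
      ≤ cpaW P T i := by
  have h1 := advance_weight i st hS e he
  have h2 := statePot_le (P := P) (T := T) i
    { st with srch := fun c => if c ∈ S then e else st.srch c }
  have h3 := card_mul_le S (childW P T i)
  unfold cpaW cpaWeightOf
  split at h1 <;> omega

theorem srchPot_next {i : A} {d : V} {e : Option V}
    (he : ∀ x, e = some x → d < x ∧ x ∈ P.dom i) :
    srchPot P T i e + (if e = none then termW P T i else childW P T i)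
      ≤ srchPot P T i (some d) := by
  cases e with
  | none => simp [srchPot]
  | some x =>
    obtain ⟨h1, h2⟩ := he x rfl
    have h3 : ((P.dom i).filter fun e => x < e).card + 1 ≤
        ((P.dom i).filter fun e => d < e).card := by
      rw [Nat.succ_le_iff]
      refine Finset.card_lt_card ⟨fun y hy => ?_, fun hsub => ?_⟩
      · simp only [Finset.mem_filter] at hy ⊢
        exact ⟨hy.1, h1.trans hy.2⟩
      · have := hsub (Finset.mem_filter.2 ⟨h2, h1⟩)
        simp at this
    have h4 := Nat.mul_le_mul_right (childW P T i) h3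
    rw [Nat.add_mul, one_mul] at h4
    rw [if_neg (by simp)]
    simp only [srchPot]
    omega

theorem statePot_setSrch_le {i : A} {st : AgentState A V} {S : Finset A} {d : V} {e : Option V}
    (he : ∀ x, e = some x → d < x ∧ x ∈ P.dom i) (hS : ∀ c ∈ S, st.srch c = some d) :
    statePot P T i { st with srch := fun c => if c ∈ S then e else st.srch c }
      ≤ statePot P T i st := by
  unfold statePot
  refine Nat.add_le_add_right (Finset.sum_le_sum fun c _ => ?_) _
  dsimp only
  split
  · rename_i h
    rw [hS c h]
    exact le_of_add_le_left (srchPot_next he)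
  · exact le_rfl

theorem nextFeasible_spec {i : A} {st : AgentState A V} {d x : V}
    (h : nextFeasible P T i st d = some x) :
    x ∈ P.dom i ∧ d < x ∧ lb P T i st x < st.ub := by
  simpa using first_mem h

theorem firstFeasible_spec {i : A} {st : AgentState A V} {x : V}
    (h : firstFeasible P T i st = some x) : x ∈ P.dom i ∧ lb P T i st x < st.ub := by
  simpa using first_mem h

theorem onCPA_weight (i p : A) (st : AgentState A V) (pa : PAssign A V) (ub : ℝ≥0∞) :
    statePot P T i (onCPA P T i st p pa ub).1 + netWeight P T (onCPA P T i st p pa ub).2 + 1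
      ≤ cpaW P T i := by
  unfold onCPA
  dsimp only
  split
  · have h2 := statePot_le (P := P) (T := T) i (initSearch P T i st pa ub)
    have h3 := one_le_termW (P := P) (T := T) i
    rw [netWeight_singleton]
    simp only [weight]
    unfold cpaW cpaWeightOf
    omega
  · rename_i d hd
    refine advance_weight_le _ _ subset_rfl _ fun x hx => ?_
    cases hx
    exact (firstFeasible_spec hd).1

theorem startSearch_weight (i : A) (st : AgentState A V) :
    statePot P T i (startSearch P T i st).1 + netWeight P T (startSearch P T i st).2 + 1
      ≤ cpaW P T i := by
  unfold startSearch
  dsimp only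
  split
  · have h1 := finish_weight (P := P) (T := T) i (initSearch P T i st (fun _ => none) ⊤)
    have h2 := statePot_le (P := P) (T := T) i (initSearch P T i st (fun _ => none) ⊤)
    unfold cpaW cpaWeightOf
    omega
  · exact advance_weight_le _ _ subset_rfl _ fun x hx => first_mem hx

theorem inferenceStep_weight (k : ℕ∞) (i : A) (st : AgentState A V) :
    statePot P T i (inferenceStep P T k i st).1 +
      netWeight P T (inferenceStep P T k i st).2 + 1
      ≤ statePot P T i st + (cpaW P T T.root + T.level i) := by
  have hpos : 1 ≤ cpaW P T T.root := by unfold cpaW cpaWeightOf; omega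
  unfold inferenceStep
  split
  · split
    · rename_i h
      obtain rfl := (T.parent_eq_none_iff i).1 h
      have := startSearch_weight (P := P) (T := T) T.root st
      omega
    · rename_i p h
      have := T.level_parent _ _ h
      rw [netWeight_singleton]
      simp only [weight]
      omega
  · rw [netWeight_zero]
    dsimp only
    omega

theorem onBacktrack_weight (i c : A) (st : AgentState A V) (v : ℝ≥0∞) (pa : PAssign A V)
    (hst : SrchValid P T i st) :
    statePot P T i (onBacktrack P T i st c v pa).1 +
      netWeight P T (onBacktrack P T i st c v pa).2 ≤ statePot P T i st := by
  unfold onBacktrack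
  split
  · simp
  · rename_i d hd
    dsimp only
    set st' : AgentState A V := _
    set e := nextFeasible P T i st' d with he
    have hc := hst c d hd
    have hS : {c} ⊆ T.children i := by simpa using hc
    have hspec : ∀ x, e = some x → d < x ∧ x ∈ P.dom i := fun x hx =>
      ⟨(nextFeasible_spec hx).2.1, (nextFeasible_spec hx).1⟩
    refine (advance_weight i st' hS e fun x hx => (hspec x hx).2).trans ?_
    have key : ∑ c', srchPot P T i (if c' ∈ ({c} : Finset A) then e else st.srch c') +
        (if e = none then termW P T i else childW P T i) ≤ ∑ c', srchPot P T i (st.srch c') := by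
      rw [← Finset.add_sum_erase _ _ (Finset.mem_univ c),
        ← Finset.add_sum_erase Finset.univ (fun c' => srchPot P T i (st.srch c'))
          (Finset.mem_univ c)]
      have h1 := srchPot_next (P := P) (T := T) hspec
      have h2 : ∑ c' ∈ Finset.univ.erase c,
          srchPot P T i (if c' ∈ ({c} : Finset A) then e else st.srch c') =
          ∑ c' ∈ Finset.univ.erase c, srchPot P T i (st.srch c') := by
        refine Finset.sum_congr rfl fun c' hc' => ?_
        rw [if_neg (by simpa using (Finset.mem_erase.1 hc').1)]
      rw [h2, if_pos (Finset.mem_singleton_self c), hd]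
      omega
    unfold statePot
    rw [Finset.card_singleton, one_mul]
    change _ + (P.dom i \ st.requested).card * _ + _ ≤ _
    change ∑ c', srchPot P T i (if c' ∈ ({c} : Finset A) then e else st.srch c') + _ + _ ≤ _
    omega

/-- The state after the receipt of a COST message. -/
def addCost (st : AgentState A V) (j : A) (d : V) (v : ℝ≥0) : AgentState A V :=
  { st with
    high := Function.update st.high d (st.high d + v)
    gotCost := Function.update st.gotCost d (insert j (st.gotCost d)) }

/-- The state after an update of the upper bound with the cost of the value `d`. -/
def lowerUb (P : ADCOP A V) (T : PseudoTree P.graph) (i : A) (st : AgentState A V) (d : V) :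
    AgentState A V :=
  { st with ub := min st.ub (lb P T i st d) }

/-- The state after the receipt of a BACKTRACK message for `d`, except for the upper bound. -/
def addBack (st : AgentState A V) (c : A) (d : V) (v : ℝ≥0∞) (pa : PAssign A V) :
    AgentState A V :=
  { st with
    lbc := Function.update st.lbc c (Function.update (st.lbc c) d v)
    spa := Function.update st.spa d (fun j => (pa j).or (st.spa d j))
    gotBack := Function.update st.gotBack d (insert c (st.gotBack d)) }

theorem onCost_of_missing {i j : A} {st : AgentState A V} {d : V} {v : ℝ≥0}
    (h : ¬ T.allParents i ⊆ (addCost st j d v).gotCost d) :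
    onCost P T i st j d v = (addCost st j d v, 0) := if_neg h

theorem onCost_leaf {i j : A} {st : AgentState A V} {d : V} {v : ℝ≥0}
    (h : T.allParents i ⊆ (addCost st j d v).gotCost d) (hl : T.children i = ∅) :
    onCost P T i st j d v = advance P T i (lowerUb P T i (addCost st j d v) d) ∅
      (nextFeasible P T i (lowerUb P T i (addCost st j d v) d) d) :=
  (if_pos h).trans (if_pos hl)

theorem onCost_node {i j : A} {st : AgentState A V} {d : V} {v : ℝ≥0}
    (h : T.allParents i ⊆ (addCost st j d v).gotCost d) (hl : T.children i ≠ ∅) :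
    onCost P T i st j d v = advance P T i (addCost st j d v)
      ((T.children i).filter (fun c => st.srch c = some d))
      (if lb P T i (addCost st j d v) d < (addCost st j d v).ub then some d
        else nextFeasible P T i (addCost st j d v) d) := by
  refine (if_pos h).trans ((if_neg hl).trans ?_)
  change (if lb P T i (addCost st j d v) d < (addCost st j d v).ub then (addCost st j d v,
    sendCPA P T i (addCost st j d v) d ((T.children i).filter (fun c => st.srch c = some d)))
    else advance P T i (addCost st j d v) ((T.children i).filter (fun c => st.srch c = some d))
      (nextFeasible P T i (addCost st j d v) d)) = _
  split_ifs with hlt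
  · have hs : (fun c => if c ∈ (T.children i).filter (fun c => st.srch c = some d) then some d
        else st.srch c) = st.srch := by
      funext c
      split_ifs with hc
      · exact (Finset.mem_filter.1 hc).2.symm
      · rfl
    unfold advance
    dsimp only
    rw [if_pos h]
    change _ = ({ addCost st j d v with
        srch := fun c => if c ∈ (T.children i).filter (fun c => st.srch c = some d) then some d
          else st.srch c }, _)
    rw [hs]
    rfl
  · rfl

theorem onBacktrack_eq {i c : A} {st : AgentState A V} {d : V} {v : ℝ≥0∞} {pa : PAssign A V}
    (h : st.srch c = some d) :
    onBacktrack P T i st c v pa =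
      let st' := if T.children i ⊆ (addBack st c d v pa).gotBack d then
        lowerUb P T i (addBack st c d v pa) d else addBack st c d v pa
      advance P T i st' {c} (nextFeasible P T i st' d) := by
  have h1 : (if T.children i ⊆ (addBack st c d v pa).gotBack d then
      lowerUb P T i (addBack st c d v pa) d else addBack st c d v pa) =
      { addBack st c d v pa with
        ub := if T.children i ⊆ (addBack st c d v pa).gotBack d then
          min st.ub (lb P T i (addBack st c d v pa) d) else st.ub } := by
    split_ifs <;> rfl
  dsimp only
  rw [h1]
  unfold onBacktrack
  rw [h]
  rfl

theorem onCost_weight (i j : A) (st : AgentState A V) (d : V) (v : ℝ≥0) :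
    statePot P T i (onCost P T i st j d v).1 + netWeight P T (onCost P T i st j d v).2 + 1
      ≤ statePot P T i st + costW P T i := by
  have h0 : statePot P T i (addCost st j d v) = statePot P T i st := rfl
  unfold costW costWeightOf
  by_cases h : T.allParents i ⊆ (addCost st j d v).gotCost d
  · by_cases hl : T.children i = ∅
    · rw [onCost_leaf h hl]
      set st' := lowerUb P T i (addCost st j d v) d with hst'
      set e := nextFeasible P T i st' d with he
      have h1 := advance_weight (P := P) (T := T) i st' (Finset.empty_subset _) e
        fun x hx => (nextFeasible_spec hx).1
      have h2 : statePot P T i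
          { st' with srch := fun c => if c ∈ (∅ : Finset A) then e else st'.srch c } =
          statePot P T i st := statePot_congr (by simp [st', lowerUb, addCost]) rfl
      rw [h2, Finset.card_empty, zero_mul] at h1
      split at h1 <;> omega
    · rw [onCost_node h hl]
      set S := (T.children i).filter (fun c => st.srch c = some d) with hS
      have hSc : S ⊆ T.children i := Finset.filter_subset _ _
      have h3 := card_mul_le S (childW P T i)
      split_ifs with hlt
      · have h1 : advance P T i (addCost st j d v) S (some d) =
            (addCost st j d v, sendCPA P T i (addCost st j d v) d S) := by
          have h1 := onCost_node h hl
          rw [if_pos hlt] at h1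
          rw [← h1]
          exact (if_pos h).trans ((if_neg hl).trans (if_pos hlt))
        have h2 := sendCPA_weight i (addCost st j d v) d hSc
        rw [h1]
        dsimp only
        omega
      · set e := nextFeasible P T i (addCost st j d v) d with he
        have h1 := advance_weight (P := P) (T := T) i (addCost st j d v) hSc e
          fun x hx => (nextFeasible_spec hx).1
        have h2 := statePot_setSrch_le (P := P) (T := T) (i := i) (st := addCost st j d v)
          (S := S) (d := d) (e := e)
          (fun x hx => ⟨(nextFeasible_spec hx).2.1, (nextFeasible_spec hx).1⟩)
          (fun c hc => (Finset.mem_filter.1 hc).2)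
        split at h1 <;> omega
  · rw [onCost_of_missing h, netWeight_zero]
    dsimp only
    omega

theorem handle_weight (k : ℕ∞) (st : AgentState A V) (p : Packet A V)
    (hst : SrchValid P T p.dst st) :
    statePot P T p.dst (handle P T k p.dst st p.src p.msg).1 +
      netWeight P T (handle P T k p.dst st p.src p.msg).2 + 1
      ≤ statePot P T p.dst st + weight P T p := by
  obtain ⟨j, i, m⟩ := p
  cases m with
  | util u =>
    exact inferenceStep_weight k i { st with
      childUtil := Function.update st.childUtil j (some (P.minProj {j} (u.join (P.costTable i j)))) }
  | cpa pa ub => exact (onCPA_weight i j st pa ub).trans (Nat.le_add_left _ _)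
  | costReq d =>
    simp only [handle, onCostReq, netWeight_singleton, weight]
    omega
  | cost d v => exact onCost_weight i j st d v
  | backtrack v pa => exact Nat.add_le_add_right (onBacktrack_weight i j st v pa hst) 1
  | terminate =>
    have := netWeight_terminate (P := P) (T := T) i
    have h2 : statePot P T i { st with terminated := True } = statePot P T i st := rfl
    simp only [handle, onTerminate, weight]
    omega

theorem finish_srch (i : A) (st : AgentState A V) : (finish P T i st).1.srch = st.srch := by
  unfold finish
  split <;> rfl

theorem SrchValid.of_eq {i : A} {st st' : AgentState A V} (h : SrchValid P T i st)
    (hs : st'.srch = st.srch) : SrchValid P T i st' := by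
  unfold SrchValid
  rwa [hs]

theorem advance_srch (i : A) (st : AgentState A V) (S : Finset A) (e : Option V) :
    (advance P T i st S e).1.srch = fun c => if c ∈ S then e else st.srch c := by
  unfold advance
  cases e with
  | none =>
    dsimp only
    split
    · exact finish_srch _ _
    · rfl
  | some d =>
    dsimp only
    split
    · rfl
    · split <;> rfl

theorem SrchValid.advance {i : A} {st : AgentState A V} (h : SrchValid P T i st) {S : Finset A}
    (hS : S ⊆ T.children i) (e : Option V) : SrchValid P T i (advance P T i st S e).1 := by
  intro c d hd
  rw [advance_srch] at hd
  dsimp only at hd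
  split at hd
  · rename_i hc
    exact mem_children.1 (hS hc)
  · exact h c d hd

theorem srchValid_of_none {i : A} {st : AgentState A V} (h : ∀ c, st.srch c = none) :
    SrchValid P T i st := by
  intro c d hd
  rw [h] at hd
  cases hd

theorem SrchValid.inferenceStep {i : A} {st : AgentState A V} (h : SrchValid P T i st) (k : ℕ∞) :
    SrchValid P T i (inferenceStep P T k i st).1 := by
  unfold PTISABB.inferenceStep
  split
  · split
    · unfold startSearch
      dsimp only
      split
      · exact (srchValid_of_none fun _ => rfl).of_eq (finish_srch _ _)
      · exact SrchValid.advance (srchValid_of_none fun _ => rfl) subset_rfl _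
    · exact h
  · exact h

theorem SrchValid.handle {i : A} {st : AgentState A V} (h : SrchValid P T i st) (k : ℕ∞) (j : A)
    (m : Msg A V) : SrchValid P T i (handle P T k i st j m).1 := by
  cases m with
  | util u =>
    have h' : SrchValid P T i { st with
        childUtil := Function.update st.childUtil j
          (some (P.minProj {j} (u.join (P.costTable i j)))) } := h
    exact h'.inferenceStep k
  | cpa pa ub =>
    simp only [PTISABB.handle, onCPA]
    split
    · exact srchValid_of_none fun _ => rfl
    · exact SrchValid.advance (srchValid_of_none fun _ => rfl) subset_rfl _
  | costReq d => exact h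
  | cost d v =>
    have h' : SrchValid P T i (addCost st j d v) := h
    have h'' : SrchValid P T i (lowerUb P T i (addCost st j d v) d) := h
    change SrchValid P T i (onCost P T i st j d v).1
    by_cases h1 : T.allParents i ⊆ (addCost st j d v).gotCost d
    · by_cases hl : T.children i = ∅
      · rw [onCost_leaf h1 hl]
        exact h''.advance (Finset.empty_subset _) _
      · rw [onCost_node h1 hl]
        exact h'.advance (Finset.filter_subset _ _) _
    · rw [onCost_of_missing h1]
      exact h'
  | backtrack v pa =>
    change SrchValid P T i (onBacktrack P T i st j v pa).1
    cases hd : st.srch j with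
    | none =>
      unfold onBacktrack
      rw [hd]
      exact h
    | some d =>
      rw [onBacktrack_eq hd]
      refine SrchValid.advance ?_ (by simpa using h _ _ hd) _
      split_ifs <;> exact h
  | terminate => exact h

variable (P T) in
/-- The measure that decreases with every step. -/
def potential (s : Config A V) : ℕ := ∑ i, statePot P T i (s.agents i) + netWeight P T s.net

theorem step_potential {k : ℕ∞} {s s' : Config A V} (h : Step P T k s s')
    (hs : ∀ i, SrchValid P T i (s.agents i)) :
    potential P T s' < potential P T s ∧ ∀ i, SrchValid P T i (s'.agents i) := by
  obtain ⟨p, rest, hnet, rfl⟩ := h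
  constructor
  · unfold potential
    dsimp only
    have h1 := handle_weight k (s.agents p.dst) p (hs p.dst)
    rw [hnet, ← Finset.add_sum_erase _ _ (Finset.mem_univ p.dst),
      ← Finset.add_sum_erase Finset.univ (fun i => statePot P T i (s.agents i))
        (Finset.mem_univ p.dst), Function.update_self, netWeight_add, ← Multiset.singleton_add,
      netWeight_add, netWeight_singleton]
    have h2 : ∑ i ∈ Finset.univ.erase p.dst, statePot P T i
        (Function.update s.agents p.dst (handle P T k p.dst (s.agents p.dst) p.src p.msg).1 i) =
        ∑ i ∈ Finset.univ.erase p.dst, statePot P T i (s.agents i) := by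
      refine Finset.sum_congr rfl fun i hi => ?_
      rw [Function.update_of_ne (Finset.mem_erase.1 hi).1]
    rw [h2]
    omega
  · intro i
    dsimp only
    by_cases hi : i = p.dst
    · subst hi
      rw [Function.update_self]
      exact (hs _).handle k _ _
    · rw [Function.update_of_ne hi]
      exact hs i

theorem initConfig_srchValid (k : ℕ∞) (i : A) :
    SrchValid P T i ((initConfig P T k).agents i) :=
  SrchValid.inferenceStep (srchValid_of_none fun _ => rfl) k

/-- Every execution is finite. -/
theorem no_infinite_execution (k : ℕ∞) (e : ℕ → Config A V) (h0 : e 0 = initConfig P T k)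
    (hstep : ∀ n, Step P T k (e n) (e (n + 1))) : False := by
  have hv : ∀ n i, SrchValid P T i ((e n).agents i) := by
    intro n
    induction n with
    | zero => rw [h0]; exact initConfig_srchValid k
    | succ n ih => exact (step_potential (hstep n) ih).2
  have hlt : ∀ n, potential P T (e (n + 1)) < potential P T (e n) := fun n =>
    (step_potential (hstep n) (hv n)).1
  have hle : ∀ n, potential P T (e n) + n ≤ potential P T (e 0) := by
    intro n
    induction n with
    | zero => simp
    | succ n ih => have := hlt n; omega
  have := hle (potential P T (e 0) + 1)
  omega

end Termination

section UtilBounds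

variable {A V : Type*} [Fintype A] [DecidableEq A] (P : ADCOP A V) (T : PseudoTree P.graph)

/-- The entries of `u` are lower bounds for the cost of the subtree of `c`. -/
def ChildBound (c : A) (u : Util A V) : Prop :=
  ∀ (pa : PAssign A V) (z : A → V), (∀ l, z l ∈ P.dom l) → (∀ j ∈ T.sep c, pa j = some (z j)) →
    u.val pa ≤ subCost P T c z

/-- The entries of `u` are lower bounds for the costs of the subtree of `c` that are visible to the
agents in this subtree. -/
def MsgBound (c : A) (u : Util A V) : Prop :=
  ∀ (pa : PAssign A V) (z : A → V), (∀ l, z l ∈ P.dom l) → pa c = some (z c) →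
    (∀ j ∈ T.sep c, pa j = some (z j)) →
    u.val pa ≤ ∑ j ∈ T.allParents c, P.f c j (z c) (z j) + ∑ c' ∈ T.children c, subCost P T c' z

variable {P T}

theorem minProj_le {S : Finset A} {u : Util A V} {pa : PAssign A V} {z : A → V}
    (hz : ∀ l, z l ∈ P.dom l) :
    (P.minProj S u).val pa ≤ u.val (fun j => if j ∈ S then some (z j) else pa j) :=
  Finset.inf'_le (f := fun y : A → V => u.val fun j => if j ∈ S then some (y j) else pa j)
    (Fintype.mem_piFinset.2 hz)

theorem childBound_minProj {c p : A} (hc : T.parent c = some p) {u : Util A V}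
    (hu : MsgBound P T c u) : ChildBound P T c (P.minProj {c} (u.join (P.costTable p c))) := by
  intro pa z hz hpa
  refine (minProj_le hz).trans ?_
  have hne : ∀ j ∈ T.sep c, j ≠ c := by
    rintro j hj rfl
    exact isAncestor_irrefl _ (mem_sep.1 hj).1
  have h1 : ∀ j ∈ T.sep c, (if j ∈ ({c} : Finset A) then some (z j) else pa j) = some (z j) := by
    intro j hj
    rw [if_neg (by simpa using hne j hj), hpa j hj]
  have h2 : (if c ∈ ({c} : Finset A) then some (z c) else pa c) = some (z c) := by simp
  have h3 := hu (fun j => if j ∈ ({c} : Finset A) then some (z j) else pa j) z hz h2 h1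
  simp only [Util.join, ADCOP.costTable]
  rw [h1 p (parent_mem_sep hc), h2, ADCOP.privCost, subCost_eq, nodeCost,
    Finset.sum_add_distrib]
  have h4 : P.f p c (z p) (z c) ≤ ∑ j ∈ T.allParents c, P.f j c (z j) (z c) :=
    Finset.single_le_sum (f := fun j => P.f j c (z j) (z c)) (fun _ _ => zero_le)
      (parent_mem_allParents hc)
  calc _ ≤ _ := add_le_add h3 h4
    _ = _ := by ring

theorem msgBound_dropDims {k : ℕ∞} {c : A} {u : Util A V} (hu : MsgBound P T c u) :
    MsgBound P T c (dropDims P T k u) := by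
  intro pa z hz hc hsep
  refine (minProj_le hz).trans (hu _ z hz ?_ ?_)
  · split_ifs
    · rfl
    · exact hc
  · intro j hj
    split_ifs
    · rfl
    · exact hsep j hj

theorem msgBound_inference {i : A} {cu : A → Option (Util A V)}
    (h : ∀ c, T.parent c = some i → ∃ u, cu c = some u ∧ ChildBound P T c u) (D : Finset A) :
    MsgBound P T i ⟨D, fun x => (localUtil P T i).val x +
      ∑ c ∈ T.children i, ((cu c).getD Util.zero).val x⟩ := by
  intro pa z hz hi hsep
  refine add_le_add (Finset.sum_le_sum fun j hj => ?_) (Finset.sum_le_sum fun c hc => ?_)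
  · simp only [ADCOP.costTable]
    rw [hi, hsep j (allParents_subset_sep i hj), ADCOP.privCost]
  · rw [mem_children] at hc
    obtain ⟨u, hu, hb⟩ := h c hc
    rw [hu, Option.getD_some]
    refine hb pa z hz fun j hj => ?_
    rcases sep_child_subset hc hj with rfl | hj
    · exact hi
    · exact hsep j hj

theorem childBound_le_opt {c i : A} (hc : T.parent c = some i) {u : Util A V}
    (hu : ChildBound P T c u) (pa : PAssign A V) (d : V) :
    ((u.val (Function.update (fun j => if j ∈ T.sep c then pa j else none) i (some d)) : ℝ≥0) :
      ℝ≥0∞) ≤ opt P T c (Function.update pa i (some d)) := by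
  refine le_iInf₂ fun z hz => ?_
  rw [ENNReal.coe_le_coe]
  refine hu _ z hz.1 fun j hj => ?_
  rw [← hz.2 j (mem_sep.1 hj).1]
  by_cases hji : j = i
  · subst hji; simp
  · rw [Function.update_of_ne hji, Function.update_of_ne hji, if_pos hj]

end UtilBounds

section Local

variable {A V : Type*} [Fintype A] [DecidableEq A] [LinearOrder V]
  (P : ADCOP A V) (T : PseudoTree P.graph)

/-- The search for the value `d` of `i` is over. -/
def Done (i : A) (st : AgentState A V) (d : V) : Prop :=
  d ∈ P.dom i ∧ T.children i ⊆ st.gotBack d ∧ T.allParents i ⊆ st.gotCost d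

/-- The cost `x` of the value `d` cannot improve on the initial upper bound `B` or on the lower
bound of a smaller value whose search is over. -/
def Beaten (i : A) (st : AgentState A V) (B : ℝ≥0∞) (d : V) (x : ℝ≥0∞) : Prop :=
  B ≤ x ∨ ∃ e, e < d ∧ Done P T i st e ∧ lb P T i st e ≤ x

/-- The outcome `v`, `S` of the search in the subtree of `i` with the upper bound `b`: either an
optimal solution or the information that no solution is better than `b`. -/
def Result (i : A) (pa : PAssign A V) (b v : ℝ≥0∞) (S : PAssign A V) : Prop :=
  (∃ z, Compat P T i pa z ∧ (∀ l, InSubtree T i l → S l = some (z l)) ∧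
    (∀ l, ¬ InSubtree T i l → S l = none) ∧ v = subCost P T i z ∧ v ≤ opt P T i pa) ∨
  (b ≤ v ∧ b ≤ opt P T i pa)

/-- All children that have backtracked for `d` have found optimal solutions. -/
def Exact (i : A) (st : AgentState A V) (d : V) : Prop :=
  ∃ z, Compat P T i st.cpa z ∧ z i = d ∧ st.spa d i = some d ∧
    (∀ l, l ≠ i → (∀ c ∈ st.gotBack d, ¬ InSubtree T c l) → st.spa d l = none) ∧
    ∀ c ∈ st.gotBack d, (∀ l, InSubtree T c l → st.spa d l = some (z l)) ∧
      st.lbc c d = subCost P T c z ∧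
      st.lbc c d ≤ opt P T c (Function.update st.cpa i (some d))

/-- The invariant of the local state of an agent `i` that searches with the initial upper bound `B`,
except for what concerns the search of the children in `S`. -/
structure Core (i : A) (st : AgentState A V) (B : ℝ≥0∞) (S : Finset A) : Prop where
  compat : ∃ z, Compat P T i st.cpa z
  high_eq : ∀ d, st.high d = ∑ j ∈ T.allParents i, P.privCost i j (some d) (st.cpa j) +
    ∑ j ∈ st.gotCost d, P.privCost j i (st.cpa j) (some d)
  gotCost_subset : ∀ d, st.gotCost d ⊆ T.allParents i
  gotCost_eq_empty : ∀ d, d ∉ st.requested → st.gotCost d = ∅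
  requested_subset : st.requested ⊆ P.dom i
  gotBack_spec : ∀ c d, c ∈ st.gotBack d →
    T.parent c = some i ∧ T.allParents i ⊆ st.gotCost d ∧ d ∈ P.dom i
  ub_spec : B ≤ st.ub ∨ ∃ e, Done P T i st e ∧ lb P T i st e ≤ st.ub
  srch_spec : ∀ c d, st.srch c = some d → T.parent c = some i ∧ d ∈ P.dom i
  gotBack_lt : ∀ c d e, c ∉ S → st.srch c = some d → c ∈ st.gotBack e → e < d
  passed : ∀ c e, T.parent c = some i → c ∉ S → e ∈ P.dom i →
    (∀ d, st.srch c = some d → e < d) → c ∈ st.gotBack e ∨ Beaten P T i st B e (lb P T i st e)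
  requested_of_srch : ∀ c d, c ∉ S → st.srch c = some d → ¬ T.allParents i ⊆ st.gotCost d →
    d ∈ st.requested
  lbc_le : ∀ c d, T.parent c = some i → d ∈ P.dom i → c ∉ st.gotBack d →
    st.lbc c d ≤ opt P T c (Function.update st.cpa i (some d))
  exact_or : ∀ d ∈ P.dom i, Exact P T i st d ∨
    (Beaten P T i st B d (optVal P T i st.cpa d) ∧ Beaten P T i st B d (lb P T i st d))

variable {P T}

theorem Beaten.mono_right {i : A} {st : AgentState A V} {B : ℝ≥0∞} {d : V} {x y : ℝ≥0∞}
    (h : Beaten P T i st B d x) (hxy : x ≤ y) : Beaten P T i st B d y := by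
  rcases h with h | ⟨e, he, hd, hl⟩
  · exact Or.inl (h.trans hxy)
  · exact Or.inr ⟨e, he, hd, hl.trans hxy⟩

theorem Beaten.mono {i : A} {st st' : AgentState A V} {B : ℝ≥0∞} {d : V} {x y : ℝ≥0∞}
    (h : Beaten P T i st B d x)
    (hst : ∀ e, Done P T i st e → Done P T i st' e ∧ lb P T i st' e = lb P T i st e)
    (hxy : x ≤ y) : Beaten P T i st' B d y := by
  rcases h with h | ⟨e, he, hd, hl⟩
  · exact Or.inl (h.trans hxy)
  · exact Or.inr ⟨e, he, (hst e hd).1, (hst e hd).2.trans_le (hl.trans hxy)⟩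

theorem Core.mono {i : A} {st : AgentState A V} {B : ℝ≥0∞} {S S' : Finset A}
    (h : Core P T i st B S) (hS : S ⊆ S') : Core P T i st B S' :=
  { h with
    gotBack_lt := fun c d e hc => h.gotBack_lt c d e (fun h' => hc (hS h'))
    passed := fun c e hp hc => h.passed c e hp (fun h' => hc (hS h'))
    requested_of_srch := fun c d hc => h.requested_of_srch c d (fun h' => hc (hS h')) }

theorem Core.high_le {i : A} {st : AgentState A V} {B : ℝ≥0∞} {S : Finset A}
    (h : Core P T i st B S) (d : V) : st.high d ≤ fullHigh P T i st.cpa d := by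
  rw [h.high_eq, fullHigh]
  gcongr
  exact h.gotCost_subset d

theorem Core.high_eq_fullHigh {i : A} {st : AgentState A V} {B : ℝ≥0∞} {S : Finset A}
    (h : Core P T i st B S) {d : V} (hd : T.allParents i ⊆ st.gotCost d) :
    st.high d = fullHigh P T i st.cpa d := by
  rw [h.high_eq, fullHigh, Finset.Subset.antisymm (h.gotCost_subset d) hd]

theorem Core.lb_le_optVal {i : A} {st : AgentState A V} {B : ℝ≥0∞} {S : Finset A}
    (h : Core P T i st B S) {d : V} (hd : d ∈ P.dom i) (he : Exact P T i st d) :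
    lb P T i st d ≤ optVal P T i st.cpa d := by
  obtain ⟨z, _, _, _, _, hz⟩ := he
  refine add_le_add (by exact_mod_cast h.high_le d) (Finset.sum_le_sum fun c hc => ?_)
  by_cases hcd : c ∈ st.gotBack d
  · exact (hz c hcd).2.2
  · exact h.lbc_le c d (mem_children.1 hc) hd hcd

theorem first_le {S : Finset V} {y : V} (hy : y ∈ S) : ∃ x, first S = some x ∧ x ≤ y :=
  ⟨S.min' ⟨y, hy⟩, by rw [first, dif_pos ⟨y, hy⟩], S.min'_le y hy⟩

/-- The outcome of a search that is over is correct. -/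
theorem Core.result {i : A} {st : AgentState A V} {B : ℝ≥0∞} {S : Finset A}
    (h : Core P T i st B S)
    (hall : ∀ e ∈ P.dom i, (T.children i ⊆ st.gotBack e ∧ T.allParents i ⊆ st.gotCost e) ∨
      Beaten P T i st B e (lb P T i st e)) :
    Result P T i st.cpa B (bestCost P T i st) (bestSpa P T i st) := by
  have hcases : ∀ e ∈ P.dom i, (Done P T i st e ∧ Exact P T i st e) ∨
      (Beaten P T i st B e (optVal P T i st.cpa e) ∧ Beaten P T i st B e (lb P T i st e)) := by
    intro e he
    rcases h.exact_or e he with hx | hb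
    · rcases hall e he with ⟨h1, h2⟩ | hb
      · exact Or.inl ⟨⟨he, h1, h2⟩, hx⟩
      · exact Or.inr ⟨hb.mono_right (h.lb_le_optVal he hx), hb⟩
    · exact Or.inr hb
  have hdone : ∀ e, Done P T i st e → B ≤ lb P T i st e ∨
      ∃ e' ≤ e, Done P T i st e' ∧ Exact P T i st e' ∧ lb P T i st e' ≤ lb P T i st e := by
    intro e
    induction hn : ((P.dom i).filter (· < e)).card using Nat.strong_induction_on generalizing e with
    | _ n ih =>
      intro he
      rcases hcases e he.1 with hx | ⟨_, hb | ⟨e', hlt, hd', hle⟩⟩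
      · exact Or.inr ⟨e, le_rfl, hx.1, hx.2, le_rfl⟩
      · exact Or.inl hb
      · have hcard : ((P.dom i).filter (· < e')).card < n := by
          rw [← hn]
          refine Finset.card_lt_card ⟨fun y hy => ?_, fun hsub => ?_⟩
          · simp only [Finset.mem_filter] at hy ⊢
            exact ⟨hy.1, hy.2.trans hlt⟩
          · have := hsub (Finset.mem_filter.2 ⟨hd'.1, hlt⟩)
            simp at this
        rcases ih _ hcard e' rfl hd' with hb | ⟨e'', h1, h2, h3, h4⟩
        · exact Or.inl (hb.trans hle)
        · exact Or.inr ⟨e'', h1.trans hlt.le, h2, h3, h4.trans hle⟩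
  have hbeat : ∀ e x, Beaten P T i st B e x → B ≤ x ∨
      ∃ e' < e, Done P T i st e' ∧ Exact P T i st e' ∧ lb P T i st e' ≤ x := by
    rintro e x (hb | ⟨e', hlt, hd', hle⟩)
    · exact Or.inl hb
    · rcases hdone e' hd' with hb | ⟨e'', h1, h2, h3, h4⟩
      · exact Or.inl (hb.trans hle)
      · exact Or.inr ⟨e'', h1.trans_lt hlt, h2, h3, h4.trans hle⟩
  have hcm : ∀ e, Done P T i st e → e ∈ cmplt P T i st := fun e he =>
    Finset.mem_filter.2 ⟨he.1, he.2.1⟩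
  have hbest : ∀ e, Done P T i st e → bestCost P T i st ≤ lb P T i st e := fun e he =>
    Finset.inf_le (hcm e he)
  by_cases hE : ∃ e, Done P T i st e ∧ Exact P T i st e ∧ lb P T i st e < B
  · left
    obtain ⟨e₀, hd₀, hx₀, hlt₀⟩ := hE
    have hvB : bestCost P T i st < B := (hbest e₀ hd₀).trans_lt hlt₀
    obtain ⟨y, hy, hyeq⟩ := Finset.exists_mem_eq_inf (cmplt P T i st) ⟨e₀, hcm e₀ hd₀⟩
      (lb P T i st)
    obtain ⟨d, hd, _⟩ := first_le
      (S := (cmplt P T i st).filter (fun d => lb P T i st d = bestCost P T i st))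
      (Finset.mem_filter.2 ⟨hy, hyeq.symm⟩)
    obtain ⟨hdc, hdeq⟩ := Finset.mem_filter.1 (first_mem hd)
    have hdx : Done P T i st d ∧ Exact P T i st d := by
      rcases hcases d (Finset.mem_filter.1 hdc).1 with hx | ⟨_, hb⟩
      · exact hx
      · exfalso
        rcases hbeat d _ hb with hb | ⟨e', hlt, hd', hx', hle⟩
        · rw [hdeq] at hb
          exact absurd hvB (not_lt.2 hb)
        · have heq : lb P T i st e' = bestCost P T i st :=
            le_antisymm (hle.trans hdeq.le) (hbest e' hd')
          obtain ⟨x, hx, hxle⟩ := first_le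
            (S := (cmplt P T i st).filter (fun d => lb P T i st d = bestCost P T i st))
            (Finset.mem_filter.2 ⟨hcm e' hd', heq⟩)
          rw [hd] at hx
          cases hx
          exact absurd hlt (not_lt.2 hxle)
    obtain ⟨hdd, z, hz, hzi, hsi, hsn, hsc⟩ := hdx
    have hspa : bestSpa P T i st = st.spa d := by
      unfold bestSpa bestVal
      rw [hd]
    refine ⟨z, hz, ?_, ?_, ?_, ?_⟩
    · rw [hspa]
      rintro l (rfl | hl)
      · rw [hsi, hzi]
      · obtain ⟨c, hc, hl⟩ := isAncestor_iff_child.1 hl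
        exact (hsc c (hdd.2.1 (mem_children.2 hc))).1 l hl
    · rw [hspa]
      intro l hl
      refine hsn l (fun hli => hl (Or.inl hli)) fun c hc hl' => hl ?_
      exact Or.inr (inSubtree_child (h.gotBack_spec c d hc).1 hl')
    · rw [← hdeq, lb, subCost_eq, h.high_eq_fullHigh hdd.2.2, ← hzi, hz.fullHigh_eq]
      push_cast
      congr 1
      refine Finset.sum_congr rfl fun c hc => ?_
      rw [hzi]
      exact (hsc c (hdd.2.1 hc)).2.1
    · refine le_opt fun e he => ?_
      rcases hcases e he with hx | ⟨hb, _⟩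
      · exact (hbest e hx.1).trans (h.lb_le_optVal he hx.2)
      · rcases hbeat e _ hb with hb | ⟨e', _, hd', _, hle⟩
        · exact hvB.le.trans hb
        · exact (hbest e' hd').trans hle
  · right
    push Not at hE
    have key : ∀ e x, Beaten P T i st B e x → B ≤ x := by
      intro e x hb
      rcases hbeat e x hb with hb | ⟨e', _, hd', hx', hle⟩
      · exact hb
      · exact (hE e' hd' hx').trans hle
    constructor
    · refine Finset.le_inf fun e he => ?_
      rcases hcases e (Finset.mem_filter.1 he).1 with hx | ⟨_, hb⟩
      · exact hE e hx.1 hx.2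
      · exact key e _ hb
    · refine le_opt fun e he => ?_
      rcases hcases e he with hx | ⟨hb, _⟩
      · exact (hE e hx.1 hx.2).trans (h.lb_le_optVal he hx.2)
      · exact key e _ hb

/-- The state at the beginning of a search. -/
theorem core_initSearch {i : A} {st : AgentState A V} {pa : PAssign A V} {B : ℝ≥0∞}
    (hpa : ∃ z, Compat P T i pa z)
    (hu : ∀ c, T.parent c = some i → ∃ u, st.childUtil c = some u ∧ ChildBound P T c u) :
    Core P T i (initSearch P T i st pa B) B (T.children i) where
  compat := hpa
  high_eq d := by simp [initSearch]
  gotCost_subset d := Finset.empty_subset _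
  gotCost_eq_empty d _ := rfl
  requested_subset := Finset.empty_subset _
  gotBack_spec c d hc := absurd hc (Finset.notMem_empty c)
  ub_spec := Or.inl le_rfl
  srch_spec c d hc := by cases hc
  gotBack_lt c d e _ hc := by cases hc
  passed c e hp hc := absurd (mem_children.2 hp) hc
  requested_of_srch c d _ hc := by cases hc
  lbc_le c d hc hd _ := by
    obtain ⟨u, hu, hb⟩ := hu c hc
    simp only [initSearch, hu, Option.getD_some]
    exact childBound_le_opt hc hb pa d
  exact_or d hd := by
    left
    obtain ⟨z, hz⟩ := hpa
    refine ⟨Function.update z i d, ⟨fun l => ?_, fun j hj => ?_⟩, by simp, by simp [initSearch],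
      fun l hl _ => by simp [initSearch, Function.update_of_ne hl],
      fun c hc => absurd hc (Finset.notMem_empty c)⟩
    · by_cases hl : l = i
      · subst hl; simpa using hd
      · rw [Function.update_of_ne hl]; exact hz.1 l
    · have hne : j ≠ i := by rintro rfl; exact isAncestor_irrefl _ hj
      rw [Function.update_of_ne hne]
      exact hz.2 j hj

/-- The children in `S` turn to `e`. -/
def setSrch (st : AgentState A V) (S : Finset A) (e : Option V) : AgentState A V :=
  { st with srch := fun c => if c ∈ S then e else st.srch c }

theorem Core.setSrch {i : A} {st : AgentState A V} {B : ℝ≥0∞} {S : Finset A}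
    (h : Core P T i st B S) {e : Option V} (hS : S ⊆ T.children i)
    (hdom : ∀ x, e = some x → x ∈ P.dom i)
    (hlt : ∀ c ∈ S, ∀ x y, e = some x → c ∈ st.gotBack y → y < x)
    (hpass : ∀ c ∈ S, ∀ y ∈ P.dom i, (∀ x, e = some x → y < x) →
      c ∈ st.gotBack y ∨ Beaten P T i st B y (lb P T i st y)) :
    Core P T i (setSrch st S e) B S ∧ ((∀ x, e = some x →
      ¬ T.allParents i ⊆ st.gotCost x → x ∈ st.requested) → Core P T i (setSrch st S e) B ∅) := by
  have hsp : ∀ c d, (PTISABB.setSrch st S e).srch c = some d →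
      T.parent c = some i ∧ d ∈ P.dom i := by
    intro c d hc
    simp only [PTISABB.setSrch] at hc
    split_ifs at hc with hcS
    · exact ⟨mem_children.1 (hS hcS), hdom d hc⟩
    · exact h.srch_spec c d hc
  have hgl : ∀ c d y, (PTISABB.setSrch st S e).srch c = some d → c ∈ st.gotBack y → y < d := by
    intro c d y hc hy
    simp only [PTISABB.setSrch] at hc
    split_ifs at hc with hcS
    · exact hlt c hcS d y hc hy
    · exact h.gotBack_lt c d y hcS hc hy
  have hps : ∀ c y, T.parent c = some i → y ∈ P.dom i →
      (∀ d, (PTISABB.setSrch st S e).srch c = some d → y < d) →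
      c ∈ st.gotBack y ∨ Beaten P T i st B y (lb P T i st y) := by
    intro c y hp hy hc
    simp only [PTISABB.setSrch] at hc
    split_ifs at hc with hcS
    · exact hpass c hcS y hy hc
    · exact h.passed c y hp hcS hy hc
  refine ⟨{ h with
    srch_spec := hsp
    gotBack_lt := fun c d y _ => hgl c d y
    passed := fun c y hp _ => hps c y hp
    requested_of_srch := ?_ }, fun hreq => { h with
    srch_spec := hsp
    gotBack_lt := fun c d y _ => hgl c d y
    passed := fun c y hp _ => hps c y hp
    requested_of_srch := ?_ }⟩
  · intro c d hcS hc
    simp only [PTISABB.setSrch, if_neg hcS] at hc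
    exact h.requested_of_srch c d hcS hc
  · intro c d _ hc
    simp only [PTISABB.setSrch] at hc
    split_ifs at hc with hcS
    · exact hreq d hc
    · exact h.requested_of_srch c d hcS hc

theorem nextFeasible_passed {i : A} {st : AgentState A V} {B : ℝ≥0∞} {S : Finset A}
    (h : Core P T i st B S) {d : V} (Q : V → Prop)
    (hQ : ∀ y ∈ P.dom i, y ≤ d → Q y ∨ Beaten P T i st B y (lb P T i st y))
    (hdone : ∀ y, Done P T i st y → y ≤ d) {y : V} (hy : y ∈ P.dom i)
    (hlt : ∀ x, nextFeasible P T i st d = some x → y < x) :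
    Q y ∨ Beaten P T i st B y (lb P T i st y) := by
  by_cases hyd : y ≤ d
  · exact hQ y hy hyd
  · right
    push Not at hyd
    have hub : st.ub ≤ lb P T i st y := by
      by_contra hcon
      push Not at hcon
      obtain ⟨x, hx, hxy⟩ := first_le
        (S := (P.dom i).filter (fun e => d < e ∧ lb P T i st e < st.ub))
        (Finset.mem_filter.2 ⟨hy, hyd, hcon⟩)
      exact absurd (hlt x hx) (not_lt.2 hxy)
    rcases h.ub_spec with hB | ⟨e, he, hle⟩
    · exact Or.inl (hB.trans hub)
    · exact Or.inr ⟨e, (hdone e he).trans_lt hyd, he, hle.trans hub⟩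

theorem lb_le_lb {i : A} {st st' : AgentState A V} {d : V} (h1 : st.high d ≤ st'.high d)
    (h2 : ∀ c ∈ T.children i, st.lbc c d ≤ st'.lbc c d) : lb P T i st d ≤ lb P T i st' d :=
  add_le_add (by exact_mod_cast h1) (Finset.sum_le_sum h2)

theorem lb_congr {i : A} {st st' : AgentState A V} {d : V} (h1 : st.high d = st'.high d)
    (h2 : ∀ c ∈ T.children i, st.lbc c d = st'.lbc c d) : lb P T i st d = lb P T i st' d := by
  unfold lb
  rw [h1, Finset.sum_congr rfl h2]

theorem Core.lowerUb {i : A} {st : AgentState A V} {B : ℝ≥0∞} {S : Finset A}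
    (h : Core P T i st B S) {d : V} (hd : Done P T i st d) :
    Core P T i (lowerUb P T i st d) B S :=
  { h with
    ub_spec := by
      rcases le_total st.ub (lb P T i st d) with hle | hle
      · rcases h.ub_spec with hB | ⟨e, he, hle'⟩
        · exact Or.inl (le_min hB (hB.trans hle))
        · exact Or.inr ⟨e, he, le_min hle' (hle'.trans hle)⟩
      · exact Or.inr ⟨d, hd, le_min hle le_rfl⟩ }

section AddCost

variable {i j : A} {st : AgentState A V} {B : ℝ≥0∞} {S : Finset A} {d : V} {v : ℝ≥0}

theorem addCost_high_le (e : V) : st.high e ≤ (addCost st j d v).high e := by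
  simp only [addCost, Function.update_apply]
  split_ifs with he
  · subst he; exact le_self_add
  · exact le_rfl

theorem addCost_gotCost_subset (e : V) : st.gotCost e ⊆ (addCost st j d v).gotCost e := by
  simp only [addCost, Function.update_apply]
  split_ifs with he
  · subst he; exact Finset.subset_insert _ _
  · exact subset_rfl

theorem addCost_lb_le (e : V) : lb P T i st e ≤ lb P T i (addCost st j d v) e :=
  lb_le_lb (addCost_high_le e) fun _ _ => le_rfl

theorem addCost_done (hj : j ∈ T.allParents i) (hjd : j ∉ st.gotCost d) (e : V)
    (he : Done P T i st e) :
    Done P T i (addCost st j d v) e ∧ lb P T i (addCost st j d v) e = lb P T i st e := by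
  refine ⟨⟨he.1, he.2.1, he.2.2.trans (addCost_gotCost_subset e)⟩, ?_⟩
  have hne : e ≠ d := by rintro rfl; exact hjd (he.2.2 hj)
  exact lb_congr (by simp [addCost, Function.update_of_ne hne]) fun _ _ => rfl

theorem Core.addCost (h : Core P T i st B S) (hj : j ∈ T.allParents i)
    (hjd : j ∉ st.gotCost d) (hreq : d ∈ st.requested)
    (hv : v = P.privCost j i (st.cpa j) (some d)) : Core P T i (addCost st j d v) B S where
  compat := h.compat
  high_eq e := by
    simp only [PTISABB.addCost, Function.update_apply]
    split_ifs with he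
    · subst he
      rw [Finset.sum_insert hjd, h.high_eq, hv]
      ring
    · exact h.high_eq e
  gotCost_subset e := by
    simp only [PTISABB.addCost, Function.update_apply]
    split_ifs with he
    · exact Finset.insert_subset hj (h.gotCost_subset d)
    · exact h.gotCost_subset e
  gotCost_eq_empty e he := by
    have hne : e ≠ d := by rintro rfl; exact he hreq
    simp only [PTISABB.addCost, Function.update_of_ne hne]
    exact h.gotCost_eq_empty e he
  requested_subset := h.requested_subset
  gotBack_spec c e hc :=
    ⟨(h.gotBack_spec c e hc).1, (h.gotBack_spec c e hc).2.1.trans (addCost_gotCost_subset e),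
      (h.gotBack_spec c e hc).2.2⟩
  ub_spec := by
    rcases h.ub_spec with hB | ⟨e, he, hle⟩
    · exact Or.inl hB
    · exact Or.inr ⟨e, (addCost_done hj hjd e he).1, (addCost_done hj hjd e he).2.trans_le hle⟩
  srch_spec := h.srch_spec
  gotBack_lt := h.gotBack_lt
  passed c e hp hc he hs := by
    rcases h.passed c e hp hc he hs with h1 | h1
    · exact Or.inl h1
    · exact Or.inr (h1.mono (addCost_done hj hjd) (addCost_lb_le e))
  requested_of_srch c e hc hs hn :=
    h.requested_of_srch c e hc hs fun h' => hn (h'.trans (addCost_gotCost_subset e))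
  lbc_le := h.lbc_le
  exact_or e he := by
    rcases h.exact_or e he with h1 | ⟨h1, h2⟩
    · exact Or.inl h1
    · exact Or.inr ⟨h1.mono (addCost_done hj hjd) le_rfl,
        h2.mono (addCost_done hj hjd) (addCost_lb_le e)⟩

end AddCost

/-- The upper bound `b` sent to the child `c` for the value `d` is large enough. -/
def LinkBound (P : ADCOP A V) (T : PseudoTree P.graph) (i : A) (st : AgentState A V)
    (B : ℝ≥0∞) (c : A) (d : V) (b : ℝ≥0∞) : Prop :=
  st.lbc c d ≤ b ∧
    Beaten P T i st B d (st.high d + ∑ c' ∈ (T.children i).erase c, st.lbc c' d + b)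

theorem LinkBound.mono {i c : A} {st st' : AgentState A V} {B : ℝ≥0∞} {d : V} {b : ℝ≥0∞}
    (h : LinkBound P T i st B c d b)
    (hst : ∀ e, Done P T i st e → Done P T i st' e ∧ lb P T i st' e = lb P T i st e)
    (hc : st'.lbc c d = st.lbc c d) (hhigh : st.high d ≤ st'.high d)
    (hl : ∀ c' ∈ T.children i, st.lbc c' d ≤ st'.lbc c' d) : LinkBound P T i st' B c d b := by
  refine ⟨hc.trans_le h.1, h.2.mono hst ?_⟩
  gcongr with c' hc'
  exact hl c' (Finset.mem_of_mem_erase hc')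

/-- The bound for a child computed by the algorithm. -/
theorem linkBound_sub {i c : A} {st : AgentState A V} {B : ℝ≥0∞} {S : Finset A}
    (h : Core P T i st B S) (hc : T.parent c = some i) {d : V} (hlt : lb P T i st d < st.ub)
    (hdone : ∀ y, Done P T i st y → y < d) :
    LinkBound P T i st B c d
      (st.ub - (st.high d + ∑ c' ∈ (T.children i).erase c, st.lbc c' d)) := by
  have hsum : lb P T i st d =
      st.high d + ∑ c' ∈ (T.children i).erase c, st.lbc c' d + st.lbc c d := by
    rw [lb, ← Finset.add_sum_erase _ _ (mem_children.2 hc)]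
    ring
  constructor
  · refine ENNReal.le_sub_of_add_le_left ?_ (hsum ▸ hlt.le)
    intro htop
    rw [htop, top_add] at hsum
    rw [hsum] at hlt
    exact not_top_lt hlt
  · have hub : st.ub ≤ st.high d + ∑ c' ∈ (T.children i).erase c, st.lbc c' d +
        (st.ub - (st.high d + ∑ c' ∈ (T.children i).erase c, st.lbc c' d)) :=
      le_add_tsub
    rcases h.ub_spec with hB | ⟨e, he, hle⟩
    · exact Or.inl (hB.trans hub)
    · exact Or.inr ⟨e, hdone e he, he, hle.trans hub⟩

section AddBack

variable {i c : A} {st : AgentState A V} {B : ℝ≥0∞} {d : V} {b v : ℝ≥0∞} {pa : PAssign A V}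

theorem addBack_lbc_le (hv : st.lbc c d ≤ v) (c' : A) (e : V) :
    st.lbc c' e ≤ (addBack st c d v pa).lbc c' e := by
  simp only [addBack, Function.update_apply]
  split_ifs with h1
  · rw [Function.update_apply]
    split_ifs with h2
    · rw [h1, h2]; exact hv
    · rw [h1]
  · exact le_rfl

theorem addBack_lbc_of_ne {c' : A} {e : V} (hne : c' ≠ c ∨ e ≠ d) :
    (addBack st c d v pa).lbc c' e = st.lbc c' e := by
  simp only [addBack, Function.update_apply]
  split_ifs with h1
  · rw [Function.update_of_ne (hne.resolve_left (not_not.2 h1)), h1]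
  · rfl

theorem addBack_lbc_self : (addBack st c d v pa).lbc c d = v := by simp [addBack]

theorem addBack_gotBack (e : V) (c' : A) :
    c' ∈ (addBack st c d v pa).gotBack e ↔ c' ∈ st.gotBack e ∨ (c' = c ∧ e = d) := by
  simp only [addBack, Function.update_apply]
  split_ifs with h1
  · subst h1; simp [or_comm]
  · simp [h1]

theorem addBack_done (hc : c ∈ T.children i) (hcd : c ∉ st.gotBack d) (e : V)
    (he : Done P T i st e) :
    Done P T i (addBack st c d v pa) e ∧ lb P T i (addBack st c d v pa) e = lb P T i st e := by
  refine ⟨⟨he.1, fun c' hc' => (addBack_gotBack e c').2 (Or.inl (he.2.1 hc')), he.2.2⟩, ?_⟩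
  have hne : e ≠ d := by rintro rfl; exact hcd (he.2.1 hc)
  exact lb_congr rfl fun c' _ => addBack_lbc_of_ne (Or.inr hne)

theorem addBack_spa_of_ne {e : V} (he : e ≠ d) : (addBack st c d v pa).spa e = st.spa e := by
  simp [addBack, Function.update_of_ne he]

theorem addBack_spa (l : A) : (addBack st c d v pa).spa d l = (pa l).or (st.spa d l) := by
  simp [addBack]

theorem lbc_le_of_result (h : Core P T i st B ∅) (hs : st.srch c = some d)
    (hb : LinkBound P T i st B c d b)
    (hr : Result P T c (Function.update st.cpa i (some d)) b v pa) : st.lbc c d ≤ v := by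
  rcases hr with ⟨z, hz, _, _, hv, _⟩ | ⟨hbv, _⟩
  · obtain ⟨hc, hd⟩ := h.srch_spec c d hs
    have hcd : c ∉ st.gotBack d := fun h' =>
      lt_irrefl _ (h.gotBack_lt c d d (Finset.notMem_empty c) hs h')
    rw [hv]
    exact (h.lbc_le c d hc hd hcd).trans (opt_le hz)
  · exact hb.1.trans hbv

theorem Exact.addBack (he : Exact P T i st d) (h : Core P T i st B ∅)
    (hc : T.parent c = some i) {z : A → V}
    (hz : Compat P T c (Function.update st.cpa i (some d)) z)
    (hin : ∀ l, InSubtree T c l → pa l = some (z l)) (hout : ∀ l, ¬ InSubtree T c l → pa l = none)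
    (hv : v = subCost P T c z) (hopt : v ≤ opt P T c (Function.update st.cpa i (some d)))
    (hcd : c ∉ st.gotBack d) : Exact P T i (addBack st c d v pa) d := by
  classical
  obtain ⟨z₀, hz₀, hz₀i, hsi, hsn, hsc⟩ := he
  obtain ⟨hz, hzi⟩ := (compat_child_iff hc).1 hz
  set z₁ : A → V := fun l => if InSubtree T c l then z l else z₀ l with hz₁
  have hanc : ∀ j, IsAncestor T.parent j c → z j = z₀ j ∧ ¬ InSubtree T c j := by
    intro j hj
    refine ⟨?_, not_inSubtree_of_isAncestor hj⟩
    rcases (isAncestor_iff_of_parent hc j).1 hj with rfl | hj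
    · rw [hzi, hz₀i]
    · exact Option.some_injective _ ((hz.2 j hj).symm.trans (hz₀.2 j hj))
  have h1 : ∀ j, IsAncestor T.parent j c → z₁ j = z₀ j := fun j hj => if_neg (hanc j hj).2
  have hic := isAncestor_of_parent hc
  have hsub : subCost P T c z₁ = subCost P T c z :=
    subCost_congr (fun j hj => if_pos hj) fun j hj => by rw [h1 j hj, (hanc j hj).1]
  have hother : ∀ c', T.parent c' = some i → c' ≠ c → ∀ l, InSubtree T c' l → z₁ l = z₀ l :=
    fun c' hc' hne l hl => if_neg fun hl' => hne (child_unique hc' hc hl hl')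
  refine ⟨z₁, ⟨fun l => ?_, fun j hj => ?_⟩, ?_, ?_, ?_, ?_⟩
  · simp only [hz₁]
    split_ifs
    · exact hz.1 l
    · exact hz₀.1 l
  · rw [h1 j (isAncestor_trans hj hic)]
    exact hz₀.2 j hj
  · rw [h1 i hic, hz₀i]
  · rw [addBack_spa, hout i (not_inSubtree_of_isAncestor hic), Option.none_or, hsi]
  · intro l hl hl'
    rw [addBack_spa, hout l (hl' c ((addBack_gotBack d c).2 (Or.inr ⟨rfl, rfl⟩))), Option.none_or]
    exact hsn l hl fun c' hc' => hl' c' ((addBack_gotBack d c').2 (Or.inl hc'))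
  · intro c' hc'
    rcases (addBack_gotBack d c').1 hc' with hold | ⟨rfl, _⟩
    · have hne : c' ≠ c := fun heq => hcd (heq ▸ hold)
      have hp := (h.gotBack_spec c' d hold).1
      obtain ⟨hs1, hs2, hs3⟩ := hsc c' hold
      refine ⟨fun l hl => ?_, ?_, ?_⟩
      · rw [addBack_spa, hout l fun hl' => hne (child_unique hp hc hl hl'), Option.none_or,
          hs1 l hl, hother c' hp hne l hl]
      · rw [addBack_lbc_of_ne (Or.inl hne), hs2]
        congr 1
        refine subCost_congr (fun l hl => (hother c' hp hne l hl).symm) fun j hj => (h1 j ?_).symm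
        exact (isAncestor_iff_of_parent hc j).2 ((isAncestor_iff_of_parent hp j).1 hj)
      · rw [addBack_lbc_of_ne (Or.inl hne)]
        exact hs3
    · refine ⟨fun l hl => ?_, ?_, ?_⟩
      · rw [addBack_spa, hin l hl, Option.some_or]
        simp only [hz₁, if_pos hl]
      · rw [addBack_lbc_self, hv, hsub]
      · rw [addBack_lbc_self]
        exact hopt

theorem Core.addBack (h : Core P T i st B ∅) (hs : st.srch c = some d)
    (hcost : T.allParents i ⊆ st.gotCost d) (hb : LinkBound P T i st B c d b)
    (hr : Result P T c (Function.update st.cpa i (some d)) b v pa) :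
    Core P T i (addBack st c d v pa) B {c} := by
  obtain ⟨hc, hd⟩ := h.srch_spec c d hs
  have hcd : c ∉ st.gotBack d := fun h' =>
    lt_irrefl _ (h.gotBack_lt c d d (Finset.notMem_empty c) hs h')
  have hdone := addBack_done (P := P) (v := v) (pa := pa) (mem_children.2 hc) hcd
  have hle := lbc_le_of_result h hs hb hr
  have hlb : ∀ e, lb P T i st e ≤ lb P T i (PTISABB.addBack st c d v pa) e := fun e =>
    lb_le_lb le_rfl fun c' _ => addBack_lbc_le hle c' e
  have hsumlb : ∀ x, x ≤ v → st.high d + ∑ c' ∈ (T.children i).erase c, st.lbc c' d + x ≤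
      lb P T i (PTISABB.addBack st c d v pa) d := by
    intro x hx
    rw [lb, ← Finset.add_sum_erase _ _ (mem_children.2 hc), addBack_lbc_self, add_comm v,
      ← add_assoc]
    refine add_le_add (add_le_add le_rfl (Finset.sum_le_sum fun c' hc' => ?_)) hx
    exact addBack_lbc_le hle c' d
  refine
    { compat := h.compat
      high_eq := h.high_eq
      gotCost_subset := h.gotCost_subset
      gotCost_eq_empty := h.gotCost_eq_empty
      requested_subset := h.requested_subset
      gotBack_spec := ?_
      ub_spec := ?_
      srch_spec := h.srch_spec
      gotBack_lt := ?_
      passed := ?_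
      requested_of_srch := fun c' e _ => h.requested_of_srch c' e (Finset.notMem_empty c')
      lbc_le := ?_
      exact_or := ?_ }
  · intro c' e hc'
    rcases (addBack_gotBack e c').1 hc' with hc' | ⟨rfl, rfl⟩
    · exact h.gotBack_spec c' e hc'
    · exact ⟨hc, hcost, hd⟩
  · rcases h.ub_spec with hB | ⟨e, he, hle'⟩
    · exact Or.inl hB
    · exact Or.inr ⟨e, (hdone e he).1, (hdone e he).2.trans_le hle'⟩
  · intro c' e y hne hs' hy
    rw [Finset.mem_singleton] at hne
    rcases (addBack_gotBack y c').1 hy with hy | ⟨rfl, _⟩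
    · exact h.gotBack_lt c' e y (Finset.notMem_empty c') hs' hy
    · exact absurd rfl hne
  · intro c' e hp _ he hlt
    rcases h.passed c' e hp (Finset.notMem_empty c') he hlt with h1 | h1
    · exact Or.inl ((addBack_gotBack e c').2 (Or.inl h1))
    · exact Or.inr (h1.mono hdone (hlb e))
  · intro c' e hp he hn
    rw [addBack_gotBack, not_or, not_and_or] at hn
    rw [addBack_lbc_of_ne hn.2]
    exact h.lbc_le c' e hp he hn.1
  · intro e he
    by_cases hed : e = d
    · subst hed
      rcases h.exact_or e he with h1 | ⟨h1, h2⟩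
      · rcases hr with ⟨z, hz, hin, hout, hv, hopt⟩ | ⟨hbv, hbo⟩
        · exact Or.inl (h1.addBack h hc hz hin hout hv hopt hcd)
        · right
          refine ⟨hb.2.mono hdone ?_, hb.2.mono hdone (hsumlb b hbv)⟩
          rw [optVal, ← Finset.add_sum_erase _ _ (mem_children.2 hc), add_comm (opt P T c _),
            ← add_assoc, h.high_eq_fullHigh hcost]
          refine add_le_add (add_le_add le_rfl (Finset.sum_le_sum fun c' hc' => ?_)) hbo
          obtain ⟨z, _, _, _, _, hz⟩ := h1
          by_cases hc'e : c' ∈ st.gotBack e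
          · exact (hz c' hc'e).2.2
          · exact h.lbc_le c' e (mem_children.1 (Finset.mem_of_mem_erase hc')) he hc'e
      · exact Or.inr ⟨h1.mono hdone le_rfl, h2.mono hdone (hlb e)⟩
    · rcases h.exact_or e he with ⟨z, h1, h2, h3, h4, h5⟩ | ⟨h1, h2⟩
      · left
        have hgb : ∀ c', c' ∈ (PTISABB.addBack st c d v pa).gotBack e ↔ c' ∈ st.gotBack e := by
          intro c'
          rw [addBack_gotBack]
          simp [hed]
        refine ⟨z, h1, h2, ?_, ?_, ?_⟩
        · rw [addBack_spa_of_ne hed]; exact h3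
        · intro l hl hl'
          rw [addBack_spa_of_ne hed]
          exact h4 l hl fun c' hc' => hl' c' ((hgb c').2 hc')
        · intro c' hc'
          rw [addBack_spa_of_ne hed, addBack_lbc_of_ne (Or.inr hed)]
          exact h5 c' ((hgb c').1 hc')
      · exact Or.inr ⟨h1.mono hdone le_rfl, h2.mono hdone (hlb e)⟩

end AddBack

end Local

section Slots

variable {A V : Type*}

/-- The communication channels: UTIL messages of `c`; CPA messages for and BACKTRACK messages of
`c`; the request of `i` for the cost of `j` for the value `d`; TERMINATE messages for `c`. -/
inductive Slot (A V : Type*) where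
  | util (c : A)
  | link (c : A)
  | req (i j : A) (d : V)
  | term (c : A)

def slotOf (p : Packet A V) : Slot A V :=
  match p.msg with
  | .util _ => .util p.src
  | .cpa _ _ => .link p.dst
  | .costReq d => .req p.src p.dst d
  | .cost d _ => .req p.dst p.src d
  | .backtrack _ _ => .link p.src
  | .terminate => .term p.dst

open Classical in
/-- The messages in transit in the channel `x`. -/
def slot (net : Multiset (Packet A V)) (x : Slot A V) : Multiset (Packet A V) :=
  net.filter fun p => slotOf p = x

theorem slot_add (m m' : Multiset (Packet A V)) (x : Slot A V) :
    slot (m + m') x = slot m x + slot m' x := by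
  classical exact Multiset.filter_add _ _ _

@[simp] theorem slot_zero (x : Slot A V) : slot (0 : Multiset (Packet A V)) x = 0 := by
  classical exact Multiset.filter_zero _

theorem slot_cons_self (p : Packet A V) (m : Multiset (Packet A V)) :
    slot (p ::ₘ m) (slotOf p) = p ::ₘ slot m (slotOf p) := by
  classical
  exact Multiset.filter_cons_of_pos _ rfl

theorem slot_cons_of_ne {p : Packet A V} {x : Slot A V} (h : slotOf p ≠ x)
    (m : Multiset (Packet A V)) : slot (p ::ₘ m) x = slot m x := by
  classical
  exact Multiset.filter_cons_of_neg _ h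

theorem slot_singleton_self (p : Packet A V) : slot {p} (slotOf p) = {p} := by
  rw [← Multiset.cons_zero, slot_cons_self, slot_zero]

theorem slot_singleton_of_ne {p : Packet A V} {x : Slot A V} (h : slotOf p ≠ x) :
    slot {p} x = 0 := by
  rw [← Multiset.cons_zero, slot_cons_of_ne h, slot_zero]

theorem slot_eq_zero {m : Multiset (Packet A V)} {x : Slot A V}
    (h : ∀ p ∈ m, slotOf p ≠ x) : slot m x = 0 := by
  classical exact Multiset.filter_eq_nil.2 h

theorem eq_zero_of_slots {m : Multiset (Packet A V)} (h : ∀ x, slot m x = 0) : m = 0 := by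
  classical
  refine Multiset.eq_zero_of_forall_notMem fun p hp => ?_
  have : p ∈ slot m (slotOf p) := Multiset.mem_filter.2 ⟨hp, rfl⟩
  rw [h] at this
  exact Multiset.notMem_zero _ this

theorem slot_map (S : Finset A) (g : A → Packet A V) (σ : A → Slot A V)
    (hg : ∀ c, slotOf (g c) = σ c) (hσ : Function.Injective σ) (c : A) [Decidable (c ∈ S)] :
    slot (S.val.map g) (σ c) = if c ∈ S then {g c} else 0 := by
  classical
  unfold slot
  rw [Multiset.filter_map]
  have : S.val.filter ((fun p => slotOf p = σ c) ∘ g) = (S.filter (fun c' => c' = c)).val := by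
    rw [Finset.filter_val]
    refine Multiset.filter_congr fun c' _ => ?_
    simp only [Function.comp, hg]
    exact hσ.eq_iff
  rw [this]
  have h2 : S.filter (fun c' => c' = c) = if c ∈ S then {c} else ∅ := by
    ext c'
    split_ifs with h <;> simp
    · rintro rfl; exact h
    · rintro h' rfl; exact h h'
  rw [h2]
  split_ifs <;> simp

theorem slot_map_of_ne (S : Finset A) (g : A → Packet A V) {x : Slot A V}
    (hg : ∀ c, slotOf (g c) ≠ x) : slot (S.val.map g) x = 0 := by
  refine slot_eq_zero fun p hp => ?_
  obtain ⟨c, _, rfl⟩ := Multiset.mem_map.1 hp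
  exact hg c

end Slots

section Global

variable {A V : Type*} [Fintype A] [DecidableEq A] [LinearOrder V]
  (P : ADCOP A V) (T : PseudoTree P.graph)

/-- The child `c` of `i` has to explore the value `d`. -/
def Busy (i : A) (st : AgentState A V) (c : A) (d : V) : Prop :=
  st.srch c = some d ∧ T.allParents i ⊆ st.gotCost d

/-- Costs for the value `d` are missing. -/
def Pending (i : A) (st : AgentState A V) (d : V) : Prop :=
  d ∈ st.requested ∧ ¬ T.allParents i ⊆ st.gotCost d

/-- The invariant of an agent `i` that searches with the initial upper bound `B`. -/
def Searching (i : A) (st : AgentState A V) (B : ℝ≥0∞) : Prop :=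
  Core P T i st B ∅ ∧
  ((T.children i ≠ ∅ ∧ (∃ c d, st.srch c = some d) ∧
      ∀ d, Pending P T i st d → ∃ c, st.srch c = some d) ∨
    (T.children i = ∅ ∧ ∃ d, Pending P T i st d ∧
      (∀ e ∈ st.requested, e ≤ d ∧ (e ≠ d → T.allParents i ⊆ st.gotCost e)) ∧
      ∀ e ∈ P.dom i, e < d → T.allParents i ⊆ st.gotCost e ∨
        Beaten P T i st B e (lb P T i st e)))

/-- The state of the exploration of a value `d` of `p` by the child `c` of `p`: the CPA message is in
transit, or `c` is searching, or the BACKTRACK message is in transit. -/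
def LinkOK (p c : A) (pa : PAssign A V) (actc : Prop) (cpac : PAssign A V) (b : ℝ≥0∞)
    (M : Multiset (Packet A V)) : Prop :=
  (¬ actc ∧ M = {⟨p, c, .cpa pa b⟩}) ∨ (actc ∧ M = 0 ∧ cpac = pa) ∨
    (¬ actc ∧ ∃ v S, M = {⟨c, p, .backtrack v S⟩} ∧ Result P T c pa b v S)

/-- The invariant of the messages between `p` and its child `c`; here `free` says that the child has
nothing to do. -/
def LinkInv (p c : A) (actp : Prop) (stp : AgentState A V) (bp : ℝ≥0∞) (free : Prop)
    (actc : Prop) (cpac : PAssign A V) (bc : ℝ≥0∞) (M : Multiset (Packet A V)) : Prop :=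
  ((free ∨ ¬ actp ∨ ∀ d, ¬ Busy P T p stp c d) → ¬ actc ∧ M = 0) ∧
  (¬ free → actp → ∀ d, Busy P T p stp c d → LinkBound P T p stp bp c d bc ∧
    LinkOK P T p c (Function.update stp.cpa p (some d)) actc cpac bc M)

/-- The invariant of the messages about the cost of `j` for the value `d` of `i`. -/
def ReqInv (i j : A) (d : V) (act : Prop) (st : AgentState A V)
    (M : Multiset (Packet A V)) : Prop :=
  (¬ (act ∧ j ∈ T.allParents i ∧ d ∈ st.requested ∧ j ∉ st.gotCost d) → M = 0) ∧
  (act → j ∈ T.allParents i → d ∈ st.requested → j ∉ st.gotCost d →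
    M = {⟨i, j, .costReq d⟩} ∨ M = {⟨j, i, .cost d (P.privCost j i (st.cpa j) (some d))⟩})

/-- The global part of the invariant of the search phase. `Act` tells which agents are searching and
`β` with which initial upper bound. -/
structure Base (s : Config A V) (Act : A → Prop) (β : A → ℝ≥0∞) (S : Finset A) : Prop where
  util_known : ∀ i c, T.parent c = some i →
    ∃ u, (s.agents i).childUtil c = some u ∧ ChildBound P T c u
  alive : ∀ i, ¬ (s.agents i).terminated
  act_root : Act T.root
  bound_root : β T.root = ⊤
  no_util : ∀ c, slot s.net (.util c) = 0
  no_term : ∀ c, slot s.net (.term c) = 0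
  link_root : slot s.net (.link T.root) = 0
  link : ∀ c p, T.parent c = some p → LinkInv P T p c (Act p) (s.agents p) (β p) (c ∈ S)
    (Act c) (s.agents c).cpa (β c) (slot s.net (.link c))
  req : ∀ i j d, ReqInv P T i j d (Act i) (s.agents i) (slot s.net (.req i j d))

/-- The invariant of the search phase. -/
def SearchInv (s : Config A V) : Prop :=
  ∃ Act β, Base P T s Act β ∅ ∧ ∀ i, Act i → Searching P T i (s.agents i) (β i)

/-- The invariant after the termination of the root. -/
structure FinalInv (s : Config A V) : Prop where
  root : (s.agents T.root).terminated
  net : ∀ p ∈ s.net, p.msg = .terminate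
  child : ∀ c p, T.parent c = some p → (s.agents p).terminated →
    (s.agents c).terminated ∨ ∃ q ∈ s.net, q.dst = c
  solution : ∃ x : A → V, P.IsSolution x ∧ answer P T s = fun i => some (x i)

variable {P T}

/-- A transition changes the state of one agent `i` and its channels only. -/
theorem Base.transition {s s' : Config A V} {Act Act' : A → Prop} {β β' : A → ℝ≥0∞} {i : A}
    {S S' : Finset A} (h : Base P T s Act β S) (hS : S ⊆ T.children i) (hS' : S' ⊆ T.children i)
    (hag : ∀ a, a ≠ i → s'.agents a = s.agents a)
    (hact : ∀ a, a ≠ i → Act' a = Act a) (hroot : Act' T.root)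
    (hβ : ∀ a, β' a = β a ∨ (T.parent a = some i ∧ ¬ Act a))
    (hcu : (s'.agents i).childUtil = (s.agents i).childUtil)
    (halive : ¬ (s'.agents i).terminated)
    (hutil : ∀ c, slot s'.net (.util c) = 0) (hterm : ∀ c, slot s'.net (.term c) = 0)
    (hlink : ∀ c, c ≠ i → T.parent c ≠ some i → slot s'.net (.link c) = slot s.net (.link c))
    (hreq : ∀ a j d, a ≠ i → slot s'.net (.req a j d) = slot s.net (.req a j d))
    (hself : (Act' i = Act i ∧ (s'.agents i).cpa = (s.agents i).cpa ∧
        slot s'.net (.link i) = slot s.net (.link i)) ∨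
      ∃ p, T.parent i = some p ∧ LinkInv P T p i (Act p) (s.agents p) (β p) False
        (Act' i) (s'.agents i).cpa (β i) (slot s'.net (.link i)))
    (hchild : ∀ c, T.parent c = some i → LinkInv P T i c (Act' i) (s'.agents i) (β i) (c ∈ S')
      (Act c) (s.agents c).cpa (β' c) (slot s'.net (.link c)))
    (hreqi : ∀ j d, ReqInv P T i j d (Act' i) (s'.agents i) (slot s'.net (.req i j d))) :
    Base P T s' Act' β' S' where
  util_known a c hc := by
    by_cases ha : a = i
    · subst ha; rw [hcu]; exact h.util_known a c hc
    · rw [hag a ha]; exact h.util_known a c hc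
  alive a := by
    by_cases ha : a = i
    · subst ha; exact halive
    · rw [hag a ha]; exact h.alive a
  act_root := hroot
  bound_root := by
    rcases hβ T.root with h1 | ⟨h1, _⟩
    · rw [h1]; exact h.bound_root
    · rw [parent_root] at h1; cases h1
  no_util := hutil
  no_term := hterm
  link_root := by
    by_cases hi : T.root = i
    · rcases hself with ⟨_, _, h3⟩ | ⟨p, hp, _⟩
      · rw [hi, h3, ← hi]; exact h.link_root
      · rw [← hi, parent_root] at hp; cases hp
    · rw [hlink _ hi (by rw [parent_root]; simp)]
      exact h.link_root
  link c p hc := by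
    have hcp : c ≠ p := by
      rintro rfl
      exact isAncestor_irrefl _ (isAncestor_of_parent hc)
    have hβp : T.parent p ≠ some p := fun hpp => isAncestor_irrefl _ (isAncestor_of_parent hpp)
    by_cases hp : p = i
    · subst hp
      replace hβp : β' p = β p := (hβ p).resolve_right fun h' => hβp h'.1
      rw [hag c hcp, hact c hcp, hβp]
      exact hchild c hc
    · have hfree : ∀ S₀ : Finset A, S₀ ⊆ T.children i → c ∉ S₀ := fun S₀ hS₀ hcS => by
        have := mem_children.1 (hS₀ hcS)
        rw [hc] at this
        exact hp (Option.some_injective _ this)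
      have hlc := h.link c p hc
      have hpc : T.parent c ≠ some i := by rw [hc]; simpa using hp
      rw [eq_false (hfree S hS)] at hlc
      rw [hag p hp, hact p hp, eq_false (hfree S' hS'), (hβ c).resolve_right fun h' => hpc h'.1]
      have hlc' : LinkInv P T p c (Act p) (s.agents p) (β' p) False (Act c) (s.agents c).cpa
          (β c) (slot s.net (.link c)) := by
        rcases hβ p with h1 | ⟨_, h1⟩
        · rw [h1]; exact hlc
        · exact ⟨hlc.1, fun _ hp' => absurd hp' h1⟩
      by_cases hci : c = i
      · subst hci
        rcases hself with ⟨h1, h2, h3⟩ | ⟨p', hp', h1⟩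
        · rw [h1, h2, h3]; exact hlc'
        · obtain rfl : p = p' := Option.some_injective _ (hc.symm.trans hp')
          rcases hβ p with h2 | ⟨_, h2⟩
          · rw [h2]; exact h1
          · exact ⟨h1.1, fun _ hp' => absurd hp' h2⟩
      · rw [hag c hci, hact c hci, hlink c hci hpc]
        exact hlc'
  req a j d := by
    by_cases ha : a = i
    · subst ha; exact hreqi j d
    · rw [hag a ha, hact a ha, hreq a j d ha]
      exact h.req a j d

end Global

section Advance

variable {A V : Type*} [Fintype A] [DecidableEq A] [LinearOrder V]
  {P : ADCOP A V} {T : PseudoTree P.graph}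

theorem parent_ne_self (i : A) : T.parent i ≠ some i := fun h =>
  isAncestor_irrefl _ (isAncestor_of_parent h)

theorem Base.turn {s : Config A V} {Act : A → Prop} {β β' : A → ℝ≥0∞} {i : A} {S : Finset A}
    (h : Base P T s Act β S) (hS : S ⊆ T.children i) (hact : Act i)
    (hgot : ∀ d, d ∉ (s.agents i).requested → (s.agents i).gotCost d = ∅)
    (e : Option V) {R : Finset V} (hR : (s.agents i).requested ⊆ R) {out : Multiset (Packet A V)}
    (hβ' : ∀ c, c ∉ S → β' c = β c)
    (hou : ∀ c, slot out (.util c) = 0) (hot : ∀ c, slot out (.term c) = 0)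
    (hol : ∀ c, (c ∉ S ∨ ∀ d, e = some d → ¬ T.allParents i ⊆ (s.agents i).gotCost d) →
      slot out (.link c) = 0)
    (hols : ∀ c ∈ S, ∀ d, e = some d → T.allParents i ⊆ (s.agents i).gotCost d →
      slot out (.link c) = {⟨i, c, .cpa (Function.update (s.agents i).cpa i (some d)) (β' c)⟩} ∧
        LinkBound P T i (s.agents i) (β i) c d (β' c))
    (hor : ∀ a j d, ¬ (a = i ∧ j ∈ T.allParents i ∧ d ∈ R ∧ d ∉ (s.agents i).requested) →
      slot out (.req a j d) = 0)
    (hors : ∀ j ∈ T.allParents i, ∀ d ∈ R, d ∉ (s.agents i).requested →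
      slot out (.req i j d) = {⟨i, j, .costReq d⟩}) :
    Base P T ⟨Function.update s.agents i { setSrch (s.agents i) S e with requested := R },
      s.net + out⟩ Act β' ∅ := by
  have hquiet : ∀ c ∈ S, ¬ Act c ∧ slot s.net (.link c) = 0 := fun c hc =>
    (h.link c i (mem_children.1 (hS hc))).1 (Or.inl hc)
  have hiS : i ∉ S := fun hi => parent_ne_self i (mem_children.1 (hS hi))
  refine h.transition (i := i) hS (Finset.empty_subset _) (fun a ha => Function.update_of_ne ha _ _)
    (fun _ _ => rfl) h.act_root ?_ ?_ ?_ ?_ ?_ ?_ ?_ ?_ ?_ ?_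
  · intro a
    by_cases ha : a ∈ S
    · exact Or.inr ⟨mem_children.1 (hS ha), (hquiet a ha).1⟩
    · exact Or.inl (hβ' a ha)
  · simp [setSrch]
  · simpa [setSrch] using h.alive i
  · intro c
    rw [slot_add, h.no_util, hou, add_zero]
  · intro c
    rw [slot_add, h.no_term, hot, add_zero]
  · intro c _ hc
    rw [slot_add, hol c (Or.inl fun h' => hc (mem_children.1 (hS h'))), add_zero]
  · intro a j d ha
    rw [slot_add, hor a j d (fun h' => ha h'.1), add_zero]
  · left
    refine ⟨rfl, by simp [setSrch], ?_⟩
    rw [slot_add, hol i (Or.inl hiS), add_zero]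
  · intro c hc
    have hl := h.link c i hc
    simp only [Function.update_self]
    rw [slot_add]
    by_cases hcS : c ∈ S
    · obtain ⟨hq1, hq2⟩ := hquiet c hcS
      have hbusy : ∀ d, Busy P T i { setSrch (s.agents i) S e with requested := R } c d ↔
          e = some d ∧ T.allParents i ⊆ (s.agents i).gotCost d := by
        intro d
        simp [Busy, setSrch, hcS]
      constructor
      · rintro (hf | hf | hf)
        · exact absurd hf (Finset.notMem_empty c)
        · exact absurd hact hf
        · refine ⟨hq1, ?_⟩
          rw [hq2, hol c (Or.inr fun d hd hg => hf d ((hbusy d).2 ⟨hd, hg⟩)), zero_add]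
      · intro _ _ d hd
        obtain ⟨he, hg⟩ := (hbusy d).1 hd
        obtain ⟨h1, h2⟩ := hols c hcS d he hg
        refine ⟨h2, Or.inl ⟨hq1, ?_⟩⟩
        rw [hq2, h1, zero_add]
        rfl
    · have hbusy : ∀ d, Busy P T i { setSrch (s.agents i) S e with requested := R } c d ↔
          Busy P T i (s.agents i) c d := by
        intro d
        simp [Busy, setSrch, hcS]
      rw [hol c (Or.inl hcS), add_zero, hβ' c hcS]
      constructor
      · rintro (hf | hf | hf)
        · exact absurd hf (Finset.notMem_empty c)
        · exact absurd hact hf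
        · exact hl.1 (Or.inr (Or.inr fun d hd => hf d ((hbusy d).2 hd)))
      · intro _ _ d hd
        exact hl.2 hcS hact d ((hbusy d).1 hd)
  · intro j d
    have hr := h.req i j d
    simp only [Function.update_self]
    rw [slot_add]
    by_cases hd : d ∈ (s.agents i).requested
    · rw [hor i j d (fun h' => h'.2.2.2 hd), add_zero]
      exact ⟨fun hn => hr.1 fun h' => hn ⟨h'.1, h'.2.1, hR h'.2.2.1, h'.2.2.2⟩,
        fun h1 h2 h3 h4 => hr.2 h1 h2 hd h4⟩
    · rw [hr.1 (fun h' => hd h'.2.2.1), zero_add]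
      constructor
      · intro hn
        refine hor i j d fun h' => hn ⟨hact, h'.2.1, h'.2.2.1, ?_⟩
        simp [setSrch, hgot d hd]
      · intro _ h2 h3 _
        exact Or.inl (hors j h2 d h3 hd)

/-- Children that are not exploring anything need not be treated as exceptional. -/
theorem Base.of_free {s : Config A V} {Act : A → Prop} {β : A → ℝ≥0∞} {S : Finset A}
    (h : Base P T s Act β S)
    (hS : ∀ c ∈ S, ∀ p, T.parent c = some p → ∀ d, ¬ Busy P T p (s.agents p) c d) :
    Base P T s Act β ∅ :=
  { h with
    link := fun c p hc => by
      refine ⟨?_, fun _ hp d hd => (h.link c p hc).2 (fun hcS => hS c hcS p hc d hd) hp d hd⟩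
      rintro (hf | hf)
      · exact absurd hf (Finset.notMem_empty c)
      · exact (h.link c p hc).1 (Or.inr hf) }

theorem Base.not_act {s : Config A V} {Act : A → Prop} {β : A → ℝ≥0∞} {S : Finset A}
    (h : Base P T s Act β S)
    (hroot : ∀ c, T.parent c = some T.root → c ∈ S ∨ ∀ d, ¬ Busy P T T.root (s.agents T.root) c d)
    (i : A) : i ≠ T.root → ¬ Act i ∧ slot s.net (.link i) = 0 := by
  refine tree_induction (T := T) (motive := fun i => i ≠ T.root → ¬ Act i ∧
    slot s.net (.link i) = 0) (fun h => absurd rfl h) (fun c p hc ih _ => ?_) i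
  refine (h.link c p hc).1 ?_
  by_cases hp : p = T.root
  · subst hp
    exact (hroot c hc).imp id Or.inr
  · exact Or.inr (Or.inl (ih hp).1)

theorem Base.net_eq_zero {s : Config A V} {Act : A → Prop} {β : A → ℝ≥0∞} {S : Finset A}
    (h : Base P T s Act β S)
    (hroot : ∀ c, T.parent c = some T.root →
      c ∈ S ∨ ∀ d, ¬ Busy P T T.root (s.agents T.root) c d) : s.net = 0 := by
  refine eq_zero_of_slots fun x => ?_
  cases x with
  | util c => exact h.no_util c
  | term c => exact h.no_term c
  | link c =>
    by_cases hc : c = T.root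
    · rw [hc]; exact h.link_root
    · exact (h.not_act hroot c hc).2
  | req i j d =>
    refine (h.req i j d).1 fun h' => ?_
    by_cases hi : i = T.root
    · rw [hi, allParents_root] at h'
      exact Finset.notMem_empty j h'.2.1
    · exact (h.not_act hroot i hi).1 h'.1

/-- A correct outcome for the root is a solution of the problem. -/
theorem Result.isSolution {pa : PAssign A V} {v : ℝ≥0∞} {S : PAssign A V}
    (h : Result P T T.root pa ⊤ v S) :
    ∃ x : A → V, P.IsSolution x ∧ S = fun i => some (x i) := by
  have hcompat : ∀ z : A → V, (∀ l, z l ∈ P.dom l) → Compat P T T.root pa z := fun z hz =>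
    ⟨hz, fun j hj => absurd hj (not_isAncestor_root j)⟩
  rcases h with ⟨z, hz, hS, _, hv, hopt⟩ | ⟨_, hopt⟩
  · refine ⟨z, ⟨hz.1, fun y hy => ?_⟩, funext fun l => hS l (inSubtree_root l)⟩
    have := hopt.trans (opt_le (hcompat y hy))
    rw [hv, ENNReal.coe_le_coe, subCost_root, subCost_root] at this
    exact this
  · exfalso
    have hne : ∀ i, ∃ d, d ∈ P.dom i := P.dom_nonempty
    choose z hz using hne
    have := hopt.trans (opt_le (hcompat z hz))
    exact absurd this (by simp)

variable (P T) in
/-- The invariant of the executions once the search phase has started. -/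
def LateInv (s : Config A V) : Prop := SearchInv P T s ∨ FinalInv P T s

theorem finalInv_of_finish {s : Config A V}
    (halive : ∀ i, i ≠ T.root → ¬ (s.agents i).terminated) (hnet : s.net = 0)
    {st : AgentState A V} {pa : PAssign A V}
    (hres : Result P T T.root pa ⊤ (bestCost P T T.root st) (bestSpa P T T.root st)) :
    FinalInv P T ⟨Function.update s.agents T.root (finish P T T.root st).1,
      s.net + (finish P T T.root st).2⟩ := by
  have hfin : finish P T T.root st = ({ st with terminated := True },
      (T.children T.root).val.map fun c => ⟨T.root, c, .terminate⟩) := by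
    unfold finish
    rw [parent_root]
  rw [hfin, hnet, zero_add]
  refine ⟨by simp, fun p hp => ?_, fun c p hc hp => ?_, ?_⟩
  · obtain ⟨c, _, rfl⟩ := Multiset.mem_map.1 hp
    rfl
  · by_cases hpr : p = T.root
    · subst hpr
      exact Or.inr ⟨⟨T.root, c, .terminate⟩,
        Multiset.mem_map.2 ⟨c, mem_children.2 hc, rfl⟩, rfl⟩
    · dsimp only at hp
      rw [Function.update_of_ne hpr] at hp
      exact absurd hp (halive p hpr)
  · obtain ⟨x, hx, hS⟩ := hres.isSolution
    refine ⟨x, hx, ?_⟩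
    unfold answer
    dsimp only
    rw [Function.update_self]
    exact hS

theorem slot_sendCPA_link (i : A) (st : AgentState A V) (d : V) (S : Finset A) (c : A) :
    slot (sendCPA P T i st d S) (.link c) = if c ∈ S then
      {⟨i, c, .cpa (Function.update st.cpa i (some d))
        (st.ub - (st.high d + ∑ c' ∈ (T.children i).erase c, st.lbc c' d))⟩} else 0 :=
  slot_map S _ Slot.link (fun _ => rfl) (fun _ _ h => by cases h; rfl) c

theorem slot_sendCPA_of_ne (i : A) (st : AgentState A V) (d : V) (S : Finset A) {x : Slot A V}
    (h : ∀ c, x ≠ .link c) : slot (sendCPA P T i st d S) x = 0 :=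
  slot_map_of_ne _ _ fun c hc => h c hc.symm

theorem slot_costReq (i j : A) (d : V) :
    slot ((T.allParents i).val.map fun j => (⟨i, j, .costReq d⟩ : Packet A V)) (.req i j d) =
      if j ∈ T.allParents i then {⟨i, j, .costReq d⟩} else 0 :=
  slot_map _ _ (fun j => Slot.req i j d) (fun _ => rfl) (fun _ _ h => by cases h; rfl) j

theorem slot_costReq_of_ne (i : A) (d : V) {x : Slot A V} (h : ∀ j, x ≠ .req i j d) :
    slot ((T.allParents i).val.map fun j => (⟨i, j, .costReq d⟩ : Packet A V)) x = 0 :=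
  slot_map_of_ne _ _ fun c hc => h c hc.symm

theorem Core.request {i : A} {st : AgentState A V} {B : ℝ≥0∞} {S : Finset A}
    (h : Core P T i st B S) {d : V} (hd : d ∈ P.dom i) :
    Core P T i { st with requested := insert d st.requested } B S :=
  { h with
    gotCost_eq_empty := fun e he => h.gotCost_eq_empty e fun h' => he (Finset.mem_insert_of_mem h')
    requested_subset := Finset.insert_subset hd h.requested_subset
    requested_of_srch := fun c e hc hs hn =>
      Finset.mem_insert_of_mem (h.requested_of_srch c e hc hs hn) }

theorem searchInv_of_base {s s' : Config A V} {Act : A → Prop} {β β' : A → ℝ≥0∞} {i : A}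
    (hB : Base P T s' Act β' ∅) (hag : ∀ a, a ≠ i → s'.agents a = s.agents a)
    (hβ : ∀ a, Act a → β' a = β a)
    (hoth : ∀ j, Act j → j ≠ i → Searching P T j (s.agents j) (β j))
    (hi : Act i → Searching P T i (s'.agents i) (β i)) : SearchInv P T s' := by
  refine ⟨Act, β', hB, fun a ha => ?_⟩
  rw [hβ a ha]
  by_cases hai : a = i
  · subst hai; exact hi ha
  · rw [hag a hai]; exact hoth a ha hai

/-- When the search below an agent is over, the outcome is correct. -/
theorem result_of_exhausted {i : A} {st : AgentState A V} {B : ℝ≥0∞}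
    (h : Core P T i st B ∅) (hs : ∀ c, T.parent c = some i → st.srch c = none)
    (hleaf : T.children i = ∅ → ∀ e ∈ P.dom i, T.allParents i ⊆ st.gotCost e ∨
      Beaten P T i st B e (lb P T i st e)) :
    Result P T i st.cpa B (bestCost P T i st) (bestSpa P T i st) := by
  refine h.result fun e he => ?_
  by_cases hl : T.children i = ∅
  · exact (hleaf hl e he).imp (fun h' => ⟨by rw [hl]; exact Finset.empty_subset _, h'⟩) id
  · obtain ⟨c₀, hc₀⟩ := Finset.nonempty_iff_ne_empty.2 hl
    by_cases hb : Beaten P T i st B e (lb P T i st e)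
    · exact Or.inr hb
    · left
      have hall : T.children i ⊆ st.gotBack e := fun c hc => by
        rw [mem_children] at hc
        refine (h.passed c e hc (Finset.notMem_empty c) he fun d hd => ?_).resolve_right hb
        rw [hs c hc] at hd
        cases hd
      exact ⟨hall, (h.gotBack_spec c₀ e (hall hc₀)).2.1⟩

theorem Base.finish_node {s : Config A V} {Act : A → Prop} {β : A → ℝ≥0∞} {i p : A}
    {S : Finset A} (h : Base P T s Act β S) (hS : S ⊆ T.children i) (hact : Act i)
    (hp : T.parent i = some p) {st : AgentState A V}
    (hcu : st.childUtil = (s.agents i).childUtil) (halive : ¬ st.terminated)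
    (hcpa : st.cpa = (s.agents i).cpa)
    (hfree : ∀ c, T.parent c = some i → c ∈ S ∨ ∀ d, ¬ Busy P T i (s.agents i) c d)
    (hpend : ∀ d, ¬ Pending P T i (s.agents i) d) {v : ℝ≥0∞} {pa : PAssign A V}
    (hres : Result P T i (s.agents i).cpa (β i) v pa) :
    Base P T ⟨Function.update s.agents i st, s.net + {⟨i, p, .backtrack v pa⟩}⟩
      (fun a => Act a ∧ a ≠ i) β ∅ := by
  have hlq : ∀ c, T.parent c = some i → ¬ Act c ∧ slot s.net (.link c) = 0 := fun c hc =>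
    (h.link c i hc).1 ((hfree c hc).imp id Or.inr)
  have hself : slot ({⟨i, p, .backtrack v pa⟩} : Multiset (Packet A V)) (.link i) =
    {⟨i, p, .backtrack v pa⟩} := slot_singleton_self _
  have hne : ∀ x : Slot A V, x ≠ .link i →
      slot ({⟨i, p, .backtrack v pa⟩} : Multiset (Packet A V)) x = 0 := fun x hx =>
    slot_singleton_of_ne fun h' => hx h'.symm
  refine h.transition (i := i) hS (Finset.empty_subset _) (fun a ha => Function.update_of_ne ha _ _)
    (fun a ha => by simp [ha]) ⟨h.act_root, ?_⟩ (fun _ => Or.inl rfl) ?_ ?_ ?_ ?_ ?_ ?_ ?_ ?_ ?_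
  · exact (ne_root_of_parent hp).symm
  · simpa using hcu
  · simpa using halive
  · intro c
    rw [slot_add, h.no_util, hne _ (by simp), add_zero]
  · intro c
    rw [slot_add, h.no_term, hne _ (by simp), add_zero]
  · intro c hc _
    rw [slot_add, hne _ (by simpa using hc), add_zero]
  · intro a j d _
    rw [slot_add, hne _ (by simp), add_zero]
  · refine Or.inr ⟨p, hp, ?_⟩
    have hl := h.link i p hp
    have hiS : i ∉ S := fun hi => parent_ne_self i (mem_children.1 (hS hi))
    have hnq : ¬ ((i ∈ S) ∨ ¬ Act p ∨ ∀ d, ¬ Busy P T p (s.agents p) i d) := fun hq =>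
      (hl.1 hq).1 hact
    constructor
    · rintro (hf | hf)
      · exact hf.elim
      · exact absurd (Or.inr hf) hnq
    · intro _ hap d hd
      obtain ⟨h1, h2⟩ := hl.2 hiS hap d hd
      refine ⟨h1, Or.inr (Or.inr ⟨fun h' => h'.2 rfl, v, pa, ?_, ?_⟩)⟩
      · rcases h2 with h2 | h2 | h2
        · exact absurd hact h2.1
        · rw [slot_add, h2.2.1, hself, zero_add]
        · exact absurd hact h2.1
      · rcases h2 with h2 | h2 | h2
        · exact absurd hact h2.1
        · rw [← h2.2.2]; exact hres
        · exact absurd hact h2.1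
  · intro c hc
    refine ⟨fun _ => ⟨(hlq c hc).1, ?_⟩, fun _ h' => absurd rfl h'.2⟩
    have hci : c ≠ i := by rintro rfl; exact parent_ne_self c hc
    rw [slot_add, (hlq c hc).2, hne _ (by simpa using hci), add_zero]
  · intro j d
    refine ⟨fun _ => ?_, fun h' => absurd rfl h'.2⟩
    rw [slot_add, hne _ (by simp), add_zero]
    exact (h.req i j d).1 fun h' => hpend d ⟨h'.2.2.1, fun hsub => h'.2.2.2 (hsub h'.2.1)⟩

/-- The effect of `advance` in a configuration where the children in `S` are idle. -/
theorem Base.advance {s : Config A V} {Act : A → Prop} {β : A → ℝ≥0∞} {i : A} {S : Finset A}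
    {e : Option V} (h : Base P T s Act β S) (hS : S ⊆ T.children i) (hact : Act i)
    (hoth : ∀ j, Act j → j ≠ i → Searching P T j (s.agents j) (β j))
    (hcore : Core P T i (s.agents i) (β i) S)
    (hpend : ∀ d, Pending P T i (s.agents i) d → ∃ c, c ∉ S ∧ (s.agents i).srch c = some d)
    (hne : T.children i ≠ ∅ → S.Nonempty)
    (hfeas : ∀ x, e = some x → x ∈ P.dom i ∧ lb P T i (s.agents i) x < (s.agents i).ub)
    (hlt : ∀ c ∈ S, ∀ x y, e = some x → c ∈ (s.agents i).gotBack y → y < x)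
    (hpass : ∀ c ∈ S, ∀ y ∈ P.dom i, (∀ x, e = some x → y < x) → c ∈ (s.agents i).gotBack y ∨
      Beaten P T i (s.agents i) (β i) y (lb P T i (s.agents i) y))
    (hleaf : T.children i = ∅ → i ≠ T.root ∧
      (∀ x, e = some x → ∀ y ∈ (s.agents i).requested, y < x) ∧
      ∀ y ∈ P.dom i, (∀ x, e = some x → y < x) → T.allParents i ⊆ (s.agents i).gotCost y ∨
        Beaten P T i (s.agents i) (β i) y (lb P T i (s.agents i) y)) :
    LateInv P T ⟨Function.update s.agents i (advance P T i (s.agents i) S e).1,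
      s.net + (advance P T i (s.agents i) S e).2⟩ := by
  have hcs := hcore.setSrch (e := e) hS (fun x hx => (hfeas x hx).1) hlt hpass
  have hadv : PTISABB.advance P T i (s.agents i) S e = match e with
    | none => if ∀ c ∈ T.children i, (setSrch (s.agents i) S e).srch c = none then
        finish P T i (setSrch (s.agents i) S e) else (setSrch (s.agents i) S e, 0)
    | some d => if T.allParents i ⊆ (s.agents i).gotCost d then
          (setSrch (s.agents i) S e, sendCPA P T i (setSrch (s.agents i) S e) d S)
        else if d ∈ (s.agents i).requested then (setSrch (s.agents i) S e, 0)
        else ({ setSrch (s.agents i) S e with requested := insert d (s.agents i).requested },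
          (T.allParents i).val.map fun j => ⟨i, j, .costReq d⟩) := by
    cases e <;> rfl
  have hsrchS : ∀ c ∈ S, (setSrch (s.agents i) S e).srch c = e := fun c hc => if_pos hc
  have hsrch : ∀ c, c ∉ S → (setSrch (s.agents i) S e).srch c = (s.agents i).srch c :=
    fun c hc => if_neg hc
  have hag : ∀ st a, a ≠ i → Function.update s.agents i st a = s.agents a := fun st a ha =>
    Function.update_of_ne ha _ _
  have hnl : ∀ x, e = some x → (T.allParents i ⊆ (s.agents i).gotCost x ∨
      x ∈ (s.agents i).requested) → T.children i ≠ ∅ := by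
    intro x hx hor hl
    obtain ⟨hr, h1, _⟩ := hleaf hl
    rcases hor with hor | hor
    · obtain ⟨p, hp⟩ := exists_parent hr
      have hxr : x ∉ (s.agents i).requested := fun hx' => lt_irrefl _ (h1 x hx x hx')
      have := hor (parent_mem_allParents hp)
      rw [hcore.gotCost_eq_empty x hxr] at this
      exact Finset.notMem_empty _ this
    · exact lt_irrefl _ (h1 x hx x hor)
  have hwait : (∀ x, e = some x → ¬ T.allParents i ⊆ (s.agents i).gotCost x ∧
      x ∈ (s.agents i).requested) → T.children i ≠ ∅ →
      (∃ c d, (setSrch (s.agents i) S e).srch c = some d) →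
      LateInv P T ⟨Function.update s.agents i (setSrch (s.agents i) S e), s.net + 0⟩ := by
    intro he hnl hex
    have hB := h.turn (β' := β) (out := 0) hS hact hcore.gotCost_eq_empty e subset_rfl
      (fun _ _ => rfl) (fun _ => slot_zero _) (fun _ => slot_zero _) (fun _ _ => slot_zero _)
      (fun c hc d hd hg => absurd hg (he d hd).1) (fun _ _ _ _ => slot_zero _)
      (fun j _ d hd hd' => absurd hd hd')
    refine Or.inl (searchInv_of_base (i := i) hB (hag _) (fun _ _ => rfl) hoth fun _ => ?_)
    simp only [Function.update_self]
    refine ⟨hcs.2 fun x hx _ => (he x hx).2, Or.inl ⟨hnl, hex, fun d hd => ?_⟩⟩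
    obtain ⟨c, hcS, hc⟩ := hpend d hd
    exact ⟨c, (hsrch c hcS).trans hc⟩
  rw [hadv]
  cases e with
  | none =>
    dsimp only
    split_ifs with hall
    · have hnone : ∀ c, T.parent c = some i → (setSrch (s.agents i) S none).srch c = none :=
        fun c hc => hall c (mem_children.2 hc)
      have hcore' := hcs.2 fun x hx => by cases hx
      have hres := result_of_exhausted hcore' hnone fun hl y hy =>
        (hleaf hl).2.2 y hy fun x hx => by cases hx
      have hfree : ∀ c, T.parent c = some i →
          c ∈ S ∨ ∀ d, ¬ Busy P T i (s.agents i) c d := by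
        intro c hc
        by_cases hcS : c ∈ S
        · exact Or.inl hcS
        · refine Or.inr fun d hd => ?_
          have := hnone c hc
          rw [hsrch c hcS, hd.1] at this
          cases this
      by_cases hi : i = T.root
      · subst hi
        rw [h.bound_root] at hres
        exact Or.inr (finalInv_of_finish (fun a _ => h.alive a) (h.net_eq_zero hfree) hres)
      · obtain ⟨p, hp⟩ := exists_parent hi
        have hfin : finish P T i (setSrch (s.agents i) S none) = (setSrch (s.agents i) S none,
            {⟨i, p, .backtrack (bestCost P T i (setSrch (s.agents i) S none))
              (bestSpa P T i (setSrch (s.agents i) S none))⟩}) := by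
          unfold finish
          rw [hp]
        rw [hfin]
        have hB := h.finish_node hS hact hp (st := setSrch (s.agents i) S none) rfl (h.alive i) rfl
          hfree (fun d hd => by
            obtain ⟨c, hcS, hc⟩ := hpend d hd
            have := hnone c (hcore.srch_spec c d hc).1
            rw [hsrch c hcS, hc] at this
            cases this) hres
        exact Or.inl (searchInv_of_base (i := i) hB (hag _) (fun _ _ => rfl)
          (fun j hj => hoth j hj.1) fun hj => absurd rfl hj.2)
    · have hex : ∃ c d, (setSrch (s.agents i) S none).srch c = some d := by
        push Not at hall
        obtain ⟨c, _, hc⟩ := hall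
        exact ⟨c, Option.ne_none_iff_exists'.1 hc⟩
      refine hwait (fun x hx => by cases hx) ?_ hex
      obtain ⟨c, d, hc⟩ := hex
      exact Finset.ne_empty_of_mem (mem_children.2 (hcs.1.srch_spec c d hc).1)
  | some d =>
    dsimp only
    split_ifs with hg hreq
    · have hchild := hnl d rfl (Or.inl hg)
      obtain ⟨c₀, hc₀⟩ := hne hchild
      have hdone : ∀ c ∈ S, ∀ y, Done P T i (s.agents i) y → y < d := fun c hc y hy =>
        hlt c hc d y rfl (hy.2.1 (hS hc))
      have hB := h.turn (out := sendCPA P T i (setSrch (s.agents i) S (some d)) d S)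
        (β' := fun c => if c ∈ S then (s.agents i).ub - ((s.agents i).high d +
          ∑ c' ∈ (T.children i).erase c, (s.agents i).lbc c' d) else β c)
        hS hact hcore.gotCost_eq_empty (some d) subset_rfl
        (fun c hc => if_neg hc) (fun _ => slot_sendCPA_of_ne _ _ _ _ (by simp))
        (fun _ => slot_sendCPA_of_ne _ _ _ _ (by simp))
        (fun c hc => by
          rw [slot_sendCPA_link, if_neg]
          rcases hc with hc | hc
          · exact hc
          · exact absurd hg (hc d rfl))
        (fun c hc x hx _ => by
          cases hx
          rw [slot_sendCPA_link, if_pos hc, if_pos hc]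
          exact ⟨rfl, linkBound_sub hcore (mem_children.1 (hS hc)) (hfeas d rfl).2 (hdone c hc)⟩)
        (fun _ _ _ _ => slot_sendCPA_of_ne _ _ _ _ (by simp))
        (fun j _ d hd hd' => absurd hd hd')
      refine Or.inl (searchInv_of_base (i := i) (β := β) hB (hag _) (fun a ha => if_neg fun haS =>
        ?_) hoth fun _ => ?_)
      · exact ((h.link a i (mem_children.1 (hS haS))).1 (Or.inl haS)).1 ha
      · simp only [Function.update_self]
        refine ⟨hcs.2 fun x hx hn => ?_, Or.inl ⟨hchild, ⟨c₀, d, hsrchS c₀ hc₀⟩, fun x hx => ?_⟩⟩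
        · cases hx
          exact absurd hg hn
        · obtain ⟨c, hcS, hc⟩ := hpend x hx
          exact ⟨c, (hsrch c hcS).trans hc⟩
    · have hchild := hnl d rfl (Or.inr hreq)
      obtain ⟨c₀, hc₀⟩ := hne hchild
      exact hwait (fun x hx => by cases hx; exact ⟨hg, hreq⟩) hchild ⟨c₀, d, hsrchS c₀ hc₀⟩
    · have hB := h.turn (out := (T.allParents i).val.map fun j => ⟨i, j, .costReq d⟩)
        (β' := β) (R := insert d (s.agents i).requested)
        hS hact hcore.gotCost_eq_empty (some d) (Finset.subset_insert _ _)
        (fun _ _ => rfl) (fun _ => slot_costReq_of_ne _ _ (by simp))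
        (fun _ => slot_costReq_of_ne _ _ (by simp)) (fun _ _ => slot_costReq_of_ne _ _ (by simp))
        (fun c hc x hx hg' => by cases hx; exact absurd hg' hg)
        (fun a j x hn => by
          by_cases hax : a = i ∧ x = d
          · obtain ⟨rfl, rfl⟩ := hax
            rw [slot_costReq, if_neg]
            exact fun hj => hn ⟨rfl, hj, Finset.mem_insert_self _ _, hreq⟩
          · refine slot_costReq_of_ne _ _ fun j' hj' => hax ?_
            cases hj'
            exact ⟨rfl, rfl⟩)
        (fun j hj x hx hx' => by
          obtain rfl : x = d := (Finset.mem_insert.1 hx).resolve_right hx'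
          rw [slot_costReq, if_pos hj])
      refine Or.inl (searchInv_of_base (i := i) hB (hag _) (fun _ _ => rfl) hoth fun _ => ?_)
      simp only [Function.update_self]
      have hc' := ((hcore.request (hfeas d rfl).1).setSrch (e := some d) hS (fun x hx => (hfeas x hx).1) hlt
        hpass).2 fun x hx _ => by cases hx; exact Finset.mem_insert_self _ _
      refine ⟨hc', ?_⟩
      have hold : ∀ x, x ∈ (s.agents i).requested → ¬ T.allParents i ⊆ (s.agents i).gotCost x →
          ∃ c, (setSrch (s.agents i) S (some d)).srch c = some x := by
        intro x hx hn
        obtain ⟨c, hcS, hc⟩ := hpend x ⟨hx, hn⟩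
        exact ⟨c, (hsrch c hcS).trans hc⟩
      by_cases hl : T.children i = ∅
      · obtain ⟨_, h1, h2⟩ := hleaf hl
        refine Or.inr ⟨hl, d, ⟨Finset.mem_insert_self _ _, hg⟩, fun x hx => ?_, fun y hy hyd => ?_⟩
        · rcases Finset.mem_insert.1 hx with rfl | hx
          · exact ⟨le_rfl, fun h' => absurd rfl h'⟩
          · refine ⟨(h1 d rfl x hx).le, fun _ => ?_⟩
            by_contra hn
            obtain ⟨c, _, hc⟩ := hpend x ⟨hx, hn⟩
            have := mem_children.2 (hcore.srch_spec c x hc).1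
            rw [hl] at this
            exact Finset.notMem_empty c this
        · exact h2 y hy fun x hx => by cases hx; exact hyd
      · obtain ⟨c₀, hc₀⟩ := hne hl
        refine Or.inl ⟨hl, ⟨c₀, d, hsrchS c₀ hc₀⟩, fun x hx => ?_⟩
        rcases Finset.mem_insert.1 hx.1 with rfl | hx'
        · exact ⟨c₀, hsrchS c₀ hc₀⟩
        · exact hold x hx' hx.2

end Advance

section Deliver

variable {A V : Type*} [Fintype A] [DecidableEq A] [LinearOrder V]
  {P : ADCOP A V} {T : PseudoTree P.graph}

theorem slot_rest_of_ne {net rest : Multiset (Packet A V)} {p : Packet A V}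
    (hnet : net = p ::ₘ rest) {x : Slot A V} (hx : slotOf p ≠ x) : slot rest x = slot net x := by
  rw [hnet, slot_cons_of_ne hx]

theorem slot_deliver {net rest : Multiset (Packet A V)} {p q : Packet A V}
    (hnet : net = p ::ₘ rest) (h : slot net (slotOf p) = {q}) :
    p = q ∧ slot rest (slotOf p) = 0 := by
  rw [hnet, slot_cons_self] at h
  obtain ⟨h1, h2⟩ := (Multiset.singleton_eq_cons_iff _).1 h.symm
  exact ⟨h1.symm, h2⟩

theorem slot_ne_zero {net rest : Multiset (Packet A V)} {p : Packet A V}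
    (hnet : net = p ::ₘ rest) : slot net (slotOf p) ≠ 0 := by
  rw [hnet, slot_cons_self]
  exact Multiset.cons_ne_zero

/-- A message in the channel of `c` belongs to the exploration of some value by `c`. -/
theorem Base.link_cases {s : Config A V} {Act : A → Prop} {β : A → ℝ≥0∞}
    (h : Base P T s Act β ∅) {c : A} (hc : slot s.net (.link c) ≠ 0) :
    ∃ p d, T.parent c = some p ∧ Act p ∧ ¬ Act c ∧ Busy P T p (s.agents p) c d ∧
      LinkBound P T p (s.agents p) (β p) c d (β c) ∧
      LinkOK P T p c (Function.update (s.agents p).cpa p (some d)) (Act c) (s.agents c).cpa (β c)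
        (slot s.net (.link c)) := by
  have hcr : c ≠ T.root := by rintro rfl; exact hc h.link_root
  obtain ⟨p, hp⟩ := exists_parent hcr
  have hl := h.link c p hp
  have hnq := mt hl.1 fun hq => hc hq.2
  push Not at hnq
  obtain ⟨hcS, hap, d, hd⟩ := hnq
  obtain ⟨h1, h2⟩ := hl.2 hcS hap d hd
  refine ⟨p, d, hp, hap, fun hac => ?_, hd, h1, h2⟩
  rcases h2 with h2 | h2 | h2
  · exact h2.1 hac
  · exact hc h2.2.1
  · exact h2.1 hac

theorem Base.act_cases {s : Config A V} {Act : A → Prop} {β : A → ℝ≥0∞}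
    (h : Base P T s Act β ∅) {c p : A} (hp : T.parent c = some p) (hc : Act c) :
    Act p ∧ ∃ d, Busy P T p (s.agents p) c d ∧
      (s.agents c).cpa = Function.update (s.agents p).cpa p (some d) := by
  have hl := h.link c p hp
  have hnq := mt hl.1 fun hq => hq.1 hc
  push Not at hnq
  obtain ⟨hcS, hap, d, hd⟩ := hnq
  obtain ⟨_, h2⟩ := hl.2 hcS hap d hd
  refine ⟨hap, d, hd, ?_⟩
  rcases h2 with h2 | h2 | h2
  · exact absurd hc h2.1
  · exact h2.2.2
  · exact absurd hc h2.1

/-- The values that the ancestors of a searching agent are exploring are those in its `Cpa`. -/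
theorem Base.cpa_eq {s : Config A V} {Act : A → Prop} {β : A → ℝ≥0∞}
    (h : Base P T s Act β ∅) (i : A) : Act i → ∀ j, IsAncestor T.parent j i →
      (T.branch j i).bind (s.agents j).srch = (s.agents i).cpa j := by
  refine tree_induction (T := T) (motive := fun i => Act i → ∀ j, IsAncestor T.parent j i →
      (T.branch j i).bind (s.agents j).srch = (s.agents i).cpa j)
    (fun _ j hj => absurd hj (not_isAncestor_root j)) (fun c p hp ih hc j hj => ?_) i
  obtain ⟨hap, d, hd, hcpa⟩ := h.act_cases hp hc
  rw [hcpa]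
  rcases (isAncestor_iff_of_parent hp j).1 hj with rfl | hj'
  · rw [branch_eq_some hp (inSubtree_self c), Function.update_self]
    exact hd.1
  · have hne : j ≠ p := by rintro rfl; exact isAncestor_irrefl _ hj'
    rw [Function.update_of_ne hne, ← ih hap j hj']
    obtain ⟨c', hc', hsub⟩ := isAncestor_iff_child.1 hj'
    rw [branch_eq_some hc' hsub,
      branch_eq_some hc' (inSubtree_trans hsub (Or.inr (isAncestor_of_parent hp)))]

theorem Base.req_cases {s : Config A V} {Act : A → Prop} {β : A → ℝ≥0∞} {S : Finset A}
    (h : Base P T s Act β S) {i j : A} {d : V} (hr : slot s.net (.req i j d) ≠ 0) :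
    Act i ∧ j ∈ T.allParents i ∧ d ∈ (s.agents i).requested ∧ j ∉ (s.agents i).gotCost d ∧
    (slot s.net (.req i j d) = {⟨i, j, .costReq d⟩} ∨ slot s.net (.req i j d) =
      {⟨j, i, .cost d (P.privCost j i ((s.agents i).cpa j) (some d))⟩}) := by
  have hn := not_not.1 (mt (h.req i j d).1 hr)
  exact ⟨hn.1, hn.2.1, hn.2.2.1, hn.2.2.2, (h.req i j d).2 hn.1 hn.2.1 hn.2.2.1 hn.2.2.2⟩

theorem SearchInv.costReq {s : Config A V} (h : SearchInv P T s) {i j : A} {d : V}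
    {rest : Multiset (Packet A V)} (hnet : s.net = ⟨i, j, .costReq d⟩ ::ₘ rest) :
    SearchInv P T ⟨Function.update s.agents j (onCostReq P T j (s.agents j) i d).1,
      rest + (onCostReq P T j (s.agents j) i d).2⟩ := by
  obtain ⟨Act, β, hB, hsearch⟩ := h
  have hso : slotOf (⟨i, j, .costReq d⟩ : Packet A V) = .req i j d := rfl
  obtain ⟨hact, hj, hreq, hgot, hM⟩ := hB.req_cases (hso ▸ slot_ne_zero hnet)
  rw [← hso] at hM
  have hrest : slot rest (.req i j d) = 0 := by
    rcases hM with hM | hM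
    · exact (slot_deliver hnet hM).2
    · cases (slot_deliver hnet hM).1
  have hval : (T.branch j i).bind (s.agents j).srch = (s.agents i).cpa j :=
    hB.cpa_eq i hact j (mem_allParents.1 hj).2
  simp only [onCostReq, Function.update_eq_self, hval]
  set q : Packet A V := ⟨j, i, .cost d (P.privCost j i ((s.agents i).cpa j) (some d))⟩ with hq
  have hqs : slotOf q = .req i j d := rfl
  have hsame : ∀ x, x ≠ .req i j d → slot (rest + {q}) x = slot s.net x := by
    intro x hx
    rw [slot_add, slot_rest_of_ne hnet (by rw [hso]; exact hx.symm),
      slot_singleton_of_ne (by rw [hqs]; exact hx.symm), add_zero]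
  refine ⟨Act, β, ?_, hsearch⟩
  refine hB.transition (i := i) (Finset.empty_subset _) (Finset.empty_subset _) (fun _ _ => rfl)
    (fun _ _ => rfl) hB.act_root (fun _ => Or.inl rfl) rfl (hB.alive i) ?_ ?_ ?_ ?_
    (Or.inl ⟨rfl, rfl, ?_⟩) ?_ ?_
  · intro c
    rw [hsame _ (by simp), hB.no_util]
  · intro c
    rw [hsame _ (by simp), hB.no_term]
  · intro c _ _
    exact hsame _ (by simp)
  · intro a j' d' ha
    exact hsame _ (by simp [ha])
  · exact hsame _ (by simp)
  · intro c hc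
    dsimp only
    rw [hsame _ (by simp)]
    exact hB.link c i hc
  · intro j' d'
    dsimp only
    by_cases hjd : j' = j ∧ d' = d
    · obtain ⟨rfl, rfl⟩ := hjd
      refine ⟨fun hn => absurd ⟨hact, hj, hreq, hgot⟩ hn, fun _ _ _ _ => Or.inr ?_⟩
      rw [slot_add, hrest, zero_add, ← hqs, slot_singleton_self]
    · rw [hsame _ (by simpa using hjd)]
      exact hB.req i j' d'

/-- The receipt of a COST message, without the reaction to it. -/
theorem Base.receiveCost {s : Config A V} {Act : A → Prop} {β : A → ℝ≥0∞}
    (h : Base P T s Act β ∅) {i j : A} {d : V} {v : ℝ≥0} {rest : Multiset (Packet A V)}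
    (hnet : s.net = ⟨j, i, .cost d v⟩ ::ₘ rest) (u : ℝ≥0∞) :
    Base P T ⟨Function.update s.agents i { addCost (s.agents i) j d v with ub := u }, rest⟩ Act β
      ((T.children i).filter fun c => (s.agents i).srch c = some d) := by
  have hso : slotOf (⟨j, i, .cost d v⟩ : Packet A V) = .req i j d := rfl
  obtain ⟨hact, hj, hreq, hgot, hM⟩ := h.req_cases (hso ▸ slot_ne_zero hnet)
  rw [← hso] at hM
  have hrest : slot rest (.req i j d) = 0 := by
    rcases hM with hM | hM
    · cases (slot_deliver hnet hM).1
    · exact (slot_deliver hnet hM).2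
  have hsame : ∀ x, x ≠ .req i j d → slot rest x = slot s.net x := fun x hx =>
    slot_rest_of_ne hnet (by rw [hso]; exact hx.symm)
  refine h.transition (i := i) (Finset.empty_subset _) (Finset.filter_subset _ _)
    (fun a ha => Function.update_of_ne ha _ _)
    (fun _ _ => rfl) h.act_root (fun _ => Or.inl rfl) ?_ ?_ ?_ ?_ ?_ ?_
    (Or.inl ⟨rfl, ?_, ?_⟩) ?_ ?_
  · simp [PTISABB.addCost]
  · simpa [PTISABB.addCost] using h.alive i
  · intro c
    rw [hsame _ (by simp), h.no_util]
  · intro c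
    rw [hsame _ (by simp), h.no_term]
  · intro c _ _
    exact hsame _ (by simp)
  · intro a j' d' ha
    exact hsame _ (by simp [ha])
  · simp [PTISABB.addCost]
  · exact hsame _ (by simp)
  · intro c hc
    have hl := h.link c i hc
    simp only [Function.update_self]
    rw [hsame _ (by simp)]
    by_cases hcS : (s.agents i).srch c = some d
    · have hq := hl.1 (Or.inr (Or.inr fun d' hd' => by
        have hdd : d' = d := Option.some_injective _ (hd'.1.symm.trans hcS)
        subst hdd
        exact hgot (hd'.2 hj)))
      exact ⟨fun _ => hq, fun hn => absurd (Finset.mem_filter.2 ⟨mem_children.2 hc, hcS⟩) hn⟩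
    · have hbusy : ∀ d', Busy P T i { addCost (s.agents i) j d v with ub := u } c d' ↔
          Busy P T i (s.agents i) c d' := by
        intro d'
        refine and_congr_right fun hs' => ?_
        have hne : d' ≠ d := by rintro rfl; exact hcS hs'
        simp [PTISABB.addCost, Function.update_of_ne hne]
      constructor
      · rintro (hf | hf | hf)
        · exact absurd (Finset.mem_filter.1 hf).2 hcS
        · exact absurd hact hf
        · exact hl.1 (Or.inr (Or.inr fun d' hd' => hf d' ((hbusy d').2 hd')))
      · intro _ _ d' hd'
        obtain ⟨h1, h2⟩ := hl.2 (Finset.notMem_empty c) hact d' ((hbusy d').1 hd')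
        exact ⟨h1.mono (addCost_done hj hgot) rfl (addCost_high_le (j := j) d') fun _ _ => le_rfl, h2⟩
  · intro j' d'
    have hr := h.req i j' d'
    simp only [Function.update_self]
    by_cases hjd : j' = j ∧ d' = d
    · obtain ⟨rfl, rfl⟩ := hjd
      have hin : j' ∈ (PTISABB.addCost (s.agents i) j' d' v).gotCost d' := by
        simp [PTISABB.addCost]
      exact ⟨fun _ => hrest, fun _ _ _ hn => absurd hin hn⟩
    · have hmem : j' ∈ (PTISABB.addCost (s.agents i) j d v).gotCost d' ↔
          j' ∈ (s.agents i).gotCost d' := by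
        simp only [PTISABB.addCost, Function.update_apply]
        split_ifs with hd'
        · subst hd'
          simp only [Finset.mem_insert, or_iff_right_iff_imp]
          exact fun hj' => absurd ⟨hj', rfl⟩ hjd
        · rfl
      rw [hsame _ (by simpa using hjd)]
      exact ⟨fun hn => hr.1 fun h' => hn ⟨h'.1, h'.2.1, h'.2.2.1, fun hg => h'.2.2.2 (hmem.1 hg)⟩,
        fun h1 h2 h3 h4 => hr.2 h1 h2 h3 fun hg => h4 (hmem.2 hg)⟩

theorem SearchInv.cost {s : Config A V} (h : SearchInv P T s) {i j : A} {d : V} {v : ℝ≥0}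
    {rest : Multiset (Packet A V)} (hnet : s.net = ⟨j, i, .cost d v⟩ ::ₘ rest) :
    LateInv P T ⟨Function.update s.agents i (onCost P T i (s.agents i) j d v).1,
      rest + (onCost P T i (s.agents i) j d v).2⟩ := by
  obtain ⟨Act, β, hB, hsearch⟩ := h
  have hso : slotOf (⟨j, i, .cost d v⟩ : Packet A V) = .req i j d := rfl
  obtain ⟨hact, hj, hreq, hgot, hM⟩ := hB.req_cases (hso ▸ slot_ne_zero hnet)
  have hv : v = P.privCost j i ((s.agents i).cpa j) (some d) := by
    rw [← hso] at hM
    rcases hM with hM | hM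
    · cases (slot_deliver hnet hM).1
    · have := (slot_deliver hnet hM).1
      injection this with _ _ h3
      injection h3
  obtain ⟨hcore, hmode⟩ := hsearch i hact
  have hcore' := hcore.addCost hj hgot hreq hv
  have hd : d ∈ P.dom i := hcore.requested_subset hreq
  have hpd : Pending P T i (s.agents i) d := ⟨hreq, fun hsub => hgot (hsub hj)⟩
  have hgc : ∀ x, x ≠ d →
      (addCost (s.agents i) j d v).gotCost x = (s.agents i).gotCost x := fun x hx => by
    simp [PTISABB.addCost, Function.update_of_ne hx]
  have hoth : ∀ st a, Act a → a ≠ i →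
      Searching P T a (Function.update s.agents i st a) (β a) := fun st a ha hai => by
    rw [Function.update_of_ne hai]
    exact hsearch a ha
  by_cases hall : T.allParents i ⊆ (addCost (s.agents i) j d v).gotCost d
  · by_cases hl : T.children i = ∅
    · -- a leaf with all replies for `d`
      obtain ⟨_, d₀, hd₀, hr₀, hp₀⟩ := hmode.resolve_left fun h' => h'.1 hl
      obtain rfl : d = d₀ := by
        by_contra hne
        exact hpd.2 ((hr₀ d hreq).2 hne)
      rw [onCost_leaf hall hl]
      have hB' := hB.receiveCost hnet (min (addCost (s.agents i) j d v).ub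
        (lb P T i (addCost (s.agents i) j d v) d))
      rw [hl, Finset.filter_empty] at hB'
      set st' := lowerUb P T i (addCost (s.agents i) j d v) d with hst'
      have hc' : Core P T i st' (β i) ∅ :=
        hcore'.lowerUb ⟨hd, by rw [hl]; exact Finset.empty_subset _, hall⟩
      have hB'' : Base P T ⟨Function.update s.agents i st', rest⟩ Act β ∅ := hB'
      have := hB''.advance (i := i) (e := nextFeasible P T i st' d) (Finset.empty_subset _) hact
        (hoth st') (by simpa using hc') ?_ (fun h' => absurd hl h') ?_
        (fun c hc => absurd hc (Finset.notMem_empty c))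
        (fun c hc => absurd hc (Finset.notMem_empty c)) (fun _ => ⟨?_, ?_, ?_⟩)
      · simpa using this
      · simp only [Function.update_self]
        rintro x ⟨hx1, hx2⟩
        exfalso
        by_cases hxd : x = d
        · subst hxd; exact hx2 hall
        · exact hx2 (((hr₀ x hx1).2 hxd).trans (addCost_gotCost_subset (v := v) x))
      · simp only [Function.update_self]
        intro x hx
        exact ⟨(nextFeasible_spec hx).1, (nextFeasible_spec hx).2.2⟩
      · rintro rfl
        rw [allParents_root] at hj
        exact Finset.notMem_empty j hj
      · simp only [Function.update_self]
        intro x hx y hy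
        exact (hr₀ y hy).1.trans_lt (nextFeasible_spec hx).2.1
      · simp only [Function.update_self]
        intro y hy hlt
        refine nextFeasible_passed hc' (fun y => T.allParents i ⊆ st'.gotCost y)
          (fun y hy hyd => ?_) (fun y hy => ?_) hy hlt
        · rcases hyd.eq_or_lt with rfl | hyd
          · exact Or.inl hall
          · rcases hp₀ y hy hyd with h1 | h1
            · exact Or.inl (h1.trans (addCost_gotCost_subset (v := v) y))
            · exact Or.inr (h1.mono (addCost_done (v := v) hj hgot) (addCost_lb_le (j := j) y))
        · by_contra hn
          have hyr : y ∉ st'.requested := fun hy' => hn (hr₀ y hy').1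
          have := hy.2.2 hj
          rw [hc'.gotCost_eq_empty y hyr] at this
          exact Finset.notMem_empty j this
    · -- an inner agent with all replies for `d`
      obtain ⟨_, _, hpend⟩ := hmode.resolve_right fun h' => hl h'.1
      rw [onCost_node hall hl]
      set S := (T.children i).filter (fun c => (s.agents i).srch c = some d) with hS
      have hB' : Base P T ⟨Function.update s.agents i (addCost (s.agents i) j d v), rest⟩ Act β S :=
        hB.receiveCost hnet (s.agents i).ub
      have hmemS : ∀ c, c ∈ S ↔ (s.agents i).srch c = some d := fun c =>
        ⟨fun hc => (Finset.mem_filter.1 hc).2, fun hc =>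
          Finset.mem_filter.2 ⟨mem_children.2 (hcore.srch_spec c d hc).1, hc⟩⟩
      have hgb : ∀ c ∈ S, ∀ y, c ∈ (s.agents i).gotBack y → y < d := fun c hc y hy =>
        hcore.gotBack_lt c d y (Finset.notMem_empty c) ((hmemS c).1 hc) hy
      set st' := addCost (s.agents i) j d v with hst'
      set e := (if lb P T i st' d < st'.ub then some d else nextFeasible P T i st' d) with he
      have hle : ∀ x, e = some x → x ∈ P.dom i ∧ lb P T i st' x < st'.ub ∧ d ≤ x := by
        intro x hx
        rw [he] at hx
        split_ifs at hx with hlt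
        · cases hx
          exact ⟨hd, hlt, le_rfl⟩
        · exact ⟨(nextFeasible_spec hx).1, (nextFeasible_spec hx).2.2,
            (nextFeasible_spec hx).2.1.le⟩
      have := hB'.advance (i := i) (e := e) (Finset.filter_subset _ _) hact (hoth st')
        (by simpa using hcore'.mono (Finset.empty_subset S)) ?_ (fun _ => ?_) ?_ ?_ ?_
        (fun h' => absurd h' hl)
      · simpa using this
      · simp only [Function.update_self]
        rintro x ⟨hx1, hx2⟩
        have hxd : x ≠ d := by rintro rfl; exact hx2 hall
        rw [hgc x hxd] at hx2
        obtain ⟨c, hc⟩ := hpend x ⟨hx1, hx2⟩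
        refine ⟨c, fun hcS => hxd ?_, hc⟩
        exact Option.some_injective _ (hc.symm.trans ((hmemS c).1 hcS))
      · obtain ⟨c, hc⟩ := hpend d hpd
        exact ⟨c, (hmemS c).2 hc⟩
      · simp only [Function.update_self]
        exact fun x hx => ⟨(hle x hx).1, (hle x hx).2.1⟩
      · simp only [Function.update_self]
        intro c hc x y hx hy
        exact (hgb c hc y hy).trans_le (hle x hx).2.2
      · simp only [Function.update_self]
        intro c hc y hy hlt
        have hcp := mem_children.1 ((Finset.filter_subset _ _) hc)
        have hpass : ∀ y ∈ P.dom i, y < d →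
            c ∈ st'.gotBack y ∨ Beaten P T i st' (β i) y (lb P T i st' y) := fun y hy hyd =>
          hcore'.passed c y hcp (Finset.notMem_empty c) hy fun d' hd' => by
            obtain rfl : d = d' := Option.some_injective _ (((hmemS c).1 hc).symm.trans hd')
            exact hyd
        rw [he] at hlt
        split_ifs at hlt with hif
        · exact hpass y hy (hlt d rfl)
        · refine nextFeasible_passed hcore' (fun y => c ∈ st'.gotBack y)
            (fun y hy hyd => ?_) (fun y hy => (hgb c hc y (hy.2.1 (mem_children.2 hcp))).le) hy hlt
          rcases hyd.eq_or_lt with rfl | hyd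
          · right
            push Not at hif
            rcases hcore'.ub_spec with h1 | ⟨x, hx, hxle⟩
            · exact Or.inl (h1.trans hif)
            · exact Or.inr ⟨x, hgb c hc x (hx.2.1 (mem_children.2 hcp)), hx, hxle.trans hif⟩
          · exact hpass y hy hyd
  · -- some replies are missing
    rw [onCost_of_missing hall]
    have hB' : Base P T ⟨Function.update s.agents i (addCost (s.agents i) j d v), rest⟩ Act β
        ((T.children i).filter fun c => (s.agents i).srch c = some d) :=
      hB.receiveCost hnet (s.agents i).ub
    have hB'' := hB'.of_free fun c hc p hp d' hd' => by
      obtain ⟨hc, hcd⟩ := Finset.mem_filter.1 hc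
      have : p = i := Option.some_injective _ (hp.symm.trans (mem_children.1 hc))
      subst this
      simp only [Function.update_self] at hd'
      obtain rfl : d = d' := Option.some_injective _ (hcd.symm.trans hd'.1)
      exact hall hd'.2
    rw [add_zero]
    refine Or.inl (searchInv_of_base (i := i) hB'' (fun _ _ => rfl) (fun _ _ => rfl)
      (hoth _) fun _ => ?_)
    simp only [Function.update_self]
    refine ⟨hcore', hmode.imp ?_ ?_⟩
    · rintro ⟨hl, hex, hpend⟩
      exact ⟨hl, hex, fun x hx => hpend x ⟨hx.1, fun hsub =>
        hx.2 (hsub.trans (addCost_gotCost_subset x))⟩⟩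
    · rintro ⟨hl, d₀, hd₀, hr₀, hp₀⟩
      obtain rfl : d = d₀ := by
        by_contra hne
        exact hpd.2 ((hr₀ d hreq).2 hne)
      refine ⟨hl, d, ⟨hreq, hall⟩, fun x hx => ⟨(hr₀ x hx).1, fun hxd =>
        ((hr₀ x hx).2 hxd).trans (addCost_gotCost_subset x)⟩, fun y hy hyd => ?_⟩
      rcases hp₀ y hy hyd with h1 | h1
      · exact Or.inl (h1.trans (addCost_gotCost_subset (v := v) y))
      · exact Or.inr (h1.mono (addCost_done (v := v) hj hgot) (addCost_lb_le (j := j) y))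

end Deliver

section Deliver

variable {A V : Type*} [Fintype A] [DecidableEq A] [LinearOrder V]
  {P : ADCOP A V} {T : PseudoTree P.graph}

theorem Core.compat_child {i c : A} {st : AgentState A V} {B : ℝ≥0∞} {S : Finset A}
    (h : Core P T i st B S) (hc : T.parent c = some i) {d : V} (hd : d ∈ P.dom i) :
    ∃ z, Compat P T c (Function.update st.cpa i (some d)) z := by
  obtain ⟨z, hz⟩ := h.compat
  refine ⟨Function.update z i d,
    (compat_child_iff hc).2 ⟨⟨fun l => ?_, fun j hj => ?_⟩, Function.update_self _ _ _⟩⟩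
  · by_cases hl : l = i
    · subst hl; simpa using hd
    · rw [Function.update_of_ne hl]; exact hz.1 l
  · have hne : j ≠ i := by rintro rfl; exact isAncestor_irrefl _ hj
    rw [Function.update_of_ne hne]
    exact hz.2 j hj

/-- The receipt of a CPA message by `c`, without the reaction to it. -/
theorem Base.receiveCPA {s : Config A V} {Act : A → Prop} {β : A → ℝ≥0∞}
    (h : Base P T s Act β ∅) {c p : A} {d : V} {rest : Multiset (Packet A V)}
    (hnet : s.net = ⟨p, c, .cpa (Function.update (s.agents p).cpa p (some d)) (β c)⟩ ::ₘ rest)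
    (hrest : slot rest (.link c) = 0) (hp : T.parent c = some p) (hap : Act p) (hnc : ¬ Act c)
    (hd : Busy P T p (s.agents p) c d) (hb : LinkBound P T p (s.agents p) (β p) c d (β c)) :
    Base P T ⟨Function.update s.agents c (initSearch P T c (s.agents c)
      (Function.update (s.agents p).cpa p (some d)) (β c)), rest⟩ (fun a => Act a ∨ a = c) β
      (T.children c) ∧
    ∀ v S, Result P T c (Function.update (s.agents p).cpa p (some d)) (β c) v S →
      Base P T ⟨Function.update s.agents c (initSearch P T c (s.agents c)
        (Function.update (s.agents p).cpa p (some d)) (β c)), rest + {⟨c, p, .backtrack v S⟩}⟩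
        Act β ∅ := by
  set pkt : Packet A V := ⟨p, c, .cpa (Function.update (s.agents p).cpa p (some d)) (β c)⟩
    with hpkt
  have hso : slotOf pkt = .link c := rfl
  have hsame : ∀ x, x ≠ .link c → slot rest x = slot s.net x := fun x hx =>
    slot_rest_of_ne hnet (by rw [hso]; exact hx.symm)
  have hsub : ∀ c', T.parent c' = some c → ¬ Act c' ∧ slot s.net (.link c') = 0 := fun c' hc' =>
    (h.link c' c hc').1 (Or.inr (Or.inl hnc))
  have hne : ∀ c', T.parent c' = some c → c' ≠ c := by
    rintro c' hc' rfl
    exact parent_ne_self _ hc'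
  have hreq0 : ∀ j d', slot s.net (.req c j d') = 0 := fun j d' =>
    (h.req c j d').1 fun h' => hnc h'.1
  have hbusy : ∀ d', Busy P T p (s.agents p) c d' → d' = d := fun d' hd' =>
    Option.some_injective _ (hd'.1.symm.trans hd.1)
  constructor
  · refine h.transition (i := c) (Finset.empty_subset _) subset_rfl
      (fun a ha => Function.update_of_ne ha _ _)
      (fun a ha => by simp [ha]) (Or.inl h.act_root) (fun _ => Or.inl rfl) ?_ ?_ ?_ ?_ ?_ ?_
      (Or.inr ⟨p, hp, ?_⟩) ?_ ?_
    · simp [initSearch]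
    · simpa [initSearch] using h.alive c
    · intro c'
      rw [hsame _ (by simp), h.no_util]
    · intro c'
      rw [hsame _ (by simp), h.no_term]
    · intro c' hc' _
      exact hsame _ (by simpa using hc')
    · intro a j' d' _
      exact hsame _ (by simp)
    · simp only [Function.update_self]
      constructor
      · rintro (hf | hf | hf)
        · exact hf.elim
        · exact absurd hap hf
        · exact absurd hd (hf d)
      · intro _ _ d' hd'
        obtain rfl := hbusy d' hd'
        exact ⟨hb, Or.inr (Or.inl ⟨Or.inr trivial, hrest, rfl⟩)⟩
    · intro c' hc'
      dsimp only
      rw [hsame _ (by simpa using hne c' hc')]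
      exact ⟨fun _ => hsub c' hc', fun hn => absurd (mem_children.2 hc') hn⟩
    · intro j d'
      simp only [Function.update_self]
      rw [hsame _ (by simp)]
      exact ⟨fun _ => hreq0 j d', fun _ _ h' => absurd h' (Finset.notMem_empty d')⟩
  · intro v S hres
    have hbs : slotOf (⟨c, p, .backtrack v S⟩ : Packet A V) = .link c := rfl
    have hsame' : ∀ x, x ≠ .link c →
        slot (rest + {⟨c, p, .backtrack v S⟩}) x = slot s.net x := fun x hx => by
      rw [slot_add, hsame x hx, slot_singleton_of_ne (by rw [hbs]; exact hx.symm), add_zero]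
    refine h.transition (i := c) (Finset.empty_subset _) (Finset.empty_subset _)
      (fun a ha => Function.update_of_ne ha _ _)
      (fun a ha => rfl) h.act_root (fun _ => Or.inl rfl) ?_ ?_ ?_ ?_ ?_ ?_
      (Or.inr ⟨p, hp, ?_⟩) ?_ ?_
    · simp [initSearch]
    · simpa [initSearch] using h.alive c
    · intro c'
      rw [hsame' _ (by simp), h.no_util]
    · intro c'
      rw [hsame' _ (by simp), h.no_term]
    · intro c' hc' _
      exact hsame' _ (by simpa using hc')
    · intro a j' d' _
      exact hsame' _ (by simp)
    · constructor
      · rintro (hf | hf | hf)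
        · exact hf.elim
        · exact absurd hap hf
        · exact absurd hd (hf d)
      · intro _ _ d' hd'
        obtain rfl := hbusy d' hd'
        refine ⟨hb, Or.inr (Or.inr ⟨hnc, v, S, ?_, hres⟩)⟩
        rw [slot_add, hrest, zero_add, ← hbs, slot_singleton_self]
    · intro c' hc'
      dsimp only
      rw [hsame' _ (by simpa using hne c' hc')]
      exact ⟨fun _ => hsub c' hc', fun _ h' => absurd h' hnc⟩
    · intro j d'
      dsimp only
      rw [hsame' _ (by simp)]
      exact ⟨fun _ => hreq0 j d', fun h' => absurd h' hnc⟩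

theorem initSearch_not_done {c : A} {st : AgentState A V} {pa : PAssign A V} {B : ℝ≥0∞}
    (hne : T.children c ≠ ∅ ∨ T.allParents c ≠ ∅) (y : V) :
    ¬ Done P T c (initSearch P T c st pa B) y := by
  rintro ⟨_, h1, h2⟩
  rcases hne with hne | hne
  · exact hne (Finset.subset_empty.1 h1)
  · exact hne (Finset.subset_empty.1 h2)

theorem SearchInv.receiveCPA {s : Config A V} (h : SearchInv P T s) {q c : A}
    {pa : PAssign A V} {ub : ℝ≥0∞} {rest : Multiset (Packet A V)}
    (hnet : s.net = ⟨q, c, .cpa pa ub⟩ ::ₘ rest) :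
    LateInv P T ⟨Function.update s.agents c (onCPA P T c (s.agents c) q pa ub).1,
      rest + (onCPA P T c (s.agents c) q pa ub).2⟩ := by
  obtain ⟨Act, β, hB, hsearch⟩ := h
  have hso : slotOf (⟨q, c, .cpa pa ub⟩ : Packet A V) = .link c := rfl
  obtain ⟨p, d, hp, hap, hnc, hd, hb, hlink⟩ := hB.link_cases (hso ▸ slot_ne_zero hnet)
  obtain ⟨hpk, hrest⟩ : (⟨q, c, .cpa pa ub⟩ : Packet A V) =
      ⟨p, c, .cpa (Function.update (s.agents p).cpa p (some d)) (β c)⟩ ∧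
      slot rest (.link c) = 0 := by
    rw [← hso] at hlink ⊢
    rcases hlink with h1 | h1 | ⟨_, v, S, h1, _⟩
    · exact slot_deliver hnet h1.2
    · exact absurd h1.2.1 (slot_ne_zero hnet)
    · cases (slot_deliver hnet h1).1
  rw [hpk] at hnet
  have hq : q = p := by injection hpk
  have hpaub : pa = Function.update (s.agents p).cpa p (some d) ∧ ub = β c := by
    injection hpk with _ _ h3
    injection h3 with h4 h5
    exact ⟨h4, h5⟩
  obtain ⟨rfl, rfl⟩ := hpaub
  subst hq
  have hcoreq := (hsearch q hap).1
  have hcompat := hcoreq.compat_child hp (hcoreq.srch_spec c d hd.1).2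
  obtain ⟨hB1, hB2⟩ := hB.receiveCPA hnet hrest hp hap hnc hd hb
  set st := initSearch P T c (s.agents c) (Function.update (s.agents q).cpa q (some d)) (β c)
    with hst
  have hcore : Core P T c st (β c) (T.children c) :=
    core_initSearch hcompat (hB.util_known c)
  have hnd : ∀ y, ¬ Done P T c st y := initSearch_not_done
    (Or.inr (Finset.ne_empty_of_mem (parent_mem_allParents hp)))
  have hoth : ∀ a, a ≠ c → Act a → Searching P T a (Function.update s.agents c st a) (β a) :=
    fun a hac ha => by
      rw [Function.update_of_ne hac]
      exact hsearch a ha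
  have hfirst : ∀ y ∈ P.dom c, (∀ x, firstFeasible P T c st = some x → y < x) →
      Beaten P T c st (β c) y (lb P T c st y) := by
    intro y hy hlt
    left
    by_contra hcon
    push Not at hcon
    obtain ⟨x, hx, hxy⟩ := first_le
      (S := (P.dom c).filter (fun e => lb P T c st e < st.ub)) (Finset.mem_filter.2 ⟨hy, hcon⟩)
    exact absurd (hlt x hx) (not_lt.2 hxy)
  unfold onCPA
  dsimp only
  rw [← hst]
  cases hff : firstFeasible P T c st with
  | none =>
    dsimp only
    refine Or.inl ⟨Act, β, hB2 _ _ (Or.inr ⟨le_top, le_opt fun y hy => ?_⟩), fun a ha => ?_⟩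
    · have hbeat : ∀ x, Beaten P T c st (β c) y x → β c ≤ x := fun x hx =>
        hx.resolve_right fun ⟨e, _, he, _⟩ => hnd e he
      rcases hcore.exact_or y hy with h1 | ⟨h1, _⟩
      · refine (hbeat _ (hfirst y hy fun x hx => ?_)).trans (hcore.lb_le_optVal hy h1)
        rw [hff] at hx
        cases hx
      · exact hbeat _ h1
    · have hac : a ≠ c := by rintro rfl; exact hnc ha
      exact hoth a hac ha
  | some e =>
    dsimp only
    have := hB1.advance (i := c) (e := some e) subset_rfl (Or.inr rfl)
      (fun a ha hac => hoth a hac (ha.resolve_right hac)) (by simpa using hcore) ?_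
      (fun hl => Finset.nonempty_iff_ne_empty.2 hl) ?_ ?_ ?_ (fun _ => ⟨ne_root_of_parent hp, ?_, ?_⟩)
    · simpa using this
    · simp only [Function.update_self]
      exact fun x hx => absurd hx.1 (Finset.notMem_empty x)
    · simp only [Function.update_self]
      intro x hx
      rw [← hff] at hx
      exact firstFeasible_spec hx
    · simp only [Function.update_self]
      exact fun c' _ x y _ hy => absurd hy (Finset.notMem_empty c')
    · simp only [Function.update_self]
      exact fun c' _ y hy hlt => Or.inr (hfirst y hy fun x hx => hlt x (hff ▸ hx))
    · simp only [Function.update_self]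
      exact fun x _ y hy => absurd hy (Finset.notMem_empty y)
    · simp only [Function.update_self]
      exact fun y hy hlt => Or.inr (hfirst y hy fun x hx => hlt x (hff ▸ hx))

/-- The receipt of a BACKTRACK message, without the reaction to it. -/
theorem Base.receiveBacktrack {s : Config A V} {Act : A → Prop} {β : A → ℝ≥0∞}
    (h : Base P T s Act β ∅) {c p : A} {d : V} {v : ℝ≥0∞} {pa : PAssign A V}
    {rest : Multiset (Packet A V)} (hnet : s.net = ⟨c, p, .backtrack v pa⟩ ::ₘ rest)
    (hrest : slot rest (.link c) = 0) (hp : T.parent c = some p) (hap : Act p) (hnc : ¬ Act c)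
    (hcd : c ∉ (s.agents p).gotBack d) (hv : (s.agents p).lbc c d ≤ v) (u : ℝ≥0∞) :
    Base P T ⟨Function.update s.agents p { addBack (s.agents p) c d v pa with ub := u }, rest⟩
      Act β {c} := by
  have hso : slotOf (⟨c, p, .backtrack v pa⟩ : Packet A V) = .link c := rfl
  have hsame : ∀ x, x ≠ .link c → slot rest x = slot s.net x := fun x hx =>
    slot_rest_of_ne hnet (by rw [hso]; exact hx.symm)
  have hpc : p ≠ c := by rintro rfl; exact parent_ne_self _ hp
  refine h.transition (i := p) (Finset.empty_subset _) (by simpa using hp)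
    (fun a ha => Function.update_of_ne ha _ _) (fun _ _ => rfl) h.act_root (fun _ => Or.inl rfl)
    ?_ ?_ ?_ ?_ ?_ ?_ (Or.inl ⟨rfl, ?_, ?_⟩) ?_ ?_
  · simp [PTISABB.addBack]
  · simpa [PTISABB.addBack] using h.alive p
  · intro c'
    rw [hsame _ (by simp), h.no_util]
  · intro c'
    rw [hsame _ (by simp), h.no_term]
  · intro c' _ hc'
    refine hsame _ fun heq => hc' ?_
    injection heq with heq
    rw [heq, hp]
  · intro a j' d' _
    exact hsame _ (by simp)
  · simp [PTISABB.addBack]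
  · exact hsame _ (by simpa using hpc)
  · intro c' hc'
    simp only [Function.update_self]
    by_cases hcc : c' = c
    · subst hcc
      exact ⟨fun _ => ⟨hnc, hrest⟩, fun hn => absurd (Finset.mem_singleton_self _) hn⟩
    · have hl := h.link c' p hc'
      rw [hsame _ (by simpa using hcc)]
      constructor
      · rintro (hf | hf)
        · exact absurd (Finset.mem_singleton.1 hf) hcc
        · exact hl.1 (Or.inr hf)
      · intro _ _ d' hd'
        obtain ⟨h1, h2⟩ := hl.2 (Finset.notMem_empty c') hap d' hd'
        exact ⟨h1.mono (addBack_done (pa := pa) (mem_children.2 hp) hcd)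
          (addBack_lbc_of_ne (pa := pa) (Or.inl hcc)) le_rfl
          fun c'' _ => addBack_lbc_le (pa := pa) hv c'' d', h2⟩
  · intro j d'
    simp only [Function.update_self]
    rw [hsame _ (by simp)]
    exact h.req p j d'

theorem SearchInv.receiveBacktrack {s : Config A V} (h : SearchInv P T s) {c i : A} {v : ℝ≥0∞}
    {pa : PAssign A V} {rest : Multiset (Packet A V)}
    (hnet : s.net = ⟨c, i, .backtrack v pa⟩ ::ₘ rest) :
    LateInv P T ⟨Function.update s.agents i (onBacktrack P T i (s.agents i) c v pa).1,
      rest + (onBacktrack P T i (s.agents i) c v pa).2⟩ := by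
  obtain ⟨Act, β, hB, hsearch⟩ := h
  have hso : slotOf (⟨c, i, .backtrack v pa⟩ : Packet A V) = .link c := rfl
  obtain ⟨p, d, hp, hap, hnc, hd, hb, hlink⟩ := hB.link_cases (hso ▸ slot_ne_zero hnet)
  obtain ⟨v', S', hpk, hrest, hres⟩ : ∃ v' S', (⟨c, i, .backtrack v pa⟩ : Packet A V) =
      ⟨c, p, .backtrack v' S'⟩ ∧ slot rest (.link c) = 0 ∧
      Result P T c (Function.update (s.agents p).cpa p (some d)) (β c) v' S' := by
    rw [← hso] at hlink ⊢
    rcases hlink with h1 | h1 | ⟨_, v', S', h1, h2⟩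
    · cases (slot_deliver hnet h1.2).1
    · exact absurd h1.2.1 (slot_ne_zero hnet)
    · exact ⟨v', S', (slot_deliver hnet h1).1, (slot_deliver hnet h1).2, h2⟩
  have hi : i = p := by injection hpk
  have hvS : v = v' ∧ pa = S' := by
    injection hpk with _ _ h3
    injection h3 with h4 h5
    exact ⟨h4, h5⟩
  obtain ⟨rfl, rfl⟩ := hvS
  subst hi
  obtain ⟨hcore, hmode⟩ := hsearch i hap
  have hl : T.children i ≠ ∅ := Finset.ne_empty_of_mem (mem_children.2 hp)
  obtain ⟨_, _, hpend⟩ := hmode.resolve_right fun h' => hl h'.1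
  have hcd : c ∉ (s.agents i).gotBack d := fun h' =>
    lt_irrefl _ (hcore.gotBack_lt c d d (Finset.notMem_empty c) hd.1 h')
  have hle := lbc_le_of_result hcore hd.1 hb hres
  have hdom := (hcore.srch_spec c d hd.1).2
  have hdone := addBack_done (P := P) (v := v) (pa := pa) (mem_children.2 hp) hcd
  have hlb : ∀ e, lb P T i (s.agents i) e ≤ lb P T i (addBack (s.agents i) c d v pa) e := fun e =>
    lb_le_lb le_rfl fun c' _ => addBack_lbc_le hle c' e
  rw [onBacktrack_eq hd.1]
  dsimp only
  set st' := (if T.children i ⊆ (addBack (s.agents i) c d v pa).gotBack d then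
    lowerUb P T i (addBack (s.agents i) c d v pa) d else addBack (s.agents i) c d v pa) with hst'
  obtain ⟨hcore', u, hu⟩ : Core P T i st' (β i) {c} ∧
      ∃ u, st' = { addBack (s.agents i) c d v pa with ub := u } := by
    have hc := hcore.addBack hd.1 hd.2 hb hres
    rw [hst']
    split_ifs with hall
    · exact ⟨hc.lowerUb ⟨hdom, hall, hd.2⟩, _, rfl⟩
    · exact ⟨hc, (s.agents i).ub, rfl⟩
  clear_value st'
  subst hu
  have hgb : ∀ y, c ∈ (addBack (s.agents i) c d v pa).gotBack y → y ≤ d := by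
    intro y hy
    rcases (addBack_gotBack (v := v) (pa := pa) y c).1 hy with hy | ⟨_, rfl⟩
    · exact (hcore.gotBack_lt c d y (Finset.notMem_empty c) hd.1 hy).le
    · exact le_rfl
  have hB' := hB.receiveBacktrack hnet hrest hp hap hnc hcd hle u
  set st'' : AgentState A V := { addBack (s.agents i) c d v pa with ub := u } with hst''
  have := hB'.advance (i := i) (e := nextFeasible P T i st'' d) (by simpa using hp) hap
    (fun a ha hai => by
      dsimp only
      rw [Function.update_of_ne hai]
      exact hsearch a ha) (by simpa using hcore') ?_ (fun _ => Finset.singleton_nonempty c)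
      ?_ ?_ ?_ (fun h' => absurd h' hl)
  · simpa using this
  · simp only [Function.update_self]
    intro x hx
    obtain ⟨c', hc'⟩ := hpend x hx
    refine ⟨c', fun hcc => ?_, hc'⟩
    rw [Finset.mem_singleton.1 hcc] at hc'
    obtain rfl : d = x := Option.some_injective _ (hd.1.symm.trans hc')
    exact hx.2 hd.2
  · simp only [Function.update_self]
    exact fun x hx => ⟨(nextFeasible_spec hx).1, (nextFeasible_spec hx).2.2⟩
  · simp only [Function.update_self]
    intro c' hc' x y hx hy
    rw [Finset.mem_singleton.1 hc'] at hy
    exact (hgb y hy).trans_lt (nextFeasible_spec hx).2.1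
  · simp only [Function.update_self]
    intro c' hc' y hy hlt
    rw [Finset.mem_singleton.1 hc']
    refine nextFeasible_passed hcore' (fun y => c ∈ st''.gotBack y) (fun y hy hyd => ?_)
      (fun y hy => hgb y (hy.2.1 (mem_children.2 hp))) hy hlt
    rcases hyd.eq_or_lt with rfl | hyd
    · exact Or.inl ((addBack_gotBack (v := v) (pa := pa) _ c).2 (Or.inr ⟨rfl, rfl⟩))
    · rcases hcore.passed c y hp (Finset.notMem_empty c) hy fun x hx => by
          obtain rfl : d = x := Option.some_injective _ (hd.1.symm.trans hx)
          exact hyd with h1 | h1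
      · exact Or.inl ((addBack_gotBack (v := v) (pa := pa) y c).2 (Or.inl h1))
      · exact Or.inr (h1.mono hdone (hlb y))

theorem FinalInv.step {k : ℕ∞} {s s' : Config A V} (h : FinalInv P T s)
    (hs : Step P T k s s') : FinalInv P T s' := by
  obtain ⟨⟨j, i, m⟩, rest, hnet, rfl⟩ := hs
  have hm : m = .terminate := h.net ⟨j, i, m⟩ (by rw [hnet]; exact Multiset.mem_cons_self _ _)
  subst hm
  simp only [handle, onTerminate]
  refine ⟨?_, ?_, ?_, ?_⟩
  · by_cases hi : T.root = i
    · subst hi; simp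
    · dsimp only
      rw [Function.update_of_ne hi]
      exact h.root
  · intro p hp
    rcases Multiset.mem_add.1 hp with hp | hp
    · exact h.net p (by rw [hnet]; exact Multiset.mem_cons_of_mem hp)
    · obtain ⟨c, _, rfl⟩ := Multiset.mem_map.1 hp
      rfl
  · intro c p hc hp
    dsimp only at hp ⊢
    by_cases hci : c = i
    · subst hci
      left
      simp
    · rw [Function.update_of_ne hci]
      by_cases hpi : p = i
      · subst hpi
        exact Or.inr ⟨⟨p, c, .terminate⟩, Multiset.mem_add.2 (Or.inr
          (Multiset.mem_map.2 ⟨c, mem_children.2 hc, rfl⟩)), rfl⟩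
      · rw [Function.update_of_ne hpi] at hp
        rcases h.child c p hc hp with h1 | ⟨q, hq, hqc⟩
        · exact Or.inl h1
        · rw [hnet] at hq
          rcases Multiset.mem_cons.1 hq with rfl | hq
          · exact absurd hqc.symm hci
          · exact Or.inr ⟨q, Multiset.mem_add.2 (Or.inl hq), hqc⟩
  · obtain ⟨x, hx, hans⟩ := h.solution
    refine ⟨x, hx, hans ▸ ?_⟩
    unfold answer
    dsimp only
    by_cases hi : T.root = i
    · subst hi
      rw [Function.update_self]
      rfl
    · rw [Function.update_of_ne hi]

theorem LateInv.step {k : ℕ∞} {s s' : Config A V} (h : LateInv P T s)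
    (hs : Step P T k s s') : LateInv P T s' := by
  rcases h with h | h
  · obtain ⟨⟨j, i, m⟩, rest, hnet, rfl⟩ := hs
    cases m with
    | util u =>
      obtain ⟨Act, β, hB, _⟩ := h
      exact absurd (hB.no_util j) (slot_ne_zero hnet)
    | cpa pa ub => exact h.receiveCPA hnet
    | costReq d => exact Or.inl (h.costReq hnet)
    | cost d v => exact h.cost hnet
    | backtrack v pa => exact h.receiveBacktrack hnet
    | terminate =>
      obtain ⟨Act, β, hB, _⟩ := h
      exact absurd (hB.no_term i) (slot_ne_zero hnet)
  · exact Or.inr (h.step hs)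

/-- There is always a message in transit during the search phase. -/
theorem SearchInv.net_ne_zero {s : Config A V} (h : SearchInv P T s) : s.net ≠ 0 := by
  obtain ⟨Act, β, hB, hsearch⟩ := h
  intro hnet
  have hslot : ∀ x, slot s.net x = 0 := fun x => by rw [hnet, slot_zero]
  refine tree_induction_up (T := T) (motive := fun i => ¬ Act i) (fun i ih hact => ?_) T.root
    hB.act_root
  obtain ⟨hcore, hmode⟩ := hsearch i hact
  have hno : ∀ d, ¬ Pending P T i (s.agents i) d := by
    rintro d ⟨h1, h2⟩
    obtain ⟨j, hj, hjd⟩ := Finset.not_subset.1 h2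
    rcases (hB.req i j d).2 hact hj h1 hjd with h3 | h3
    · rw [hslot] at h3
      exact Multiset.singleton_ne_zero _ h3.symm
    · rw [hslot] at h3
      exact Multiset.singleton_ne_zero _ h3.symm
  rcases hmode with ⟨_, ⟨c, d, hc⟩, _⟩ | ⟨_, d, hd, _⟩
  · have hbusy : Busy P T i (s.agents i) c d := by
      refine ⟨hc, ?_⟩
      by_contra hn
      exact hno d ⟨hcore.requested_of_srch c d (Finset.notMem_empty c) hc hn, hn⟩
    have hp := (hcore.srch_spec c d hc).1
    obtain ⟨_, h2⟩ := (hB.link c i hp).2 (Finset.notMem_empty c) hact d hbusy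
    rcases h2 with h2 | h2 | ⟨_, v, S, h2, _⟩
    · rw [hslot] at h2
      exact Multiset.singleton_ne_zero _ h2.2.symm
    · exact ih c hp h2.1
    · rw [hslot] at h2
      exact Multiset.singleton_ne_zero _ h2.symm
  · exact hno d hd

theorem FinalInv.all_terminated {s : Config A V} (h : FinalInv P T s) (hnet : s.net = 0) (i : A) :
    (s.agents i).terminated := by
  refine tree_induction (T := T) (motive := fun i => (s.agents i).terminated) h.root
    (fun c p hc hp => ?_) i
  rcases h.child c p hc hp with h1 | ⟨q, hq, _⟩
  · exact h1
  · rw [hnet] at hq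
    exact absurd hq (Multiset.notMem_zero q)

end Deliver

section Inference

variable {A V : Type*} [Fintype A] [DecidableEq A] [LinearOrder V]
  {P : ADCOP A V} {T : PseudoTree P.graph}

/-- All UTIL messages for `i` have arrived. -/
def Ready (P : ADCOP A V) (T : PseudoTree P.graph) (i : A) (st : AgentState A V) : Prop :=
  ∀ c ∈ T.children i, (st.childUtil c).isSome

theorem inferenceStep_of_not_ready {k : ℕ∞} {i : A} {st : AgentState A V}
    (h : ¬ Ready P T i st) : inferenceStep P T k i st = (st, 0) := if_neg h

theorem inferenceStep_root {k : ℕ∞} {st : AgentState A V} (h : Ready P T T.root st) :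
    inferenceStep P T k T.root st = startSearch P T T.root st := by
  refine (if_pos h).trans ?_
  rw [parent_root]

theorem inferenceStep_node {k : ℕ∞} {i p : A} {st : AgentState A V} (h : Ready P T i st)
    (hp : T.parent i = some p)
    (hk : ∀ c u, T.parent c = some i → st.childUtil c = some u → ChildBound P T c u) :
    ∃ u, MsgBound P T i u ∧ inferenceStep P T k i st = (st, {⟨i, p, .util u⟩}) := by
  have hc : ∀ c, T.parent c = some i → ∃ u, st.childUtil c = some u ∧ ChildBound P T c u := by
    intro c hc
    obtain ⟨u, hu⟩ := Option.isSome_iff_exists.1 (h c (mem_children.2 hc))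
    exact ⟨u, hu, hk c u hc hu⟩
  refine ⟨_, msgBound_dropDims (k := k) (msgBound_inference hc
    ((localUtil P T i).dims ∪
      (T.children i).biUnion fun c => ((st.childUtil c).getD Util.zero).dims)),
    (if_pos h).trans ?_⟩
  rw [hp]

/-- The start of the search phase. -/
theorem lateInv_startSearch {s : Config A V} (hnet : s.net = 0)
    (halive : ∀ i, ¬ (s.agents i).terminated)
    (hu : ∀ i c, T.parent c = some i →
      ∃ u, (s.agents i).childUtil c = some u ∧ ChildBound P T c u) :
    LateInv P T ⟨Function.update s.agents T.root (startSearch P T T.root (s.agents T.root)).1,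
      s.net + (startSearch P T T.root (s.agents T.root)).2⟩ := by
  set st := initSearch P T T.root (s.agents T.root) (fun _ => none) ⊤ with hst
  have hcompat : ∃ z, Compat P T T.root (fun _ => none) z := by
    have hne : ∀ i, ∃ d, d ∈ P.dom i := P.dom_nonempty
    choose z hz using hne
    exact ⟨z, hz, fun j hj => absurd hj (not_isAncestor_root j)⟩
  have hcore : Core P T T.root st ⊤ (T.children T.root) :=
    core_initSearch hcompat (hu T.root)
  have hslot : ∀ x, slot s.net x = 0 := fun x => by rw [hnet, slot_zero]
  by_cases hl : T.children T.root = ∅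
  · have hs : startSearch P T T.root (s.agents T.root) = finish P T T.root st := if_pos hl
    rw [hs]
    rw [hl] at hcore
    exact Or.inr (finalInv_of_finish (fun i _ => halive i) hnet
      (result_of_exhausted hcore (fun _ _ => rfl) fun _ e _ => Or.inl (by
        rw [allParents_root]; exact Finset.empty_subset _)))
  · have hs : startSearch P T T.root (s.agents T.root) =
        advance P T T.root st (T.children T.root) (first (P.dom T.root)) := if_neg hl
    have hag : ∀ a, a ≠ T.root → Function.update s.agents T.root st a = s.agents a := fun a ha =>
      Function.update_of_ne ha _ _
    have hB : Base P T ⟨Function.update s.agents T.root st, s.net⟩ (fun a => a = T.root)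
        (fun _ => ⊤) (T.children T.root) := by
      refine ⟨fun i c hc => ?_, fun i => ?_, rfl, rfl, fun _ => hslot _, fun _ => hslot _, hslot _,
        fun c p hc => ⟨fun _ => ⟨ne_root_of_parent hc, hslot _⟩, fun hn hp => ?_⟩,
        fun i j d => ⟨fun _ => hslot _, fun hi hj => ?_⟩⟩
      · dsimp only
        by_cases hi : i = T.root
        · subst hi
          rw [Function.update_self]
          exact hu _ c hc
        · rw [hag i hi]
          exact hu i c hc
      · dsimp only
        by_cases hi : i = T.root
        · subst hi
          rw [Function.update_self]
          exact halive _
        · rw [hag i hi]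
          exact halive i
      · subst hp
        exact absurd (mem_children.2 hc) hn
      · subst hi
        rw [allParents_root] at hj
        exact absurd hj (Finset.notMem_empty j)
    have hlb : ∀ x, lb P T T.root st x < ⊤ := by
      intro x
      refine ENNReal.add_lt_top.2 ⟨ENNReal.coe_lt_top, ENNReal.sum_lt_top.2 fun c _ => ?_⟩
      exact ENNReal.coe_lt_top
    have hle : ∀ y ∈ P.dom T.root, ¬ ∀ x, first (P.dom T.root) = some x → y < x := by
      intro y hy hlt
      obtain ⟨x, hx, hxy⟩ := first_le hy
      exact absurd (hlt x hx) (not_lt.2 hxy)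
    have := hB.advance (i := T.root) (e := first (P.dom T.root)) subset_rfl rfl
      (fun j hj hjr => absurd hj hjr) (by simpa using hcore) ?_
      (fun hl => Finset.nonempty_iff_ne_empty.2 hl) ?_ ?_ ?_ (fun h' => absurd h' hl)
    · rw [hs]
      simpa using this
    · simp only [Function.update_self]
      exact fun x hx => absurd hx.1 (Finset.notMem_empty x)
    · simp only [Function.update_self]
      exact fun x hx => ⟨first_mem hx, hlb x⟩
    · simp only [Function.update_self]
      exact fun c' _ x y _ hy => absurd hy (Finset.notMem_empty c')
    · exact fun c' _ y hy hlt => absurd hlt (hle y hy)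

/-- The invariant of the UTIL message from `c` to its parent `p`; here `o` is the table of `c` stored
by `p`. -/
def UtilInv (P : ADCOP A V) (T : PseudoTree P.graph) (p c : A) (ready : Prop)
    (o : Option (Util A V)) (M : Multiset (Packet A V)) : Prop :=
  (¬ ready → o = none ∧ M = 0) ∧
  (ready → (o = none ∧ ∃ u, M = {⟨c, p, .util u⟩} ∧ MsgBound P T c u) ∨ (o.isSome ∧ M = 0))

/-- The invariant of the inference phase while `i` has not reacted to the last message. -/
structure InferBase (P : ADCOP A V) (T : PseudoTree P.graph) (s : Config A V) (i : A) :
    Prop where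
  alive : ∀ i, ¬ (s.agents i).terminated
  no_link : ∀ c, slot s.net (.link c) = 0
  no_req : ∀ i j d, slot s.net (.req i j d) = 0
  no_term : ∀ c, slot s.net (.term c) = 0
  util_root : slot s.net (.util T.root) = 0
  known : ∀ i c u, T.parent c = some i → (s.agents i).childUtil c = some u → ChildBound P T c u
  util : ∀ c p, T.parent c = some p → c ≠ i →
    UtilInv P T p c (Ready P T c (s.agents c)) ((s.agents p).childUtil c) (slot s.net (.util c))
  util_self : ∀ p, T.parent i = some p →
    (s.agents p).childUtil i = none ∧ slot s.net (.util i) = 0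

variable (P T) in
/-- The invariant of the inference phase. -/
def InferInv (s : Config A V) : Prop :=
  InferBase P T s T.root ∧ ¬ Ready P T T.root (s.agents T.root)

theorem InferBase.step {k : ℕ∞} {s : Config A V} {i : A} (h : InferBase P T s i)
    (hroot : i ≠ T.root → ¬ Ready P T T.root (s.agents T.root)) :
    InferInv P T ⟨Function.update s.agents i (inferenceStep P T k i (s.agents i)).1,
      s.net + (inferenceStep P T k i (s.agents i)).2⟩ ∨
    LateInv P T ⟨Function.update s.agents i (inferenceStep P T k i (s.agents i)).1,
      s.net + (inferenceStep P T k i (s.agents i)).2⟩ := by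
  have hpr : ∀ p, T.parent T.root = some p →
      (s.agents p).childUtil T.root = none ∧ slot s.net (.util T.root) = 0 := by
    intro p hp
    rw [parent_root] at hp
    cases hp
  by_cases hr : Ready P T i (s.agents i)
  · by_cases hi : i = T.root
    · subst hi
      right
      rw [inferenceStep_root hr]
      have hall : ∀ i, Ready P T i (s.agents i) := fun i => by
        refine tree_induction (T := T) (motive := fun i => Ready P T i (s.agents i)) hr
          (fun c p hc hp => ?_) i
        have hsome := hp c (mem_children.2 hc)
        by_contra hn
        rw [((h.util c p hc (ne_root_of_parent hc)).1 hn).1] at hsome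
        cases hsome
      refine lateInv_startSearch (eq_zero_of_slots fun x => ?_) h.alive fun i c hc => ?_
      · cases x with
        | link c => exact h.no_link c
        | req i j d => exact h.no_req i j d
        | term c => exact h.no_term c
        | util c =>
          by_cases hc : c = T.root
          · rw [hc]; exact h.util_root
          · obtain ⟨p, hp⟩ := exists_parent hc
            rcases (h.util c p hp hc).2 (hall c) with h1 | h1
            · have := hall p c (mem_children.2 hp)
              rw [h1.1] at this
              cases this
            · exact h1.2
      · obtain ⟨u, hu⟩ := Option.isSome_iff_exists.1 (hall i c (mem_children.2 hc))
        exact ⟨u, hu, h.known i c u hc hu⟩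
    · left
      obtain ⟨p, hp⟩ := exists_parent hi
      obtain ⟨u, hu, hstep⟩ := inferenceStep_node (k := k) hr hp (h.known i)
      rw [hstep]
      simp only [Function.update_eq_self]
      have hso : slotOf (⟨i, p, .util u⟩ : Packet A V) = .util i := rfl
      have hsame : ∀ x, x ≠ .util i → slot (s.net + {⟨i, p, .util u⟩}) x = slot s.net x := by
        intro x hx
        rw [slot_add, slot_singleton_of_ne (by rw [hso]; exact hx.symm), add_zero]
      refine ⟨⟨h.alive, fun c => ?_, fun i j d => ?_, fun c => ?_, ?_, h.known, fun c q hc _ => ?_,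
        fun q hq => ?_⟩, hroot hi⟩
      · rw [hsame _ (by simp)]; exact h.no_link c
      · rw [hsame _ (by simp)]; exact h.no_req i j d
      · rw [hsame _ (by simp)]; exact h.no_term c
      · rw [hsame _ (by simpa using fun h' => hi h'.symm)]; exact h.util_root
      · by_cases hci : c = i
        · subst hci
          obtain rfl : p = q := Option.some_injective _ (hp.symm.trans hc)
          obtain ⟨h1, h2⟩ := h.util_self p hp
          refine ⟨fun hn => absurd hr hn, fun _ => Or.inl ⟨h1, u, ?_, hu⟩⟩
          rw [slot_add, h2, zero_add, ← hso, slot_singleton_self]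
        · dsimp only
          rw [hsame _ (by simpa using hci)]
          exact h.util c q hc hci
      · rw [parent_root] at hq; cases hq
  · left
    rw [inferenceStep_of_not_ready hr]
    simp only [Function.update_eq_self, add_zero]
    refine ⟨{ h with
      util := fun c p hc _ => ?_
      util_self := hpr }, fun hr' => ?_⟩
    · by_cases hci : c = i
      · subst hci
        exact ⟨fun _ => h.util_self p hc, fun hr' => absurd hr' hr⟩
      · exact h.util c p hc hci
    · by_cases hi : i = T.root
      · subst hi; exact hr hr'
      · exact hroot hi hr'

theorem InferInv.step {k : ℕ∞} {s s' : Config A V} (h : InferInv P T s)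
    (hs : Step P T k s s') : InferInv P T s' ∨ LateInv P T s' := by
  obtain ⟨⟨c, i, m⟩, rest, hnet, rfl⟩ := hs
  obtain ⟨h, hroot⟩ := h
  cases m with
  | cpa pa ub => exact absurd (h.no_link i) (slot_ne_zero hnet)
  | costReq d => exact absurd (h.no_req c i d) (slot_ne_zero hnet)
  | cost d v => exact absurd (h.no_req i c d) (slot_ne_zero hnet)
  | backtrack v pa => exact absurd (h.no_link c) (slot_ne_zero hnet)
  | terminate => exact absurd (h.no_term i) (slot_ne_zero hnet)
  | util u =>
    have hso : slotOf (⟨c, i, .util u⟩ : Packet A V) = .util c := rfl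
    have hne : slot s.net (.util c) ≠ 0 := hso ▸ slot_ne_zero hnet
    have hcr : c ≠ T.root := by rintro rfl; exact hne h.util_root
    obtain ⟨p, hp⟩ := exists_parent hcr
    have hui := h.util c p hp hcr
    have hrc : Ready P T c (s.agents c) := by
      by_contra hn
      exact hne (hui.1 hn).2
    obtain ⟨hnone, u', hM, hu'⟩ := (hui.2 hrc).resolve_right fun h' => hne h'.2
    rw [← hso] at hM
    obtain ⟨hpk, hrest⟩ := slot_deliver hnet hM
    obtain rfl : i = p := by injection hpk
    obtain rfl : u = u' := by
      injection hpk with _ _ h3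
      injection h3
    have hsame : ∀ x, x ≠ .util c → slot rest x = slot s.net x := fun x hx =>
      slot_rest_of_ne hnet (by rw [hso]; exact hx.symm)
    have hci : c ≠ i := by rintro rfl; exact parent_ne_self _ hp
    have hnr : ¬ Ready P T i (s.agents i) := fun hr => by
      have := hr c (mem_children.2 hp)
      rw [hnone] at this
      cases this
    set st : AgentState A V := { s.agents i with
      childUtil := Function.update (s.agents i).childUtil c
        (some (P.minProj {c} (u.join (P.costTable i c)))) } with hst
    have hag : ∀ a, a ≠ i → Function.update s.agents i st a = s.agents a := fun a ha =>
      Function.update_of_ne ha _ _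
    have hB : InferBase P T ⟨Function.update s.agents i st, rest⟩ i := by
      refine ⟨fun a => ?_, fun c' => ?_, fun i' j d => ?_, fun c' => ?_, ?_, fun a c' v hc' hv => ?_,
        fun c' q hc' hci' => ?_, fun q hq => ?_⟩
      · dsimp only
        by_cases ha : a = i
        · subst ha
          rw [Function.update_self]
          exact h.alive a
        · rw [hag a ha]
          exact h.alive a
      · rw [hsame _ (by simp)]; exact h.no_link c'
      · rw [hsame _ (by simp)]; exact h.no_req i' j d
      · rw [hsame _ (by simp)]; exact h.no_term c'
      · rw [hsame _ (by simpa using hcr.symm)]; exact h.util_root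
      · dsimp only at hv
        by_cases ha : a = i
        · subst ha
          rw [Function.update_self] at hv
          by_cases hcc : c' = c
          · subst hcc
            simp only [hst, Function.update_self] at hv
            cases hv
            exact childBound_minProj hp hu'
          · simp only [hst, Function.update_of_ne hcc] at hv
            exact h.known a c' v hc' hv
        · rw [hag a ha] at hv
          exact h.known a c' v hc' hv
      · dsimp only
        rw [hag c' hci']
        by_cases hcc : c' = c
        · subst hcc
          obtain rfl : i = q := Option.some_injective _ (hp.symm.trans hc')
          rw [Function.update_self]
          exact ⟨fun hn => absurd hrc hn, fun _ => Or.inr ⟨by simp [hst], hrest⟩⟩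
        · rw [hsame _ (by simpa using hcc)]
          have huc := h.util c' q hc' (ne_root_of_parent hc')
          by_cases hq : q = i
          · subst hq
            rw [Function.update_self]
            simp only [hst, Function.update_of_ne hcc]
            exact huc
          · rw [hag q hq]
            exact huc
      · have hqi : q ≠ i := by rintro rfl; exact parent_ne_self _ hq
        dsimp only
        rw [hag q hqi, hsame _ (by simpa using hci.symm)]
        exact (h.util i q hq (ne_root_of_parent hq)).1 hnr
    have := hB.step (k := k) fun hir => by
      dsimp only
      rw [hag _ hir.symm]
      exact hroot
    simp only [Function.update_self, Function.update_idem] at this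
    exact this

theorem InferInv.net_ne_zero {s : Config A V} (h : InferInv P T s) : s.net ≠ 0 := by
  intro hnet
  refine h.2 (tree_induction_up (T := T) (motive := fun i => Ready P T i (s.agents i))
    (fun i ih c hc => ?_) T.root)
  rw [mem_children] at hc
  rcases (h.1.util c i hc (ne_root_of_parent hc)).2 (ih c hc) with ⟨_, u, hM, _⟩ | h1
  · rw [hnet, slot_zero] at hM
    exact absurd hM.symm (Multiset.singleton_ne_zero _)
  · exact h1.1

theorem slot_sum (g : A → Multiset (Packet A V)) (x : Slot A V) :
    slot (∑ i, g i) x = ∑ i, slot (g i) x :=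
  map_sum (⟨⟨fun m => slot m x, slot_zero x⟩, fun m m' => slot_add m m' x⟩ :
    Multiset (Packet A V) →+ Multiset (Packet A V)) g Finset.univ

theorem initConfig_inv (k : ℕ∞) :
    InferInv P T (initConfig P T k) ∨ LateInv P T (initConfig P T k) := by
  by_cases hl : T.children T.root = ∅
  · right
    have hall : ∀ i, i = T.root := by
      intro i
      rcases inSubtree_root (T := T) i with h | h
      · exact h
      · obtain ⟨c, hc, _⟩ := isAncestor_iff_child.1 h
        exact absurd (mem_children.2 hc) (by rw [hl]; exact Finset.notMem_empty c)
    have hr : Ready P T T.root (AgentState.blank : AgentState A V) := by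
      intro c hc
      rw [hl] at hc
      exact absurd hc (Finset.notMem_empty c)
    have key := lateInv_startSearch (P := P) (T := T)
      (s := ⟨fun _ => AgentState.blank, 0⟩) rfl (fun _ h => h) fun i c hc =>
        absurd (hall c) (ne_root_of_parent hc)
    have huniv : (Finset.univ : Finset A) = {T.root} := by
      ext i
      simp [hall i]
    have heq : initConfig P T k = ⟨Function.update (fun _ => AgentState.blank) T.root
        (startSearch P T T.root AgentState.blank).1,
        0 + (startSearch P T T.root AgentState.blank).2⟩ := by
      unfold initConfig
      congr 1
      · funext i
        obtain rfl := hall i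
        rw [Function.update_self, inferenceStep_root hr]
      · rw [huniv, Finset.sum_singleton, inferenceStep_root hr, zero_add]
    rw [heq]
    exact key
  · left
    have hready : ∀ i, Ready P T i (AgentState.blank : AgentState A V) ↔ T.children i = ∅ := by
      intro i
      constructor
      · intro h
        by_contra hne
        obtain ⟨c, hc⟩ := Finset.nonempty_iff_ne_empty.2 hne
        have := h c hc
        simp [AgentState.blank] at this
      · intro h c hc
        rw [h] at hc
        exact absurd hc (Finset.notMem_empty c)
    have hnone : ∀ i, T.children i ≠ ∅ →
        inferenceStep P T k i AgentState.blank = (AgentState.blank, 0) := fun i hi =>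
      inferenceStep_of_not_ready (mt (hready i).1 hi)
    have hleaf : ∀ i p, T.children i = ∅ → T.parent i = some p → ∃ u, MsgBound P T i u ∧
        inferenceStep P T k i AgentState.blank = (AgentState.blank, {⟨i, p, .util u⟩}) :=
      fun i p hi hp => inferenceStep_node ((hready i).2 hi) hp fun c u _ hu => by cases hu
    have hag : ∀ i, (initConfig P T k).agents i = AgentState.blank := by
      intro i
      simp only [initConfig]
      by_cases hi : T.children i = ∅
      · obtain ⟨p, hp⟩ := exists_parent (i := i) (T := T) (by rintro rfl; exact hl hi)
        obtain ⟨u, _, h⟩ := hleaf i p hi hp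
        rw [h]
      · rw [hnone i hi]
    have hother : ∀ i x, x ≠ .util i →
        slot (inferenceStep P T k i AgentState.blank).2 x = 0 := by
      intro i x hx
      by_cases hi : T.children i = ∅
      · obtain ⟨p, hp⟩ := exists_parent (i := i) (T := T) (by rintro rfl; exact hl hi)
        obtain ⟨u, _, h⟩ := hleaf i p hi hp
        rw [h]
        exact slot_singleton_of_ne fun h' => hx h'.symm
      · rw [hnone i hi]
        exact slot_zero x
    have hslot : ∀ x, (∀ i, x ≠ .util i) → slot (initConfig P T k).net x = 0 := by
      intro x hx
      simp only [initConfig]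
      rw [slot_sum]
      exact Finset.sum_eq_zero fun i _ => hother i x (hx i)
    have hutil : ∀ c, slot (initConfig P T k).net (.util c) =
        slot (inferenceStep P T k c AgentState.blank).2 (.util c) := by
      intro c
      simp only [initConfig]
      rw [slot_sum]
      refine Finset.sum_eq_single c (fun i _ hi => hother i _ ?_) fun h =>
        absurd (Finset.mem_univ c) h
      intro heq
      injection heq with heq
      exact hi heq.symm
    refine ⟨⟨fun i => ?_, fun c => hslot _ (by simp), fun i j d => hslot _ (by simp),
      fun c => hslot _ (by simp), ?_, fun i c u _ hu => ?_, fun c p hc _ => ?_, fun p hp => ?_⟩, ?_⟩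
    · rw [hag]
      exact id
    · rw [hutil, hnone _ hl, slot_zero]
    · rw [hag] at hu
      cases hu
    · rw [hag, hag, hutil]
      constructor
      · intro hn
        refine ⟨rfl, ?_⟩
        rw [hnone c (mt (hready c).2 hn), slot_zero]
      · intro hr
        obtain ⟨u, hu, h⟩ := hleaf c p ((hready c).1 hr) hc
        refine Or.inl ⟨rfl, u, ?_, hu⟩
        rw [h]
        exact slot_singleton_self _
    · rw [parent_root] at hp
      cases hp
    · rw [hag]
      exact mt (hready _).1 hl

theorem reachable_inv {k : ℕ∞} {s : Config A V} (h : Reachable P T k s) :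
    InferInv P T s ∨ LateInv P T s := by
  induction h with
  | refl => exact initConfig_inv k
  | tail _ hs ih =>
    rcases ih with ih | ih
    · exact ih.step hs
    · exact Or.inr (ih.step hs)

theorem all_terminated_of_stuck {k : ℕ∞} {s : Config A V} (h : Reachable P T k s)
    (hs : ¬ ∃ s', Step P T k s s') (i : A) : (s.agents i).terminated := by
  have hnet : s.net = 0 := by
    by_contra hne
    obtain ⟨p, hp⟩ := Multiset.exists_mem_of_ne_zero hne
    obtain ⟨rest, hrest⟩ := Multiset.exists_cons_of_mem hp
    exact hs ⟨_, p, rest, hrest, rfl⟩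
  rcases reachable_inv h with h | h | h
  · exact absurd hnet h.net_ne_zero
  · exact absurd hnet h.net_ne_zero
  · exact h.all_terminated hnet i

theorem exists_solution_of_terminated {k : ℕ∞} {s : Config A V} (h : Reachable P T k s)
    (hs : (s.agents T.root).terminated) :
    ∃ x : A → V, P.IsSolution x ∧ answer P T s = fun i => some (x i) := by
  rcases reachable_inv h with h | ⟨_, _, h, _⟩ | h
  · exact absurd hs (h.1.alive _)
  · exact absurd hs (h.alive _)
  · exact h.solution

end Inference

end PTISABB

end

theorem theorem4p1 {A V : Type*} [Fintype A] [DecidableEq A] [LinearOrder V]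
    (P : PTISABB.ADCOP A V) (T : PTISABB.PseudoTree P.graph) (k : ℕ∞) :
    -- every asynchronous execution is finite
    (¬ ∃ e : ℕ → PTISABB.Config A V, e 0 = PTISABB.initConfig P T k ∧
        ∀ n, PTISABB.Step P T k (e n) (e (n + 1))) ∧
    -- an execution can only stop with all agents terminated
    (∀ s, PTISABB.Reachable P T k s → (¬ ∃ s', PTISABB.Step P T k s s') →
        ∀ i, (s.agents i).terminated) ∧
    -- once the root has terminated, its answer is a complete assignment of minimal cost
    (∀ s, PTISABB.Reachable P T k s → (s.agents T.root).terminated →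
        ∃ x : A → V, P.IsSolution x ∧ PTISABB.answer P T s = fun i => some (x i)) := by
  refine ⟨?_, ?_, ?_⟩
  · rintro ⟨e, h0, hstep⟩
    exact PTISABB.no_infinite_execution k e h0 hstep
  · intro s hs hstuck i
    exact PTISABB.all_terminated_of_stuck hs hstuck i
  · intro s hs ht
    exact PTISABB.exists_solution_of_terminated hs ht
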